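/- **Setting.** Work in three-dimensional Minkowski space with metric $\eta=\mathrm{diag}(-1,1,1)$; round (square) brackets denote strength-one symmetrization (antisymmetrization); $\varepsilon^{\mu\nu\rho}$ is the Levi-Civita density. Let $N\ge 0$. The variables are the completely symmetric fields $h^a_{\mu\nu\rho}$, the symmetric traceless ghosts $C^a_{\mu\nu}$, the completely symmetric antifields $h_a^{*\mu\nu\rho}$ and the symmetric traceless antifields $C_a^{*\mu\nu}$ ($a=1,\dots,N$), of ghost numbers $0,1,-1,-2$ and antighost numbers $0,0,1,2$; their Grassmann parity is the ghost number mod $2$. Internal indices are raised and lowered with $\delta_{ab}$, and traces are $h^a_\mu=\eta^{\nu\rho}h^a_{\mu\nu\rho}$, $h_a^{*\mu}=\eta_{\nu\rho}h_a^{*\mu\nu\rho}$. Local functions are smooth in the $h$'s and finitely many of their derivatives, and polynomial in the ghosts, the antifields and their derivatives, without explicit dependence on the coordinates. Let $\gamma,\delta$ be the odd (left) derivations of the algebra of local functions which commute with the total derivatives $\partial_\mu$, vanish on all variables except $$\gamma h^a_{\mu\nu\rho}=3\,\partial_{(\mu}C^a_{\nu\rho)},\qquad \delta h_a^{*\mu\nu\rho}=G_a^{\mu\nu\rho},\qquad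 \delta C_a^{*\mu\nu}=-3\big(\partial_\rho h_a^{*\mu\nu\rho}-\tfrac13\eta^{\mu\nu}\partial_\rho h_a^{*\rho}\big),$$ where $G_{\mu\nu\rho}=F_{\mu\nu\rho}-\tfrac32\eta_{(\mu\nu}F_{\rho)}$, $F_{\mu\nu\rho}=\Box h_{\mu\nu\rho}-3\partial^\sigma\partial_{(\mu}h_{\nu\rho)\sigma}+3\partial_{(\mu}\partial_\nu h_{\rho)}$, $F_\mu=\eta^{\nu\rho}F_{\mu\nu\rho}$. Put $T^a_{\nu\rho|\beta}=\partial_{[\nu}C^a_{\rho]\beta}$. Let $f^a{}_{bc}=-f^a{}_{cb}$ be real constants, $f_{abc}=\delta_{ad}f^d{}_{bc}$, and let $\mathcal A$ be the anticommutative algebra $\mathbb R^N$ with product $(xy)^a=f^a{}_{bc}x^by^c$. Let (omitting the factor $d^3x$) $$a_2=f^a{}_{bc}\,\varepsilon^{\mu\nu\rho}\,C_a^{*\alpha\beta}\,C^b_{\mu\alpha}\,\partial_{[\nu}C^c_{\rho]\beta}.$$ **Definition.** A local function $a_1$ of ghost number $0$ and antighost number $1$ is a lift of $a_2$ if $\gamma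 a_1+\delta a_2+\partial_\mu b_1^\mu=0$ for some local functions $b_1^\mu$. A local function $a_0$ of ghost number $0$ and antighost number $0$ is a lift of $a_1$ if $\gamma a_0+\delta a_1+\partial_\mu b_0^\mu=0$ for some local functions $b_0^\mu$. **Theorem.** 1. $\gamma a_2=0$, and $a_2$ lifts, without further condition on $f$, to $$\begin{aligned}a_1=f^a{}_{bc}\,\varepsilon^{\mu\nu\rho}\Big[&3\big(h_a^{*\alpha\beta\lambda}-\tfrac13\eta^{\alpha\beta}h_a^{*\lambda}\big)\big(\tfrac13h^b_{\alpha\mu\lambda}T^c_{\nu\rho|\beta}+\tfrac12C^b_{\alpha\mu}\partial_{[\rho}h^c_{\nu]\beta\lambda}\big)\\&+\tfrac13h_a^{*\lambda}T^b_{\lambda\nu|\mu}h^c_\rho+h^*_{a\mu}C_\nu^{b\,\alpha}\big(-\tfrac12\partial^\lambda h^c_{\lambda\alpha\rho}+\partial_{(\alpha}h^c_{\rho)}\big)\Big].\end{aligned}$$ 2. This $a_1$ has a lift $a_0$ if and only if $f_{abc}$ is totally antisymmetric. More generally, there are a lift $a_1'$ of $a_2$ and a lift $a_0'$ of $a_1'$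 if and only if $f_{abc}$ is totally antisymmetric. 3. $f_{abc}$ is totally antisymmetric if and only if the internal metric $\delta_{ab}$ is an invariant norm on $\mathcal A$, i.e. $(xy,z)=(x,yz)$ for all $x,y,z\in\mathcal A$, where $(x,y)=\delta_{ab}x^ay^b$. 4. If $f_{abc}$ is totally antisymmetric, then the following parity-breaking cubic vertex with two derivatives is a lift of the $a_1$ of part 1: $$\begin{aligned}a_0=f_{abc}\,\varepsilon^{\mu\nu\rho}\Big[&\tfrac14\partial_\mu h^a_{\nu\alpha\beta}\partial^\alpha h^{b\beta}h^c_\rho+\tfrac14\partial_\mu h^a_{\nu\alpha\beta}\partial^\alpha h^{b\beta\gamma\delta}h^c_{\rho\gamma\delta}-\tfrac54\partial_\mu h^a_{\nu\alpha\beta}\partial^\alpha h^{b\gamma}h^{c}_{\rho\gamma}{}^{\beta}-\tfrac38\partial_\mu h^a_\nu\partial^\alpha h^b_\alpha h^c_\rho\\&+\tfrac14\partial_\mu h^{a}_{\nu}{}^{\alpha\beta}\partial^\gamma h^b_\gamma h^c_{\rho\alpha\beta}-\partial_\mu h^a_\nu\partial^\gamma h^b_{\alpha\beta\gamma}h^{c}_{\rho}{}^{\alpha\beta}+\tfrac12\partial_\mu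 h^{a}_{\nu\alpha\beta}\partial^\gamma h^{b\alpha}{}_{\gamma\delta}h^{c}_{\rho}{}^{\beta\delta}+2\,\partial_\mu h^a_\nu\partial^\beta h^{b\gamma}h^c_{\rho\beta\gamma}\\&-\tfrac14\partial_\mu h^a_{\nu\alpha\beta}\partial^\gamma h^{b\alpha\beta\delta}h^c_{\rho\gamma\delta}-\tfrac14\partial_\mu h^a_{\nu\alpha\beta}\partial^\gamma h^{b\beta}h^{c}_{\rho\gamma}{}^{\alpha}-\tfrac58\partial_\mu h^a_\nu\partial_\rho h^{b\beta}h^c_\beta+\tfrac78\partial_\mu h^a_{\nu\alpha\beta}\partial_\rho h^{b\alpha\beta\gamma}h^c_\gamma\\&+\tfrac14\partial_\mu h^a_{\nu\alpha\beta}\partial_\gamma h^{b}_{\rho}{}^{\alpha\gamma}h^{c\beta}+\tfrac14\partial_\mu h^a_\nu\partial^\alpha h^b_{\rho\alpha\beta}h^{c\beta}-\tfrac14\partial_\mu h^a_{\nu\alpha\beta}\partial^\gamma h^b_{\rho\gamma\delta}h^{c\alpha\beta\delta}\\&-\tfrac18\partial_\mu h^a_\nu\partial^\alpha h^b_\rho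 h^c_\alpha-\tfrac18\partial_\mu h^a_{\nu\alpha\beta}\partial^\gamma h^{b}_{\rho}{}^{\alpha\beta}h^c_\gamma\Big].\end{aligned}$$ -/

import Mathlib

open scoped TensorProduct ContDiff

noncomputable section

namespace Spin3

/-! ### Minkowski space in three dimensions -/

/-- The diagonal entries `η_{μμ} = η^{μμ}` of the mostly plus Minkowski metric
`η = diag(-1, 1, 1)`; a contracted pair of lower (or of upper) indices `μ` is written
`∑ μ, η μ • (…)`. -/
def η (μ : Fin 3) : ℝ := if μ = 0 then -1 else 1

/-- The metric `η_{μν}` (numerically also `η^{μν}`). -/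
def metric (μ ν : Fin 3) : ℝ := if μ = ν then η μ else 0

/-- The Levi-Civita density `ε^{μνρ}`, normalised by `ε^{012} = 1`: the Vandermonde product
of the indices vanishes if two of them agree, and is `2` times the sign of a permutation. -/
def ε (μ ν ρ : Fin 3) : ℝ :=
  ((ν.val : ℝ) - μ.val) * ((ρ.val : ℝ) - μ.val) * ((ρ.val : ℝ) - ν.val) / 2

/-- Independent components of a symmetric rank-2 tensor. -/
abbrev I2 : Type := {t : Fin 3 × Fin 3 // t.1 ≤ t.2}

/-- Independent components of a symmetric rank-3 tensor. -/
abbrev I3 : Type := {t : Fin 3 × Fin 3 × Fin 3 // t.1 ≤ t.2.1 ∧ t.2.1 ≤ t.2.2}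

/-- The unordered pair of indices `μ, ν`, in increasing order. -/
def sort2 (μ ν : Fin 3) : I2 := ⟨(min μ ν, max μ ν), min_le_max⟩

/-- The unordered triple of indices `μ, ν, ρ`, in increasing order. -/
def sort3 (μ ν ρ : Fin 3) : I3 :=
  ⟨(min (min μ ν) ρ, max (min μ ν) (min (max μ ν) ρ), max (max μ ν) ρ),
    by revert μ ν ρ; decide⟩

/-! ### Smooth local functions of the fields -/

/-- Functions of the variables `x i`, `i : J`, which depend smoothly on finitely many of them. -/
def smoothLocal (J : Type) : Subalgebra ℝ ((J → ℝ) → ℝ) where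
  carrier := {F | ∃ (s : Finset J) (G : (s → ℝ) → ℝ), ContDiff ℝ ∞ G ∧
    ∀ x, F x = G (fun i => x i)}
  mul_mem' := by
    classical
    rintro F F' ⟨s, G, hG, h⟩ ⟨s', G', hG', h'⟩
    refine ⟨s ∪ s', fun y => G (fun i => y ⟨i, Finset.mem_union_left _ i.2⟩) *
      G' (fun i => y ⟨i, Finset.mem_union_right _ i.2⟩), ?_, fun x => ?_⟩
    · exact (hG.comp (by fun_prop)).mul (hG'.comp (by fun_prop))
    · simp [h, h']
  add_mem' := by
    classical
    rintro F F' ⟨s, G, hG, h⟩ ⟨s', G', hG', h'⟩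
    refine ⟨s ∪ s', fun y => G (fun i => y ⟨i, Finset.mem_union_left _ i.2⟩) +
      G' (fun i => y ⟨i, Finset.mem_union_right _ i.2⟩), ?_, fun x => ?_⟩
    · exact (hG.comp (by fun_prop)).add (hG'.comp (by fun_prop))
    · simp [h, h']
  algebraMap_mem' := fun r => ⟨∅, fun _ => r, contDiff_const, fun _ => rfl⟩

/-- The variable `x i` as a local function. -/
def coord {J : Type} (i : J) : smoothLocal J :=
  ⟨fun x => x i, {i}, fun y => y ⟨i, Finset.mem_singleton_self i⟩, by fun_prop, fun _ => rfl⟩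

theorem hasDerivAt_update {J : Type} [DecidableEq J] {F : (J → ℝ) → ℝ} {s : Finset J}
    {G : (s → ℝ) → ℝ} (hG : ContDiff ℝ ∞ G) (h : ∀ x, F x = G (fun i => x i)) (i : J)
    (x : J → ℝ) :
    HasDerivAt (fun t => F (Function.update x i t))
      (fderiv ℝ G (fun j => x j) (fun j => if (j : J) = i then 1 else 0)) (x i) := by
  have h1 : HasDerivAt (fun t => (fun j : s => Function.update x i t j))
      (fun j : s => if (j : J) = i then (1 : ℝ) else 0) (x i) := by
    rw [hasDerivAt_pi]
    intro j
    by_cases hj : (j : J) = i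
    · simp only [hj, Function.update_self, if_true]; exact hasDerivAt_id _
    · simp only [Function.update_of_ne hj, hj, if_false]; exact hasDerivAt_const _ _
  have h2 : HasFDerivAt G (fderiv ℝ G (fun j => x j))
      (fun j : s => Function.update x i (x i) j) := by
    simp only [Function.update_eq_self]
    exact (hG.differentiable (by simp)).differentiableAt.hasFDerivAt
  simp only [h]
  exact h2.comp_hasDerivAt (x i) h1

open Classical in
/-- The partial derivative `∂F/∂x_i`. -/
def partialDeriv {J : Type} (i : J) : smoothLocal J →ₗ[ℝ] smoothLocal J where
  toFun F := ⟨fun x => deriv (fun t => F.1 (Function.update x i t)) (x i), by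
    obtain ⟨s, G, hG, h⟩ := F.2
    refine ⟨s, fun y => fderiv ℝ G y (fun j => if (j : J) = i then 1 else 0), ?_, fun x => ?_⟩
    · exact (hG.fderiv_right (m := ∞) (by simp)).clm_apply contDiff_const
    · exact (hasDerivAt_update hG h i x).deriv⟩
  map_add' F F' := by
    obtain ⟨s, G, hG, h⟩ := F.2
    obtain ⟨s', G', hG', h'⟩ := F'.2
    ext x
    exact ((hasDerivAt_update hG h i x).add (hasDerivAt_update hG' h' i x)).deriv.trans
      (congrArg₂ (· + ·) (hasDerivAt_update hG h i x).deriv.symm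
        (hasDerivAt_update hG' h' i x).deriv.symm)
  map_smul' r F := by
    obtain ⟨s, G, hG, h⟩ := F.2
    ext x
    exact ((hasDerivAt_update hG h i x).const_mul r).deriv.trans
      (congrArg (r * ·) (hasDerivAt_update hG h i x).deriv.symm)

theorem partialDeriv_finite {J : Type} (F : smoothLocal J) :
    {i | partialDeriv i F ≠ 0}.Finite := by
  classical
  obtain ⟨s, G, hG, h⟩ := F.2
  refine s.finite_toSet.subset fun i hi => ?_
  by_contra his
  refine hi (Subtype.ext (funext fun x => ?_))
  change deriv (fun t => F.1 (Function.update x i t)) (x i) = 0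
  have : (fun t => F.1 (Function.update x i t)) = fun _ => F.1 x := by
    funext t
    rw [h, h]
    congr 1
    funext j
    exact Function.update_of_ne (fun hj => his (by simp [← hj])) _ _
  rw [this, deriv_const]

/-- The derivation `F ↦ ∑ i, (∂F/∂x_i) v_i` (a finite sum for each `F`), with values in an algebra
`A` over the local functions. -/
def vectorField {J A : Type} [Ring A] [Algebra ℝ A] (j : smoothLocal J →ₐ[ℝ] A) (v : J → A) :
    smoothLocal J →ₗ[ℝ] A where
  toFun F := ∑ᶠ i, j (partialDeriv i F) * v i
  map_add' F F' := by
    have hf : ∀ F : smoothLocal J,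
        (Function.support fun i => j (partialDeriv i F) * v i).Finite :=
      fun F => (partialDeriv_finite F).subset fun i hi h0 => hi (by simp [h0])
    simp only [map_add, add_mul]
    exact finsum_add_distrib (hf F) (hf F')
  map_smul' r F := by
    have hf : (Function.support fun i => j (partialDeriv i F) * v i).Finite :=
      (partialDeriv_finite F).subset fun i hi h0 => hi (by simp [h0])
    simp only [map_smul, smul_mul_assoc, RingHom.id_apply]
    exact (smul_finsum' r hf).symm

/-! ### The fields, ghosts and antifields -/

/-- Jets of the fields: `(a, s, α)` stands for `∂_α h^a_s`, with `s` three symmetric lower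
indices and `α` the multiset of derivative indices. -/
abbrev HJet (N : ℕ) : Type := Fin N × I3 × Multiset (Fin 3)

/-- Jets of the ghosts `C^a_{μν}` (lower indices) and of the antifields `h^{*μνρ}_a` and
`C^{*μν}_a` (upper indices). -/
inductive Gen (N : ℕ) : Type
  | C (a : Fin N) (s : I2) (α : Multiset (Fin 3))
  | hs (a : Fin N) (s : I3) (α : Multiset (Fin 3))
  | Cs (a : Fin N) (s : I2) (α : Multiset (Fin 3))

variable {N : ℕ}

/-- Antighost number. -/
def Gen.antigh : Gen N → ℕ
  | .C _ _ _ => 0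
  | .hs _ _ _ => 1
  | .Cs _ _ _ => 2

/-- Ghost number. -/
def Gen.gh : Gen N → ℤ
  | .C _ _ _ => 1
  | .hs _ _ _ => -1
  | .Cs _ _ _ => -2

/-- Grassmann parity, the ghost number modulo two. -/
def Gen.parity : Gen N → ℕ
  | .C _ _ _ => 1
  | .hs _ _ _ => 1
  | .Cs _ _ _ => 0

/-- Graded commutation, and tracelessness of the ghosts `C` and of the antifields `C^*`. -/
inductive Rel (N : ℕ) : FreeAlgebra ℝ (Gen N) → FreeAlgebra ℝ (Gen N) → Prop
  | comm (x y : Gen N) : Rel N (FreeAlgebra.ι ℝ x * FreeAlgebra.ι ℝ y)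
      ((-1 : ℝ) ^ (x.parity * y.parity) • (FreeAlgebra.ι ℝ y * FreeAlgebra.ι ℝ x))
  | traceC (a : Fin N) (α : Multiset (Fin 3)) :
      Rel N (∑ μ, η μ • FreeAlgebra.ι ℝ (Gen.C a (sort2 μ μ) α)) 0
  | traceCs (a : Fin N) (α : Multiset (Fin 3)) :
      Rel N (∑ μ, η μ • FreeAlgebra.ι ℝ (Gen.Cs a (sort2 μ μ) α)) 0

/-- The graded commutative algebra generated by the jets of the ghosts and antifields. -/
def GhostAlg (N : ℕ) : Type := RingQuot (Rel N)

instance : Ring (GhostAlg N) := inferInstanceAs (Ring (RingQuot (Rel N)))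

instance : Algebra ℝ (GhostAlg N) := inferInstanceAs (Algebra ℝ (RingQuot (Rel N)))

/-- A generator of the algebra of ghosts and antifields. -/
def ghostGen (x : Gen N) : GhostAlg N :=
  RingQuot.mkAlgHom ℝ (Rel N) (FreeAlgebra.ι ℝ x)

/-- Smooth local functions of the fields `h^a_{μνρ}`. -/
abbrev FieldFn (N : ℕ) : Type := smoothLocal (HJet N)

/-- Local functions of the fields, ghosts and antifields: smooth in the fields and their
derivatives, polynomial in the ghosts, the antifields and their derivatives. -/
def Loc (N : ℕ) : Type := FieldFn N ⊗[ℝ] GhostAlg N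

instance : Ring (Loc N) := inferInstanceAs (Ring (FieldFn N ⊗[ℝ] GhostAlg N))

instance : Algebra ℝ (Loc N) := inferInstanceAs (Algebra ℝ (FieldFn N ⊗[ℝ] GhostAlg N))

/-- The inclusion of the functions of the fields. -/
def ofField (N : ℕ) : FieldFn N →ₐ[ℝ] Loc N :=
  (Algebra.TensorProduct.includeLeft : FieldFn N →ₐ[ℝ] FieldFn N ⊗[ℝ] GhostAlg N)

/-- The inclusion of the functions of the ghosts and antifields. -/
def ofGhost (N : ℕ) : GhostAlg N →ₐ[ℝ] Loc N :=
  (Algebra.TensorProduct.includeRight : GhostAlg N →ₐ[ℝ] FieldFn N ⊗[ℝ] GhostAlg N)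

/-- A generator of the ghost and antifield sector, as a local function. -/
def gen (x : Gen N) : Loc N :=
  ofGhost N (ghostGen x)

/-- `∂_α h^a_{μνρ}` -/
def h (a : Fin N) (μ ν ρ : Fin 3) (α : Multiset (Fin 3)) : Loc N :=
  ofField N (coord (a, sort3 μ ν ρ, α))

/-- `∂_α C^a_{μν}` -/
def C (a : Fin N) (μ ν : Fin 3) (α : Multiset (Fin 3)) : Loc N := gen (.C a (sort2 μ ν) α)

/-- `∂_α h^{*μνρ}_a` -/
def hs (a : Fin N) (μ ν ρ : Fin 3) (α : Multiset (Fin 3)) : Loc N :=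
  gen (.hs a (sort3 μ ν ρ) α)

/-- `∂_α C^{*μν}_a` -/
def Cs (a : Fin N) (μ ν : Fin 3) (α : Multiset (Fin 3)) : Loc N := gen (.Cs a (sort2 μ ν) α)

/-- `∂_α h^a_μ`, where `h^a_μ = η^{νρ} h^a_{μνρ}` -/
def htr (a : Fin N) (μ : Fin 3) (α : Multiset (Fin 3)) : Loc N := ∑ ν, η ν • h a μ ν ν α

/-- `∂_α h^{*μ}_a`, where `h^{*μ}_a = η_{νρ} h^{*μνρ}_a` -/
def hstr (a : Fin N) (μ : Fin 3) (α : Multiset (Fin 3)) : Loc N := ∑ ν, η ν • hs a μ ν ν α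

/-- Local functions of ghost number `g` and antighost number `k`. -/
def Homog (N : ℕ) (g : ℤ) (k : ℕ) : Submodule ℝ (Loc N) :=
  Submodule.span ℝ {z | ∃ (F : FieldFn N) (l : List (Gen N)),
    (l.map Gen.gh).sum = g ∧ (l.map Gen.antigh).sum = k ∧
    z = ofField N F * (l.map gen).prod}

/-! ### Graded derivations -/

/-- The elements `g x` of an algebra satisfy the relations of the ghosts and antifields. -/
structure Compatible {A : Type} [Ring A] [Algebra ℝ A] (g : Gen N → A) : Prop where
  comm : ∀ x y, g x * g y = (-1 : ℝ) ^ (x.parity * y.parity) • (g y * g x)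
  traceC : ∀ a α, ∑ μ, η μ • g (.C a (sort2 μ μ) α) = 0
  traceCs : ∀ a α, ∑ μ, η μ • g (.Cs a (sort2 μ μ) α) = 0

/-- Values `v x` on the generators `g x` which extend to a derivation of parity `d` (even for
`d = 0`, odd for `d = 1`). -/
structure Derivable {A : Type} [Ring A] [Algebra ℝ A] (g : Gen N → A) (d : ℕ)
    (v : Gen N → A) : Prop where
  comm : ∀ x y, v x * g y = (-1 : ℝ) ^ (y.parity * (x.parity + d)) • (g y * v x)
  traceC : ∀ a α, ∑ μ, η μ • v (.C a (sort2 μ μ) α) = 0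
  traceCs : ∀ a α, ∑ μ, η μ • v (.Cs a (sort2 μ μ) α) = 0

theorem derMatrix_compatible {A : Type} [Ring A] [Algebra ℝ A] {g : Gen N → A}
    (hg : Compatible g) {d : ℕ} {v : Gen N → A} (hv : Derivable g d v) :
    Compatible fun x => (!![(-1 : ℝ) ^ (d * x.parity) • g x, v x; 0, g x] :
      Matrix (Fin 2) (Fin 2) A) where
  comm x y := by
    have e1 : ((-1 : ℝ) ^ (x.parity * y.parity)) * (-1) ^ (d * y.parity) =
        (-1) ^ (y.parity * (x.parity + d)) := by rw [← pow_add]; congr 1; ring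
    have e2 : ((-1 : ℝ) ^ (x.parity * y.parity)) * (-1) ^ (x.parity * (y.parity + d)) =
        (-1) ^ (d * x.parity) := by
      rw [← pow_add, show x.parity * y.parity + x.parity * (y.parity + d) =
        2 * (x.parity * y.parity) + d * x.parity by ring, pow_add, pow_mul]
      simp
    rw [Matrix.mul_fin_two, Matrix.mul_fin_two, Matrix.smul_of]
    congr 1
    ext i j
    fin_cases i <;> fin_cases j
    · simp only [Fin.zero_eta, Fin.isValue, Matrix.cons_val_zero, Pi.smul_apply, mul_zero,
        add_zero, smul_mul_smul_comm, hg.comm x y, smul_smul]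
      congr 1; ring
    · simp only [Fin.zero_eta, Fin.mk_one, Fin.isValue, Matrix.cons_val_zero,
        Matrix.cons_val_one, Pi.smul_apply, smul_mul_assoc, hv.comm x y,
        smul_add, smul_smul, e1, hv.comm y x, e2]
      rw [add_comm]
    · simp
    · simpa using hg.comm x y
  traceC a α := by
    have h1 := hv.traceC a α
    have h2 := hg.traceC a α
    ext i j
    fin_cases i <;> fin_cases j
    · simp only [Gen.parity, Matrix.sum_apply, Matrix.smul_apply]
      simp [smul_comm (η _) ((-1 : ℝ) ^ d), ← Finset.smul_sum, h2]
    · simpa [Matrix.sum_apply] using h1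
    · simp [Matrix.sum_apply]
    · simpa [Matrix.sum_apply] using h2
  traceCs a α := by
    have h1 := hv.traceCs a α
    have h2 := hg.traceCs a α
    ext i j
    fin_cases i <;> fin_cases j
    · simpa [Matrix.sum_apply, Gen.parity] using h2
    · simpa [Matrix.sum_apply] using h1
    · simp [Matrix.sum_apply]
    · simpa [Matrix.sum_apply] using h2

/-- The homomorphism with values `g x` on the generators. -/
def ghostLift {A : Type} [Ring A] [Algebra ℝ A] (g : Gen N → A) (hg : Compatible g) :
    GhostAlg N →ₐ[ℝ] A :=
  RingQuot.liftAlgHom ℝ ⟨FreeAlgebra.lift ℝ g, by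
    intro p q hpq
    cases hpq with
    | comm x y =>
      simp only [map_mul, map_smul, FreeAlgebra.lift_ι_apply]
      exact hg.comm x y
    | traceC a α =>
      simp only [map_sum, map_smul, map_zero, FreeAlgebra.lift_ι_apply]
      exact hg.traceC a α
    | traceCs a α =>
      simp only [map_sum, map_smul, map_zero, FreeAlgebra.lift_ι_apply]
      exact hg.traceCs a α⟩

theorem ghostGen_compatible : Compatible (ghostGen (N := N)) where
  comm x y := by
    have := RingQuot.mkAlgHom_rel ℝ (Rel.comm x y)
    simp only [map_mul, map_smul] at this
    exact this
  traceC a α := by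
    have := RingQuot.mkAlgHom_rel ℝ (Rel.traceC a α)
    simp only [map_sum, map_smul, map_zero] at this
    exact this
  traceCs a α := by
    have := RingQuot.mkAlgHom_rel ℝ (Rel.traceCs a α)
    simp only [map_sum, map_smul, map_zero] at this
    exact this

theorem gen_compatible : Compatible (gen (N := N)) where
  comm x y := by
    simp only [gen, ← map_mul, ← map_smul]
    rw [ghostGen_compatible.comm x y]
  traceC a α := by
    simp only [gen, ← map_smul, ← map_sum]
    rw [ghostGen_compatible.traceC a α, map_zero]
  traceCs a α := by
    simp only [gen, ← map_smul, ← map_sum]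
    rw [ghostGen_compatible.traceCs a α, map_zero]

/-- The left graded derivation `D` of parity `d` with `D x = v x` on the generators, that is
`D (z w) = (D z) w + (-1)^{d |z|} z (D w)`: it is the upper right entry of the multiplicative map
`z ↦ [[(-1)^{d|z|} z, D z], [0, z]]`. -/
def ghostDer (d : ℕ) (v : Gen N → Loc N) (hv : Derivable gen d v) : GhostAlg N →ₗ[ℝ] Loc N :=
  Matrix.entryLinearMap ℝ (Loc N) 0 1 ∘ₗ
    (ghostLift _ (derMatrix_compatible gen_compatible hv)).toLinearMap

/-- The map `F w ↦ (A F) (B w)` for `F` a function of the fields and `w` a function of the ghosts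
and antifields. -/
def mulMap (A : FieldFn N →ₗ[ℝ] Loc N) (B : GhostAlg N →ₗ[ℝ] Loc N) : Loc N →ₗ[ℝ] Loc N :=
  LinearMap.mul' ℝ (Loc N) ∘ₗ
    (TensorProduct.map A B : FieldFn N ⊗[ℝ] GhostAlg N →ₗ[ℝ] Loc N ⊗[ℝ] Loc N)

/-! ### The differentials `γ`, `δ` and the total derivatives -/

/-- `γ ∂_α h^a_{μνρ} = 3 ∂_α ∂_{(μ} C^a_{νρ)}` -/
def gammaField : HJet N → Loc N
  | (a, ⟨(μ, ν, ρ), _⟩, α) =>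
    C a ν ρ (μ ::ₘ α) + C a μ ρ (ν ::ₘ α) + C a μ ν (ρ ::ₘ α)

/-- The differential along the gauge orbits; it vanishes on the ghosts and antifields. -/
def γ (N : ℕ) : Loc N →ₗ[ℝ] Loc N :=
  mulMap (vectorField (ofField N) gammaField) (ofGhost N).toLinearMap

/-- The Fronsdal tensor `∂_α F^a_{μνρ}`. -/
def Fronsdal (a : Fin N) (μ ν ρ : Fin 3) (α : Multiset (Fin 3)) : Loc N :=
  (∑ σ, η σ • h a μ ν ρ (σ ::ₘ σ ::ₘ α))
    - (∑ σ, η σ • (h a ν ρ σ (σ ::ₘ μ ::ₘ α) + h a μ ρ σ (σ ::ₘ ν ::ₘ α)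
        + h a μ ν σ (σ ::ₘ ρ ::ₘ α)))
    + (htr a ρ (μ ::ₘ ν ::ₘ α) + htr a ν (μ ::ₘ ρ ::ₘ α) + htr a μ (ν ::ₘ ρ ::ₘ α))

/-- Its trace `∂_α F^a_μ`. -/
def Fronsdaltr (a : Fin N) (μ : Fin 3) (α : Multiset (Fin 3)) : Loc N :=
  ∑ ν, η ν • Fronsdal a μ ν ν α

/-- The field equations `∂_α G^a_{μνρ}`, where `G_{μνρ} = F_{μνρ} - 3/2 η_{(μν} F_{ρ)}`. -/
def Gtensor (a : Fin N) (μ ν ρ : Fin 3) (α : Multiset (Fin 3)) : Loc N :=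
  Fronsdal a μ ν ρ α - (1 / 2 : ℝ) • (metric μ ν • Fronsdaltr a ρ α
    + metric ν ρ • Fronsdaltr a μ α + metric μ ρ • Fronsdaltr a ν α)

/-- `δ h^{*μνρ}_a = G^{μνρ}_a` and
`δ C^{*μν}_a = -3 (∂_ρ h^{*μνρ}_a - (1/3) η^{μν} ∂_ρ h^{*ρ}_a)`, and their derivatives. -/
def deltaGen : Gen N → Loc N
  | .C _ _ _ => 0
  | .hs a ⟨(μ, ν, ρ), _⟩ α => (η μ * η ν * η ρ) • Gtensor a μ ν ρ α
  | .Cs a ⟨(μ, ν), _⟩ α => (-3 : ℝ) • ((∑ ρ, hs a μ ν ρ (ρ ::ₘ α))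
      - (1 / 3 : ℝ) • metric μ ν • ∑ ρ, hstr a ρ (ρ ::ₘ α))

theorem commute_ofField_gen (F : FieldFn N) (y : Gen N) : Commute (ofField N F) (gen y) := by
  have : ofField N F * gen y = gen y * ofField N F := by
    change (F ⊗ₜ[ℝ] (1 : GhostAlg N)) * ((1 : FieldFn N) ⊗ₜ[ℝ] ghostGen y) =
      ((1 : FieldFn N) ⊗ₜ[ℝ] ghostGen y) * (F ⊗ₜ[ℝ] (1 : GhostAlg N))
    simp only [Algebra.TensorProduct.tmul_mul_tmul, mul_one, one_mul]
  exact this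

theorem commute_Gtensor_gen (a : Fin N) (μ ν ρ : Fin 3) (α : Multiset (Fin 3)) (y : Gen N) :
    Commute (Gtensor a μ ν ρ α) (gen y) := by
  have hh : ∀ a μ ν ρ α, Commute (h (N := N) a μ ν ρ α) (gen y) :=
    fun _ _ _ _ _ => commute_ofField_gen _ _
  have ht : ∀ a μ α, Commute (htr (N := N) a μ α) (gen y) := fun a μ α =>
    Commute.sum_left _ _ _ fun ν _ => (hh _ _ _ _ _).smul_left _
  have hF : ∀ a μ ν ρ α, Commute (Fronsdal (N := N) a μ ν ρ α) (gen y) := fun a μ ν ρ α =>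
    (((Commute.sum_left _ _ _ fun σ _ => (hh _ _ _ _ _).smul_left _).sub_left
      (Commute.sum_left _ _ _ fun σ _ => (((hh _ _ _ _ _).add_left
        (hh _ _ _ _ _)).add_left (hh _ _ _ _ _)).smul_left _)).add_left
      (((ht _ _ _).add_left (ht _ _ _)).add_left (ht _ _ _)))
  have hFt : ∀ a μ α, Commute (Fronsdaltr (N := N) a μ α) (gen y) := fun a μ α =>
    Commute.sum_left _ _ _ fun ν _ => (hF _ _ _ _ _).smul_left _
  exact (hF _ _ _ _ _).sub_left (((((hFt _ _ _).smul_left _).add_left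
    ((hFt _ _ _).smul_left _)).add_left ((hFt _ _ _).smul_left _)).smul_left _)

theorem deltaGen_derivable : Derivable gen 1 (deltaGen (N := N)) where
  comm x y := by
    cases x with
    | C a s α => simp [deltaGen]
    | hs a s α =>
      obtain ⟨⟨μ, ν, ρ⟩, _⟩ := s
      have h1 := ((commute_Gtensor_gen a μ ν ρ α y).smul_left (η μ * η ν * η ρ)).eq
      have h2 : (-1 : ℝ) ^ (y.parity * ((Gen.hs a ⟨(μ, ν, ρ), ‹_›⟩ α).parity + 1)) = 1 := by
        simp [Gen.parity, pow_mul']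
      rw [h2, one_smul]
      exact h1
    | Cs a s α =>
      obtain ⟨⟨μ, ν⟩, _⟩ := s
      have hg : ∀ a μ ν ρ α, hs (N := N) a μ ν ρ α * gen y =
          (-1 : ℝ) ^ y.parity • (gen y * hs a μ ν ρ α) := by
        intro a μ ν ρ α
        have := gen_compatible.comm (.hs a (sort3 μ ν ρ) α) y
        rwa [show (Gen.hs a (sort3 μ ν ρ) α).parity = 1 from rfl, one_mul] at this
      have e : y.parity * ((Gen.Cs a ⟨(μ, ν), ‹_›⟩ α).parity + 1) = y.parity := by
        simp [Gen.parity]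
      rw [e]
      simp only [deltaGen, hstr, sub_mul, mul_sub, Finset.sum_mul, Finset.mul_sum,
        smul_mul_assoc, mul_smul_comm, hg, Finset.smul_sum, smul_sub]
      simp only [smul_comm _ ((-1 : ℝ) ^ y.parity)]
  traceC a α := by simp [deltaGen]
  traceCs a α := by
    simp only [deltaGen, sort2, min_self, max_self, metric, if_true]
    have : ∀ μ : Fin 3, η μ • (-3 : ℝ) • ((∑ ρ, hs a μ μ ρ (ρ ::ₘ α))
        - (1 / 3 : ℝ) • η μ • ∑ ρ, hstr a ρ (ρ ::ₘ α)) =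
        (-3 : ℝ) • (∑ ρ, η μ • hs a μ μ ρ (ρ ::ₘ α)) + ∑ ρ, hstr a ρ (ρ ::ₘ α) := by
      intro μ
      have h1 : η μ * η μ = 1 := by unfold η; split_ifs <;> norm_num
      rw [← Finset.smul_sum]
      have h2 : η μ • (-3 : ℝ) • (1 / 3 : ℝ) • η μ • (∑ ρ, hstr a ρ (ρ ::ₘ α) : Loc N) =
          (-1 : ℝ) • ∑ ρ, hstr a ρ (ρ ::ₘ α) := by
        rw [smul_smul, smul_smul, smul_smul]
        congr 1
        linear_combination (-1) * h1
      rw [smul_sub, smul_sub, h2, smul_comm]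
      simp
    rw [Finset.sum_congr rfl fun μ _ => this μ, Finset.sum_add_distrib, ← Finset.smul_sum,
      Finset.sum_comm]
    have h3 : ∀ ρ : Fin 3, ∑ μ, η μ • hs a μ μ ρ (ρ ::ₘ α) = hstr a ρ (ρ ::ₘ α) := by
      intro ρ
      have : ∀ μ, sort3 μ μ ρ = sort3 ρ μ μ := by revert ρ; decide
      simp [hstr, hs, this]
    simp only [h3]
    rw [Finset.sum_const, Finset.card_univ, Fintype.card_fin, ← Nat.cast_smul_eq_nsmul ℝ,
      ← add_smul]
    norm_num

/-- The Koszul-Tate differential; it vanishes on the fields and the ghosts. -/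
def δ (N : ℕ) : Loc N →ₗ[ℝ] Loc N :=
  mulMap (ofField N).toLinearMap (ghostDer 1 deltaGen deltaGen_derivable)

/-- `∂_μ` on the jets of the fields. -/
def shiftField (μ : Fin 3) : HJet N → Loc N
  | (a, s, α) => ofField N (coord (a, s, μ ::ₘ α))

/-- `∂_μ` on the jets of the ghosts and antifields. -/
def shiftGen (μ : Fin 3) : Gen N → Loc N
  | .C a s α => gen (.C a s (μ ::ₘ α))
  | .hs a s α => gen (.hs a s (μ ::ₘ α))
  | .Cs a s α => gen (.Cs a s (μ ::ₘ α))

theorem shiftGen_derivable (μ : Fin 3) : Derivable gen 0 (shiftGen (N := N) μ) where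
  comm x y := by
    rw [add_zero, mul_comm y.parity]
    cases x with
    | C a s α => exact gen_compatible.comm (.C a s (μ ::ₘ α)) y
    | hs a s α => exact gen_compatible.comm (.hs a s (μ ::ₘ α)) y
    | Cs a s α => exact gen_compatible.comm (.Cs a s (μ ::ₘ α)) y
  traceC a α := gen_compatible.traceC a _
  traceCs a α := gen_compatible.traceCs a _

/-- The total derivative `∂_μ`. -/
def totalDeriv (N : ℕ) (μ : Fin 3) : Loc N →ₗ[ℝ] Loc N :=
  mulMap (vectorField (ofField N) (shiftField μ)) (ofGhost N).toLinearMap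
    + mulMap (ofField N).toLinearMap (ghostDer 0 (shiftGen μ) (shiftGen_derivable μ))

/-- The total divergence `∂_μ b^μ`: a topform `d b` is `(∂_μ b^μ) d³x` where the local two-form `b`
has components `½ b^λ ε_{λστ} dx^σ dx^τ`. -/
def totalDiv (b : Fin 3 → Loc N) : Loc N := ∑ μ, totalDeriv N μ (b μ)

/-! ### The deformation -/

/-- `T^a_{νρ|β} = ∂_{[ν} C^a_{ρ]β}` -/
def T (a : Fin N) (ν ρ β : Fin 3) : Loc N :=
  (1 / 2 : ℝ) • (C a ρ β {ν} - C a ν β {ρ})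

/-- `a₂ = f^a_{bc} ε^{μνρ} C_a^{*αβ} C^b_{μα} ∂_{[ν} C^c_{ρ]β}` -/
def a₂ (f : Fin N → Fin N → Fin N → ℝ) : Loc N :=
  ∑ a, ∑ b, ∑ c, ∑ μ, ∑ ν, ∑ ρ, (f a b c * ε μ ν ρ) •
    ∑ α, ∑ β, Cs a α β 0 * C b μ α 0 * T c ν ρ β

/-- `a₁ = f^a_{bc} ε^{μνρ} [ 3 (h_a^{*αβλ} - ⅓ η^{αβ} h_a^{*λ})
      (⅓ h^b_{αμλ} T^c_{νρ|β} + ½ C^b_{αμ} ∂_{[ρ} h^c_{ν]βλ})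
    + ⅓ h_a^{*λ} T^b_{λν|μ} h^c_ρ
    + h^*_{aμ} C^{bα}_ν (-½ ∂^λ h^c_{λαρ} + ∂_{(α} h^c_{ρ)}) ]` -/
def a₁ (f : Fin N → Fin N → Fin N → ℝ) : Loc N :=
  ∑ a, ∑ b, ∑ c, ∑ μ, ∑ ν, ∑ ρ, (f a b c * ε μ ν ρ) •
    ((∑ α, ∑ β, ∑ l, (3 : ℝ) • ((hs a α β l 0 - (1 / 3 : ℝ) • metric α β • hstr a l 0) *
        ((1 / 3 : ℝ) • (h b α μ l 0 * T c ν ρ β)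
          + (1 / 2 : ℝ) • (C b α μ 0 *
              ((1 / 2 : ℝ) • (h c ν β l {ρ} - h c ρ β l {ν}))))))
    + (∑ l, (1 / 3 : ℝ) • (hstr a l 0 * T b l ν μ * htr c ρ 0))
    + ∑ α, (η μ * η α) • (hstr a μ 0 * C b ν α 0 *
        ((-1 / 2 : ℝ) • (∑ l, η l • h c l α ρ {l})
          + (1 / 2 : ℝ) • (htr c ρ {α} + htr c α {ρ}))))

/-- The cubic vertex `a₀`:
`f_{abc} ε^{μνρ} [ ¼ ∂_μ h^a_{ναβ} ∂^α h^{bβ} h^c_ρ + ¼ ∂_μ h^a_{ναβ} ∂^α h^{bβγδ} h^c_{ργδ}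
- 5/4 ∂_μ h^a_{ναβ} ∂^α h^{bγ} h^{cβ}_{ργ} - 3/8 ∂_μ h^a_ν ∂^α h^b_α h^c_ρ + … ]`. -/
def a₀ (f : Fin N → Fin N → Fin N → ℝ) : Loc N :=
  ∑ a, ∑ b, ∑ c, ∑ μ, ∑ ν, ∑ ρ, (f a b c * ε μ ν ρ) •
    ((1 / 4 : ℝ) • (∑ x, ∑ y, (η x * η y) •
        (h a ν x y {μ} * htr b y {x} * htr c ρ 0))
    + (1 / 4 : ℝ) • (∑ x, ∑ y, ∑ z, ∑ w, (η x * η y * η z * η w) •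
        (h a ν x y {μ} * h b y z w {x} * h c ρ z w 0))
    - (5 / 4 : ℝ) • (∑ x, ∑ y, ∑ z, (η x * η y * η z) •
        (h a ν x y {μ} * htr b z {x} * h c ρ z y 0))
    - (3 / 8 : ℝ) • (∑ x, η x • (htr a ν {μ} * htr b x {x} * htr c ρ 0))
    + (1 / 4 : ℝ) • (∑ x, ∑ y, ∑ z, (η x * η y * η z) •
        (h a ν x y {μ} * htr b z {z} * h c ρ x y 0))
    - (∑ x, ∑ y, ∑ z, (η x * η y * η z) •
        (htr a ν {μ} * h b x y z {z} * h c ρ x y 0))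
    + (1 / 2 : ℝ) • (∑ x, ∑ y, ∑ z, ∑ w, (η x * η y * η z * η w) •
        (h a ν x y {μ} * h b x z w {z} * h c ρ y w 0))
    + (2 : ℝ) • (∑ y, ∑ z, (η y * η z) •
        (htr a ν {μ} * htr b z {y} * h c ρ y z 0))
    - (1 / 4 : ℝ) • (∑ x, ∑ y, ∑ z, ∑ w, (η x * η y * η z * η w) •
        (h a ν x y {μ} * h b x y w {z} * h c ρ z w 0))
    - (1 / 4 : ℝ) • (∑ x, ∑ y, ∑ z, (η x * η y * η z) •
        (h a ν x y {μ} * htr b y {z} * h c ρ z x 0))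
    - (5 / 8 : ℝ) • (∑ y, η y • (htr a ν {μ} * htr b y {ρ} * htr c y 0))
    + (7 / 8 : ℝ) • (∑ x, ∑ y, ∑ z, (η x * η y * η z) •
        (h a ν x y {μ} * h b x y z {ρ} * htr c z 0))
    + (1 / 4 : ℝ) • (∑ x, ∑ y, ∑ z, (η x * η y * η z) •
        (h a ν x y {μ} * h b ρ x z {z} * htr c y 0))
    + (1 / 4 : ℝ) • (∑ x, ∑ y, (η x * η y) •
        (htr a ν {μ} * h b ρ x y {x} * htr c y 0))
    - (1 / 4 : ℝ) • (∑ x, ∑ y, ∑ z, ∑ w, (η x * η y * η z * η w) •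
        (h a ν x y {μ} * h b ρ z w {z} * h c x y w 0))
    - (1 / 8 : ℝ) • (∑ x, η x • (htr a ν {μ} * htr b ρ {x} * htr c x 0))
    - (1 / 8 : ℝ) • (∑ x, ∑ y, ∑ z, (η x * η y * η z) •
        (h a ν x y {μ} * h b ρ x y {z} * htr c z 0)))

/-- `a₁` is a lift of `a₂`: `γ a₁ + δ a₂ + d b₁ = 0` for some local `b₁`, with `a₁` of ghost number
zero and antighost number one. -/
def IsLift₁ (a1 a2 : Loc N) : Prop :=
  a1 ∈ Homog N 0 1 ∧ ∃ b, γ N a1 + δ N a2 + totalDiv b = 0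

/-- `a₀` is a lift of `a₁`: `γ a₀ + δ a₁ + d b₀ = 0` for some local `b₀`, with `a₀` of ghost number
zero and antighost number zero. -/
def IsLift₀ (a0 a1 : Loc N) : Prop :=
  a0 ∈ Homog N 0 0 ∧ ∃ b, γ N a0 + δ N a1 + totalDiv b = 0

/-- `f_{abc}` (indices lowered by `δ_{ab}`) is totally antisymmetric. -/
def TotallyAntisymmetric (f : Fin N → Fin N → Fin N → ℝ) : Prop :=
  ∀ a b c, f a b c = -f b a c ∧ f a b c = -f a c b

/-- The product `(x y)^a = f^a_{bc} x^b y^c` of the internal algebra. -/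
def algMul (f : Fin N → Fin N → Fin N → ℝ) (x y : Fin N → ℝ) : Fin N → ℝ :=
  fun a => ∑ b, ∑ c, f a b c * x b * y c

/-- The internal metric `δ_{ab}` is invariant: `(x y, z) = (x, y z)`. -/
def InvariantNorm (f : Fin N → Fin N → Fin N → ℝ) : Prop :=
  ∀ x y z : Fin N → ℝ, algMul f x y ⬝ᵥ z = x ⬝ᵥ algMul f y z

end Spin3

end

set_option linter.unusedSimpArgs false

noncomputable section

namespace Spin3

variable {N : ℕ}

/-! ### Calculus of local functions -/

/-! Necessity of total antisymmetry and existence of the lifts are proved by different methods.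

Necessity is obtained by testing the lift equations on plane waves. A wave of momentum `k` is
expanded in powers of `k`; the variation along its part of order `n` is a derivation with constant
coefficients (`Pol.V`), and its commutator with `∂_μ` is `k_μ` times the variation of order `n - 1`.
Hence an alternating sum over the orders of two waves, followed by evaluation at the origin (`aug`),
kills every total divergence: it pairs waves of opposite momenta. The commutators with `γ` and `δ`
turn a ghost wave into a pure gauge field wave, a field wave into an antifield wave carrying its
field equations, and an antifield wave into its Noether identity. For an arbitrary lift `a₁'`, the
first lift equation therefore expresses the transformation of pure gauge waves under a constant
ghost through `a₂` alone (`Pol.transf_vee`). The second makes this transformation, contracted with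
the field equations, symmetric in two fields (`Pol.transf_eom`), which is the invariance of the free
action. The transformation is linear in the momentum and in the field, so polarisations that are not
pure gauge can be reached from pure gauge ones (`Pol.transf_decomp`). Two such components give `9/2
f_{abc}` and `-9/2 f_{abc}`, so symmetry forces `f_{abc} = -f_{cba}`; with the antisymmetry in `b,
c` this is total antisymmetry.

Existence is a polynomial computation. Trilinear expressions in jets of symmetric tensors are
encoded by polynomials in three vectors `u_s` and three momenta `k_s` (`umb`). Then `∂_μ` is
multiplication by the total momentum (`totalDeriv_umb`), `γ` replaces one `u_s` by `k_s` as a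
derivation (`gamma_umb`), tracelessness kills the multiples of `u_s · u_s`, and the symmetries of
`f` permute slots. Being a total divergence follows from membership in the ideal `divIdeal`
(`mem_divergences_of_mem_divIdeal`), and modulo it the claims become identities between scalar
products and determinants of vectors. These are combinations of `schouten`, the vanishing of
antisymmetrization over four indices in dimension three: `ghostSym_add_swap` for `a₁` and
`vertexSym_sub_swap` for `a₀`.

The invariant norm condition, tested on basis vectors, is the cyclicity of `f`, which for `f`
antisymmetric in its last two indices is total antisymmetry. -/

theorem partialDeriv_apply {J : Type} [DecidableEq J] (i : J) (F : smoothLocal J) (x : J → ℝ) :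
    (partialDeriv i F).1 x = deriv (fun t => F.1 (Function.update x i t)) (x i) := by
  have : (Classical.decEq J) = ‹DecidableEq J› := Subsingleton.elim _ _
  subst this
  rfl

theorem hasDerivAt_partialDeriv {J : Type} [DecidableEq J] (i : J) (F : smoothLocal J)
    (x : J → ℝ) :
    HasDerivAt (fun t => F.1 (Function.update x i t)) ((partialDeriv i F).1 x) (x i) := by
  obtain ⟨s, G, hG, h⟩ := F.2
  have := hasDerivAt_update hG h i x
  rw [partialDeriv_apply, this.deriv]
  exact this

theorem partialDeriv_mul {J : Type} (i : J) (F G : smoothLocal J) :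
    partialDeriv i (F * G) = partialDeriv i F * G + F * partialDeriv i G := by
  classical
  ext x
  rw [partialDeriv_apply]
  have := ((hasDerivAt_partialDeriv i F x).mul (hasDerivAt_partialDeriv i G x)).deriv
  simp only [Function.update_eq_self] at this
  exact this

theorem partialDeriv_coord {J : Type} [DecidableEq J] (i j : J) :
    partialDeriv i (coord j) = if i = j then 1 else 0 := by
  ext x
  rw [partialDeriv_apply]
  by_cases hij : i = j
  · subst hij
    simp [coord]
  · have : (fun t => (coord j).1 (Function.update x i t)) = fun _ => x j := by
      funext t
      exact Function.update_of_ne (fun h => hij h.symm) _ _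
    rw [this, deriv_const, if_neg hij]
    rfl

/-- Both sides are the second derivative of the finite-dimensional representative of `F`, in two
coordinate directions, so Schwarz's theorem applies. It is needed for commutators of derivations on
nonlinear functions of the fields. -/
theorem partialDeriv_comm {J : Type} (i j : J) (F : smoothLocal J) :
    partialDeriv i (partialDeriv j F) = partialDeriv j (partialDeriv i F) := by
  classical
  obtain ⟨s, G, hG, h⟩ := F.2
  let e : J → (s → ℝ) := fun i k => if (k : J) = i then 1 else 0
  have h1 : ∀ i x, (partialDeriv i F).1 x = fderiv ℝ G (fun k => x k) (e i) := fun i x => by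
    rw [partialDeriv_apply, (hasDerivAt_update hG h i x).deriv]
  have hd : Differentiable ℝ (fderiv ℝ G) :=
    (hG.fderiv_right (m := ∞) (by simp)).differentiable (by simp)
  have h2 : ∀ i j x, (partialDeriv i (partialDeriv j F)).1 x =
      fderiv ℝ (fderiv ℝ G) (fun k => x k) (e i) (e j) := fun i j x => by
    have hs : ContDiff ℝ ∞ fun y => fderiv ℝ G y (e j) :=
      (hG.fderiv_right (m := ∞) (by simp)).clm_apply contDiff_const
    rw [partialDeriv_apply, (hasDerivAt_update hs (h1 j) i x).deriv,
      fderiv_clm_apply (hd _) (differentiableAt_const _)]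
    simp [e]
  ext x
  rw [h2, h2]
  exact (second_derivative_symmetric (f := G) (fun y => (hG.differentiable (by simp) y).hasFDerivAt)
    (hd _).hasFDerivAt _ _)

theorem vectorField_eq_sum {J A : Type} [Ring A] [Algebra ℝ A] (j : smoothLocal J →ₐ[ℝ] A)
    (v : J → A) (F : smoothLocal J) (s : Finset J)
    (hs : ∀ i, partialDeriv i F ≠ 0 → i ∈ s) :
    vectorField j v F = ∑ i ∈ s, j (partialDeriv i F) * v i := by
  refine finsum_eq_sum_of_support_subset _ fun i hi => ?_
  exact hs i fun h0 => hi (by simp [h0])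

/-- The Leibniz rule needs the image of `j` to commute with everything. The alternative in the
conclusion keeps the statement free of this hypothesis; `ofField_commute` discards it for local
functions. -/
theorem vectorField_mul {J A : Type} [Ring A] [Algebra ℝ A] (j : smoothLocal J →ₐ[ℝ] A)
    (v : J → A) (F G : smoothLocal J) :
    vectorField j v (F * G) = vectorField j v F * j G + j F * vectorField j v G ∨
      ¬ ∀ F a, Commute (j F) a := by
  classical
  by_cases hc : ∀ F a, Commute (j F) a
  swap
  · exact Or.inr hc
  left
  let s := (partialDeriv_finite F).toFinset ∪ (partialDeriv_finite G).toFinset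
  rw [vectorField_eq_sum j v F s, vectorField_eq_sum j v G s, vectorField_eq_sum j v _ s,
    Finset.sum_mul, Finset.mul_sum, ← Finset.sum_add_distrib]
  · refine Finset.sum_congr rfl fun i _ => ?_
    rw [partialDeriv_mul, map_add, map_mul, map_mul, add_mul, mul_assoc, mul_assoc,
      (hc G (v i)).eq, mul_assoc]
  · intro i hi
    by_contra his
    simp only [s, Finset.mem_union, Set.Finite.mem_toFinset, Set.mem_ofPred_eq, not_or,
      not_not] at his
    exact hi (by rw [partialDeriv_mul, his.1, his.2, zero_mul, mul_zero, add_zero])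
  · intro i hi; simp [s, hi]
  · intro i hi; simp [s, hi]

/-! ### The algebra of local functions -/

theorem ofField_mul_ofGhost (F : FieldFn N) (w : GhostAlg N) :
    ofField N F * ofGhost N w = (F ⊗ₜ[ℝ] w : FieldFn N ⊗[ℝ] GhostAlg N) := by
  change (F ⊗ₜ[ℝ] (1 : GhostAlg N)) * ((1 : FieldFn N) ⊗ₜ[ℝ] w) = _
  rw [Algebra.TensorProduct.tmul_mul_tmul, mul_one, one_mul]

/-- The quotient map onto the algebra of ghosts and antifields. -/
def ghostMk (N : ℕ) : FreeAlgebra ℝ (Gen N) →ₐ[ℝ] GhostAlg N := RingQuot.mkAlgHom ℝ (Rel N)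

/-- Words in the generators span, so it is enough to multiply on the left by one generator at a
time. This matches the Leibniz rules below, which are stated for a generator as left factor. -/
theorem ghostAlg_induction {p : GhostAlg N → Prop} (one : p 1)
    (add : ∀ x y, p x → p y → p (x + y)) (smul : ∀ (r : ℝ) x, p x → p (r • x))
    (mul : ∀ y x, p x → p (ghostGen y * x)) (z : GhostAlg N) : p z := by
  -- Free algebra induction does not build words from the left; stability under left multiplication
  -- by every element does propagate through products.
  have key : ∀ (a : FreeAlgebra ℝ (Gen N)) (x : GhostAlg N), p x → p (ghostMk N a * x) := by
    intro a
    induction a using FreeAlgebra.induction with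
    | grade0 r =>
      intro x hx
      rw [AlgHom.commutes, ← Algebra.smul_def]
      exact smul r x hx
    | grade1 y => exact fun x hx => mul y x hx
    | mul a b ha hb =>
      intro x hx
      rw [map_mul, mul_assoc]
      exact ha _ (hb _ hx)
    | add a b ha hb =>
      intro x hx
      rw [map_add, add_mul]
      exact add _ _ (ha _ hx) (hb _ hx)
  obtain ⟨a, ha⟩ := RingQuot.mkAlgHom_surjective ℝ (Rel N) z
  have := key a 1 one
  rw [mul_one] at this
  exact ha ▸ this

theorem loc_induction {p : Loc N → Prop} (one : p 1)
    (add : ∀ x y, p x → p y → p (x + y)) (smul : ∀ (r : ℝ) x, p x → p (r • x))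
    (mul : ∀ y x, p x → p (gen y * x)) (field : ∀ F x, p x → p (ofField N F * x))
    (z : Loc N) : p z := by
  have hg : ∀ w : GhostAlg N, p (ofGhost N w) := by
    intro w
    induction w using ghostAlg_induction with
    | one => simpa using one
    | add x y hx hy => rw [map_add]; exact add _ _ hx hy
    | smul r x hx => rw [map_smul]; exact smul _ _ hx
    | mul y x hx => rw [map_mul]; exact mul y _ hx
  refine TensorProduct.induction_on (R := ℝ) (M := FieldFn N) (N := GhostAlg N)
    (motive := p) z ?_ ?_ ?_
  · have := smul 0 1 one
    rw [zero_smul] at this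
    exact this
  · intro F w
    rw [← ofField_mul_ofGhost]
    exact field _ _ (hg w)
  · exact fun x y hx hy => add x y hx hy

theorem ofField_commute (F : FieldFn N) (z : Loc N) : Commute (ofField N F) z := by
  induction z using loc_induction with
  | one => exact Commute.one_right _
  | add x y hx hy => exact hx.add_right hy
  | smul r x hx => exact hx.smul_right r
  | mul y x hx => exact (commute_ofField_gen F y).mul_right hx
  | field G x hx =>
    refine Commute.mul_right ?_ hx
    change ofField N F * ofField N G = ofField N G * ofField N F
    rw [← map_mul, ← map_mul, mul_comm]

theorem vectorField_ofField_mul (v : HJet N → Loc N) (F G : FieldFn N) :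
    vectorField (ofField N) v (F * G) =
      vectorField (ofField N) v F * ofField N G + ofField N F * vectorField (ofField N) v G :=
  (vectorField_mul (ofField N) v F G).resolve_right fun h => h ofField_commute

theorem vectorField_coord (v : HJet N → Loc N) (i : HJet N) :
    vectorField (ofField N) v (coord i) = v i := by
  classical
  rw [vectorField_eq_sum (ofField N) v (coord i) {i}]
  · simp [partialDeriv_coord]
  · intro j hj
    rw [partialDeriv_coord] at hj
    simpa using hj

/-- The augmentation: the value at vanishing fields, ghosts and antifields. -/
def aug (N : ℕ) : Loc N →ₗ[ℝ] ℝ :=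
  LinearMap.mul' ℝ ℝ ∘ₗ (TensorProduct.map
    ({ toFun := fun F => F.1 0, map_add' := fun _ _ => rfl, map_smul' := fun _ _ => rfl } :
      FieldFn N →ₗ[ℝ] ℝ)
    (ghostLift (fun _ : Gen N => (0 : ℝ)) ⟨by simp, by simp, by simp⟩).toLinearMap :
      FieldFn N ⊗[ℝ] GhostAlg N →ₗ[ℝ] ℝ ⊗[ℝ] ℝ)

theorem ghostLift_ghostGen {A : Type} [Ring A] [Algebra ℝ A] (g : Gen N → A) (hg : Compatible g)
    (x : Gen N) : ghostLift g hg (ghostGen x) = g x :=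
  (RingQuot.liftAlgHom_mkAlgHom_apply ℝ _ _ _).trans (FreeAlgebra.lift_ι_apply _ _)

theorem aug_ofField_ofGhost (F : FieldFn N) (w : GhostAlg N) :
    aug N (ofField N F * ofGhost N w) = F.1 0 *
      ghostLift (fun _ : Gen N => (0 : ℝ)) ⟨by simp, by simp, by simp⟩ w := by
  rw [ofField_mul_ofGhost]
  rfl

theorem loc_tmul_induction {p : Loc N → Prop} (add : ∀ x y, p x → p y → p (x + y))
    (mul : ∀ F w, p (ofField N F * ofGhost N w)) (z : Loc N) : p z := by
  refine TensorProduct.induction_on (R := ℝ) (M := FieldFn N) (N := GhostAlg N)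
    (motive := p) z ?_ ?_ ?_
  · have := mul 0 0
    rw [map_zero, zero_mul] at this
    exact this
  · intro F w
    rw [← ofField_mul_ofGhost]
    exact mul F w
  · exact fun x y hx hy => add x y hx hy

theorem aug_mul (x y : Loc N) : aug N (x * y) = aug N x * aug N y := by
  induction x using loc_tmul_induction with
  | add a b ha hb => rw [add_mul, map_add, map_add, ha, hb, add_mul]
  | mul F w =>
    induction y using loc_tmul_induction with
    | add a b ha hb => rw [mul_add, map_add, map_add, ha, hb, mul_add]
    | mul G w' =>
      have : ofField N F * ofGhost N w * (ofField N G * ofGhost N w') =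
          ofField N (F * G) * ofGhost N (w * w') := by
        rw [map_mul, map_mul, mul_assoc, ← mul_assoc (ofGhost N w),
          ← (ofField_commute G (ofGhost N w)).eq]
        simp only [mul_assoc]
      rw [this, aug_ofField_ofGhost, aug_ofField_ofGhost, aug_ofField_ofGhost, map_mul]
      change F.1 0 * G.1 0 * _ = _
      ring

@[simp] theorem aug_one : aug N 1 = 1 := by
  have := aug_ofField_ofGhost (N := N) 1 1
  rw [map_one, map_one, map_one, mul_one] at this
  rw [this]
  change (1 : ℝ) * 1 = 1
  norm_num

@[simp] theorem aug_gen (y : Gen N) : aug N (gen y) = 0 := by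
  have := aug_ofField_ofGhost (N := N) 1 (ghostGen y)
  rw [map_one, one_mul, ghostLift_ghostGen, mul_zero] at this
  exact this

@[simp] theorem aug_coord (i : HJet N) : aug N (ofField N (coord i)) = 0 := by
  have := aug_ofField_ofGhost (N := N) (coord i) 1
  rw [map_one, mul_one, map_one, mul_one] at this
  exact this

/-! ### Graded derivations -/

/-- `X` is a left derivation of parity `d` which respects the chain rule on functions of the
fields. -/
structure IsDer (d : ℕ) (X : Loc N →ₗ[ℝ] Loc N) : Prop where
  field_mul : ∀ F z, X (ofField N F * z) = X (ofField N F) * z + ofField N F * X z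
  gen_mul : ∀ y z, X (gen y * z) = X (gen y) * z + (-1 : ℝ) ^ (d * y.parity) • (gen y * X z)
  chain : ∀ F, X (ofField N F) =
    vectorField (ofField N) (fun i => X (ofField N (coord i))) F

theorem IsDer.map_one {d : ℕ} {X : Loc N →ₗ[ℝ] Loc N} (hX : IsDer d X) : X 1 = 0 := by
  have := hX.field_mul 1 1
  rw [_root_.map_one, mul_one, mul_one, one_mul] at this
  simpa using this

/-- The derivation of parity `d` with given values on the generators. -/
def genDer (d : ℕ) (φ : HJet N → Loc N) (v : Gen N → Loc N) (hv : Derivable gen d v) :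
    Loc N →ₗ[ℝ] Loc N :=
  mulMap (vectorField (ofField N) φ) (ofGhost N).toLinearMap
    + mulMap (ofField N).toLinearMap (ghostDer d v hv)

theorem mulMap_apply (A : FieldFn N →ₗ[ℝ] Loc N) (B : GhostAlg N →ₗ[ℝ] Loc N) (F : FieldFn N)
    (w : GhostAlg N) : mulMap A B (ofField N F * ofGhost N w) = A F * B w := by
  rw [ofField_mul_ofGhost]
  rfl

/-- The matrices are upper triangular with the identity in the lower right corner. Given this, the
upper right entry of a product of two such matrices is the graded Leibniz rule. -/
theorem ghostLift_derMatrix_apply {d : ℕ} {v : Gen N → Loc N} (hv : Derivable gen d v)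
    (w : GhostAlg N) :
    ghostLift _ (derMatrix_compatible gen_compatible hv) w 1 0 = 0 ∧
    ghostLift _ (derMatrix_compatible gen_compatible hv) w 1 1 = ofGhost N w := by
  induction w using ghostAlg_induction with
  | one => simp
  | add x y hx hy => simp [hx, hy]
  | smul r x hx => simp [hx]
  | mul y x hx =>
    rw [map_mul, ghostLift_ghostGen, Matrix.mul_apply, Matrix.mul_apply, map_mul,
      Fin.sum_univ_two, Fin.sum_univ_two, hx.1, hx.2]
    simp [gen]

theorem ghostDer_ghostGen {d : ℕ} {v : Gen N → Loc N} (hv : Derivable gen d v) (y : Gen N) :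
    ghostDer d v hv (ghostGen y) = v y := by
  change ghostLift _ (derMatrix_compatible gen_compatible hv) (ghostGen y) 0 1 = _
  rw [ghostLift_ghostGen]
  simp

theorem ghostDer_one {d : ℕ} {v : Gen N → Loc N} (hv : Derivable gen d v) :
    ghostDer d v hv 1 = 0 := by
  change ghostLift _ (derMatrix_compatible gen_compatible hv) 1 0 1 = _
  rw [map_one]
  simp

theorem ghostDer_mul {d : ℕ} {v : Gen N → Loc N} (hv : Derivable gen d v) (y : Gen N)
    (w : GhostAlg N) : ghostDer d v hv (ghostGen y * w) =
      v y * ofGhost N w + (-1 : ℝ) ^ (d * y.parity) • (gen y * ghostDer d v hv w) := by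
  change ghostLift _ (derMatrix_compatible gen_compatible hv) (ghostGen y * w) 0 1 =
    _ + _ • (_ * ghostLift _ (derMatrix_compatible gen_compatible hv) w 0 1)
  rw [map_mul, ghostLift_ghostGen, Matrix.mul_apply, Fin.sum_univ_two,
    (ghostLift_derMatrix_apply hv w).2]
  simp [add_comm]

theorem genDer_coord {d : ℕ} {φ : HJet N → Loc N} {v : Gen N → Loc N} (hv : Derivable gen d v)
    (F : FieldFn N) : genDer d φ v hv (ofField N F) = vectorField (ofField N) φ F := by
  have e : ofField N F = ofField N F * ofGhost N 1 := by rw [map_one, mul_one]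
  rw [genDer, LinearMap.add_apply, e, mulMap_apply, mulMap_apply, ghostDer_one]
  simp

theorem genDer_gen {d : ℕ} {φ : HJet N → Loc N} {v : Gen N → Loc N} (hv : Derivable gen d v)
    (y : Gen N) : genDer d φ v hv (gen y) = v y := by
  have e : gen y = ofField N 1 * ofGhost N (ghostGen y) := by rw [map_one, one_mul]; rfl
  rw [genDer, LinearMap.add_apply, e, mulMap_apply, mulMap_apply, ghostDer_ghostGen]
  have : vectorField (ofField N) φ 1 = 0 := by
    have := vectorField_ofField_mul φ 1 1
    rw [map_one (ofField N), mul_one, mul_one, one_mul] at this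
    simpa using this
  rw [this]
  simp

/-- A generator must be moved past the values on the fields to compare both sides of the Leibniz
rule; `hφ` says that these values have the parity required of a derivation of parity `d`. -/
theorem genDer_isDer {d : ℕ} {φ : HJet N → Loc N} {v : Gen N → Loc N} (hv : Derivable gen d v)
    (hφ : ∀ i y, φ i * gen y = (-1 : ℝ) ^ (d * y.parity) • (gen y * φ i)) :
    IsDer d (genDer d φ v hv) := by
  have hvf : ∀ F y, vectorField (ofField N) φ F * gen y =
      (-1 : ℝ) ^ (d * y.parity) • (gen y * vectorField (ofField N) φ F) := by
    intro F y
    rw [vectorField_eq_sum (ofField N) φ F (partialDeriv_finite F).toFinset (by simp),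
      Finset.sum_mul, Finset.mul_sum, Finset.smul_sum]
    refine Finset.sum_congr rfl fun i _ => ?_
    rw [mul_assoc, hφ, mul_smul_comm, ← mul_assoc, (ofField_commute _ _).eq, mul_assoc]
  refine ⟨fun F z => ?_, fun y z => ?_, fun F => ?_⟩
  · induction z using loc_tmul_induction with
    | add x y hx hy => rw [mul_add, map_add, hx, hy, map_add, mul_add, mul_add]; abel
    | mul G w =>
      rw [← mul_assoc, ← map_mul, genDer_coord]
      simp only [genDer, LinearMap.add_apply, mulMap_apply]
      rw [vectorField_ofField_mul]
      simp only [AlgHom.toLinearMap_apply, map_mul, mul_add, add_mul, mul_assoc]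
      abel
  · induction z using loc_tmul_induction with
    | add x y hx hy => rw [mul_add, map_add, hx, hy, map_add, mul_add, mul_add, smul_add]; abel
    | mul G w =>
      rw [genDer_gen, ← mul_assoc, ← (ofField_commute G (gen y)).eq, mul_assoc]
      change genDer d φ v hv (ofField N G * (ofGhost N (ghostGen y) * ofGhost N w)) = _
      rw [← map_mul]
      simp only [genDer, LinearMap.add_apply, mulMap_apply, ghostDer_mul,
        AlgHom.toLinearMap_apply]
      rw [map_mul]
      change vectorField (ofField N) φ G * (gen y * ofGhost N w) + _ = _
      rw [← mul_assoc, hvf, ← mul_assoc, ← (ofField_commute G (v y)).eq]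
      simp only [mul_add, mul_smul_comm, ← mul_assoc, (ofField_commute G (gen y)).eq, smul_add,
        smul_mul_assoc]
      abel
  · have : φ = fun i => genDer d φ v hv (ofField N (coord i)) := by
      funext i
      rw [genDer_coord, vectorField_coord]
    rw [← this, genDer_coord]

/-- `γ` and `δ` each consist of only one of the two summands of `genDer`. The vanishing lemmas
supply the other, so that both are covered by `genDer_isDer`. -/
theorem ghostDer_zero {d : ℕ} {v : Gen N → Loc N} (hv : Derivable gen d v) (h0 : v = 0) :
    ghostDer d v hv = 0 := by
  ext w
  rw [LinearMap.zero_apply]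
  induction w using ghostAlg_induction with
  | one => exact ghostDer_one hv
  | add x y hx hy => rw [map_add, hx, hy, add_zero]
  | smul r x hx => rw [map_smul, hx, smul_zero]
  | mul y x hx => rw [ghostDer_mul, hx, h0]; simp

theorem vectorField_zero {J A : Type} [Ring A] [Algebra ℝ A] (j : smoothLocal J →ₐ[ℝ] A) :
    vectorField j (0 : J → A) = 0 := by
  ext F
  change ∑ᶠ i, j (partialDeriv i F) * 0 = 0
  simp

theorem mulMap_zero_left (B : GhostAlg N →ₗ[ℝ] Loc N) : mulMap 0 B = 0 := by
  ext z
  induction z using loc_tmul_induction with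
  | add x y hx hy => rw [map_add, map_add, hx, hy]
  | mul F w => rw [mulMap_apply]; simp

theorem mulMap_zero_right (A : FieldFn N →ₗ[ℝ] Loc N) : mulMap A 0 = 0 := by
  ext z
  induction z using loc_tmul_induction with
  | add x y hx hy => rw [map_add, map_add, hx, hy]
  | mul F w => rw [mulMap_apply]; simp

theorem derivable_zero (d : ℕ) : Derivable gen d (0 : Gen N → Loc N) :=
  ⟨by simp, by simp, by simp⟩

theorem gamma_eq : γ N = genDer 1 gammaField 0 (derivable_zero 1) := by
  rw [γ, genDer, ghostDer_zero _ rfl, mulMap_zero_right, add_zero]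

theorem delta_eq : δ N = genDer 1 0 deltaGen deltaGen_derivable := by
  rw [δ, genDer, vectorField_zero, mulMap_zero_left, zero_add]

theorem totalDeriv_eq (μ : Fin 3) :
    totalDeriv N μ = genDer 0 (shiftField μ) (shiftGen μ) (shiftGen_derivable μ) := rfl

theorem gamma_isDer : IsDer 1 (γ N) := by
  rw [gamma_eq]
  refine genDer_isDer _ ?_
  rintro ⟨a, ⟨⟨μ, ν, ρ⟩, _⟩, α⟩ y
  have hC : ∀ (μ ν : Fin 3) α, C a μ ν α * gen y = (-1 : ℝ) ^ y.parity • (gen y * C a μ ν α) := by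
    intro μ ν α
    have := gen_compatible.comm (.C a (sort2 μ ν) α) y
    rwa [show (Gen.C a (sort2 μ ν) α).parity = 1 from rfl, one_mul] at this
  simp only [gammaField, add_mul, mul_add, hC, one_mul, smul_add]

theorem delta_isDer : IsDer 1 (δ N) := by
  rw [delta_eq]
  exact genDer_isDer _ (by simp)

theorem totalDeriv_isDer (μ : Fin 3) : IsDer 0 (totalDeriv N μ) := by
  rw [totalDeriv_eq]
  refine genDer_isDer _ ?_
  rintro ⟨a, s, α⟩ y
  rw [zero_mul, pow_zero, one_smul]
  exact ofField_commute _ _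

@[simp] theorem gamma_coord (i : HJet N) : γ N (ofField N (coord i)) = gammaField i := by
  rw [gamma_eq, genDer_coord, vectorField_coord]

@[simp] theorem gamma_gen (y : Gen N) : γ N (gen y) = 0 := by
  rw [gamma_eq, genDer_gen]; rfl

@[simp] theorem delta_coord (i : HJet N) : δ N (ofField N (coord i)) = 0 := by
  rw [delta_eq, genDer_coord, vectorField_coord]; rfl

@[simp] theorem delta_gen (y : Gen N) : δ N (gen y) = deltaGen y := by
  rw [delta_eq, genDer_gen]

@[simp] theorem totalDeriv_coord (μ : Fin 3) (i : HJet N) :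
    totalDeriv N μ (ofField N (coord i)) = shiftField μ i := by
  rw [totalDeriv_eq, genDer_coord, vectorField_coord]

@[simp] theorem totalDeriv_gen (μ : Fin 3) (y : Gen N) :
    totalDeriv N μ (gen y) = shiftGen μ y := by
  rw [totalDeriv_eq, genDer_gen]

/-- Evaluation at the origin is multiplicative. By the Leibniz and chain rules every term of `X z`
contains the value of `X` on a generator, and these values vanish at the origin. -/
theorem IsDer.aug_eq_zero {d : ℕ} {X : Loc N →ₗ[ℝ] Loc N} (hX : IsDer d X)
    (hc : ∀ i, aug N (X (ofField N (coord i))) = 0) (hg : ∀ y, aug N (X (gen y)) = 0)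
    (z : Loc N) : aug N (X z) = 0 := by
  induction z using loc_induction with
  | one => rw [hX.map_one, map_zero]
  | add x y hx hy => rw [map_add, map_add, hx, hy, add_zero]
  | smul r x hx => rw [map_smul, map_smul, hx, smul_zero]
  | mul y x hx => rw [hX.gen_mul, map_add, map_smul, aug_mul, aug_mul, hg, hx]; simp
  | field F x hx =>
    rw [hX.field_mul, map_add, aug_mul, aug_mul, hx, hX.chain,
      vectorField_eq_sum (ofField N) _ F (partialDeriv_finite F).toFinset (by simp), map_sum]
    simp [aug_mul, hc]

theorem aug_totalDeriv (μ : Fin 3) (z : Loc N) : aug N (totalDeriv N μ z) = 0 := by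
  refine (totalDeriv_isDer μ).aug_eq_zero ?_ ?_ z
  · rintro ⟨a, s, α⟩; rw [totalDeriv_coord]; exact aug_coord _
  · rintro (_ | _ | _) <;> rw [totalDeriv_gen] <;> exact aug_gen _

theorem aug_gamma (z : Loc N) : aug N (γ N z) = 0 := by
  refine gamma_isDer.aug_eq_zero ?_ ?_ z
  · rintro ⟨a, ⟨⟨μ, ν, ρ⟩, _⟩, α⟩; rw [gamma_coord]; simp [gammaField, C]
  · simp

theorem aug_delta (z : Loc N) : aug N (δ N z) = 0 := by
  refine delta_isDer.aug_eq_zero (by simp) ?_ z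
  rintro (_ | ⟨a, ⟨⟨μ, ν, ρ⟩, _⟩, α⟩ | ⟨a, ⟨⟨μ, ν⟩, _⟩, α⟩) <;>
    simp [deltaGen, Gtensor, Fronsdal, Fronsdaltr, htr, h, hs, hstr]

/-- `X` is a derivation of constant coefficients: its values on the generators are numbers. -/
structure IsScalarDer (d : ℕ) (V : Loc N →ₗ[ℝ] Loc N) (φ : HJet N → ℝ) (v : Gen N → ℝ) :
    Prop extends IsDer d V where
  coord : ∀ i, V (ofField N (coord i)) = algebraMap ℝ _ (φ i)
  gen : ∀ y, V (gen y) = algebraMap ℝ _ (v y)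
  even : ∀ i, φ i ≠ 0 → d = 0
  parity : ∀ y, v y ≠ 0 → y.parity = d

/-- The graded commutator of a derivation `V` of constant coefficients with a derivation `Y` is
determined by its values on the generators. -/
theorem IsScalarDer.comm {d e c : ℕ} {V Y Z : Loc N →ₗ[ℝ] Loc N} {φ : HJet N → ℝ}
    {v : Gen N → ℝ} (hV : IsScalarDer d V φ v) (hY : IsDer e Y) (hZ : IsDer c Z)
    (hc : (-1 : ℝ) ^ c = (-1) ^ (d + e))
    (coord_eq : ∀ i, V (Y (ofField N (Spin3.coord i))) = Z (ofField N (Spin3.coord i)))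
    (gen_eq : ∀ y, V (Y (Spin3.gen y)) = Z (Spin3.gen y))
    (leib_coord : ∀ i z, V (Y (ofField N (Spin3.coord i)) * z) =
      V (Y (ofField N (Spin3.coord i))) * z
        + (-1 : ℝ) ^ (d * e) • (Y (ofField N (Spin3.coord i)) * V z))
    (leib : ∀ y z, V (Y (Spin3.gen y) * z) = V (Y (Spin3.gen y)) * z
      + (-1 : ℝ) ^ (d * (y.parity + e)) • (Y (Spin3.gen y) * V z)) (z : Loc N) :
    V (Y z) = (-1 : ℝ) ^ (d * e) • Y (V z) + Z z := by
  classical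
  -- By symmetry of second derivatives, `F` and all its first partial derivatives depend only on
  -- variables from one finite set, over which every chain rule is expanded.
  have hsupp : ∀ F : FieldFn N, ∃ s : Finset (HJet N),
      (∀ i, partialDeriv i F ≠ 0 → i ∈ s) ∧
      ∀ j i, partialDeriv i (partialDeriv j F) ≠ 0 → i ∈ s := fun F =>
    ⟨(partialDeriv_finite F).toFinset, by simp, fun j i hi => by
      simp only [Set.Finite.mem_toFinset, Set.mem_ofPred_eq]
      exact fun h0 => hi (by rw [partialDeriv_comm, h0, map_zero])⟩
  have hfield : ∀ F, V (Y (ofField N F)) =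
      (-1 : ℝ) ^ (d * e) • Y (V (ofField N F)) + Z (ofField N F) := by
    intro F
    obtain ⟨s, hs, hs'⟩ := hsupp F
    have eY := (hY.chain F).trans (vectorField_eq_sum (ofField N) _ F s hs)
    have eV := (hV.chain F).trans (vectorField_eq_sum (ofField N) _ F s hs)
    have eZ := (hZ.chain F).trans (vectorField_eq_sum (ofField N) _ F s hs)
    have eY' := fun j => (hY.chain (partialDeriv j F)).trans
      (vectorField_eq_sum (ofField N) _ _ s (hs' j))
    have eV' := fun j => (hV.chain (partialDeriv j F)).trans
      (vectorField_eq_sum (ofField N) _ _ s (hs' j))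
    rw [eY, eV, eZ, map_sum, map_sum]
    simp only [hV.field_mul, hY.field_mul, eY', eV', coord_eq, hV.coord,
      Finset.sum_add_distrib]
    have h0 : ∀ r : ℝ, Y (algebraMap ℝ _ r) = 0 := fun r => by
      rw [Algebra.algebraMap_eq_smul_one, map_smul, hY.map_one, smul_zero]
    simp only [h0, mul_zero, Finset.sum_const_zero, add_zero]
    congr 1
    simp only [Finset.sum_mul, Finset.smul_sum]
    -- What remains on each side is the Hessian of `F` contracted with the values of `V` and `Y`;
    -- exchanging the two sums identifies them.
    rw [Finset.sum_comm]
    refine Finset.sum_congr rfl fun i _ => Finset.sum_congr rfl fun j _ => ?_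
    by_cases hφ : φ i = 0
    · simp [hφ]
    · rw [hV.even i hφ, zero_mul, pow_zero, one_smul, partialDeriv_comm i j, mul_assoc,
        Algebra.commutes, mul_assoc]
  induction z using loc_induction with
  | one => rw [hY.map_one, hV.map_one, hZ.map_one]; simp
  | add x y hx hy => simp only [map_add, hx, hy, smul_add]; abel
  | smul r x hx => simp only [map_smul, hx, smul_add, smul_comm r]
  | field F x hx =>
    obtain ⟨s, hs, -⟩ := hsupp F
    have eY := (hY.chain F).trans (vectorField_eq_sum (ofField N) _ F s hs)
    have eV := (hV.chain F).trans (vectorField_eq_sum (ofField N) _ F s hs)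
    have e1 : V (Y (ofField N F) * x) = V (Y (ofField N F)) * x
        + (-1 : ℝ) ^ (d * e) • (Y (ofField N F) * V x) := by
      rw [eY, Finset.sum_mul, map_sum, map_sum, Finset.sum_mul, Finset.sum_mul, Finset.smul_sum,
        ← Finset.sum_add_distrib]
      refine Finset.sum_congr rfl fun i _ => ?_
      rw [mul_assoc, hV.field_mul, hV.field_mul, leib_coord]
      simp only [mul_add, add_mul, mul_smul_comm, mul_assoc]
      abel
    have e2 : Y (V (ofField N F) * x) = Y (V (ofField N F)) * x + V (ofField N F) * Y x := by
      rw [eV, Finset.sum_mul, map_sum, map_sum, Finset.sum_mul, Finset.sum_mul,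
        ← Finset.sum_add_distrib]
      refine Finset.sum_congr rfl fun i _ => ?_
      simp only [hV.coord, ← Algebra.smul_def, ← Algebra.commutes (φ i), map_smul,
        smul_mul_assoc, hY.field_mul, ← smul_add]
    -- If `d ≠ 0` then `V` vanishes on the fields, so the sign is only present when it equals one.
    have e3 : (-1 : ℝ) ^ (d * e) • (V (ofField N F) * Y x) = V (ofField N F) * Y x := by
      by_cases hd : d = 0
      · rw [hd, zero_mul, pow_zero, one_smul]
      · rw [eV, Finset.sum_eq_zero fun i _ => ?_, zero_mul, smul_zero]
        rw [hV.coord, show φ i = 0 from by_contra fun h => hd (hV.even i h), map_zero, mul_zero]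
    rw [hY.field_mul, map_add, e1, hV.field_mul, hV.field_mul, map_add, e2, hY.field_mul,
      hZ.field_mul, hx, hfield]
    simp only [smul_add, add_mul, mul_add, smul_mul_assoc, mul_smul_comm, e3]
    abel
  | mul y x hx =>
    rw [hY.gen_mul, map_add, leib, map_smul, hV.gen_mul, hV.gen_mul, map_add, map_smul,
      hY.gen_mul, hZ.gen_mul, hx, gen_eq, hV.gen]
    have e2 : Y (algebraMap ℝ _ (v y) * x) = v y • Y x := by
      rw [← Algebra.smul_def, map_smul]
    -- A nonzero `v y` forces the parity of `y` to be `d`, so the two signs agree.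
    have e3 : (-1 : ℝ) ^ (d * e) • v y • Y x = (-1 : ℝ) ^ (e * y.parity) • v y • Y x := by
      by_cases hv : v y = 0
      · simp [hv]
      · rw [hV.parity y hv, mul_comm d]
    have e4 : (-1 : ℝ) ^ (c * y.parity) = (-1) ^ (d * y.parity) * (-1) ^ (e * y.parity) := by
      rw [pow_mul, hc, ← pow_mul, add_mul, pow_add]
    rw [e2]
    simp only [smul_add, mul_add, mul_smul_comm, e3, e4, ← Algebra.smul_def, pow_add]
    module


/-! ### Plane waves -/

/-- The coefficient of order `n` of the derivatives of the plane wave of momentum `k`. -/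
def pw (k : Fin 3 → ℝ) (n : ℕ) (α : Multiset (Fin 3)) : ℝ :=
  if α.card = n then (α.map k).prod else 0

/-- A derivative of `exp(k · x)` brings down one power of `k`: it raises the order by one and
multiplies by `k_μ`. -/
theorem pw_succ_cons (k : Fin 3 → ℝ) (n : ℕ) (μ : Fin 3) (α : Multiset (Fin 3)) :
    pw k (n + 1) (μ ::ₘ α) = k μ * pw k n α := by
  simp [pw]

theorem pw_zero_cons (k : Fin 3 → ℝ) (μ : Fin 3) (α : Multiset (Fin 3)) :
    pw k 0 (μ ::ₘ α) = 0 := by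
  simp [pw]

/-- Polarisations of parity `d` of a plane wave of the fields, ghosts and antifields. -/
structure Pol (N d : ℕ) where
  h : Fin N → I3 → ℝ
  C : Fin N → I2 → ℝ
  hs : Fin N → I3 → ℝ
  Cs : Fin N → I2 → ℝ
  h_even : ∀ a s, h a s ≠ 0 → d = 0
  C_odd : ∀ a s, C a s ≠ 0 → d = 1
  hs_odd : ∀ a s, hs a s ≠ 0 → d = 1
  Cs_even : ∀ a s, Cs a s ≠ 0 → d = 0
  traceC : ∀ a, ∑ μ, η μ * C a (sort2 μ μ) = 0
  traceCs : ∀ a, ∑ μ, η μ * Cs a (sort2 μ μ) = 0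

namespace Pol

variable {d : ℕ}

/-- The value of a plane wave on the jets of the fields. -/
def φ (P : Pol N d) (k : Fin 3 → ℝ) (n : ℕ) : HJet N → ℝ
  | (a, s, α) => P.h a s * pw k n α

/-- The value of a plane wave on the jets of the ghosts and antifields. -/
def v (P : Pol N d) (k : Fin 3 → ℝ) (n : ℕ) : Gen N → ℝ
  | .C a s α => P.C a s * pw k n α
  | .hs a s α => P.hs a s * pw k n α
  | .Cs a s α => P.Cs a s * pw k n α

theorem v_parity (P : Pol N d) (k : Fin 3 → ℝ) (n : ℕ) (y : Gen N) (hy : P.v k n y ≠ 0) :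
    y.parity = d := by
  cases y with
  | C a s α => exact (P.C_odd a s (left_ne_zero_of_mul hy)).symm
  | hs a s α => exact (P.hs_odd a s (left_ne_zero_of_mul hy)).symm
  | Cs a s α => exact (P.Cs_even a s (left_ne_zero_of_mul hy)).symm

theorem v_derivable (P : Pol N d) (k : Fin 3 → ℝ) (n : ℕ) :
    Derivable gen d fun y => algebraMap ℝ (Loc N) (P.v k n y) where
  comm x y := by
    by_cases hx : P.v k n x = 0
    · simp [hx]
    · rw [P.v_parity k n x hx, ← two_mul, Algebra.commutes, mul_comm y.parity, mul_assoc,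
        pow_mul]
      simp
  traceC a α := by
    simp only [Algebra.algebraMap_eq_smul_one, smul_smul, ← Finset.sum_smul, v, ← mul_assoc,
      ← Finset.sum_mul, P.traceC, zero_mul, zero_smul]
  traceCs a α := by
    simp only [Algebra.algebraMap_eq_smul_one, smul_smul, ← Finset.sum_smul, v, ← mul_assoc,
      ← Finset.sum_mul, P.traceCs, zero_mul, zero_smul]

/-- The variation along the part of order `n` of a plane wave. -/
def V (P : Pol N d) (k : Fin 3 → ℝ) (n : ℕ) : Loc N →ₗ[ℝ] Loc N :=
  genDer d (fun i => algebraMap ℝ _ (P.φ k n i)) _ (P.v_derivable k n)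

theorem V_isScalarDer (P : Pol N d) (k : Fin 3 → ℝ) (n : ℕ) :
    IsScalarDer d (P.V k n) (P.φ k n) (P.v k n) where
  toIsDer := genDer_isDer _ fun i y => by
    by_cases hi : P.φ k n i = 0
    · simp [hi]
    · have hd : (-1 : ℝ) ^ (d * y.parity) = 1 := by
        rw [P.h_even i.1 i.2.1 (left_ne_zero_of_mul hi), zero_mul, pow_zero]
      rw [hd, one_smul, Algebra.commutes]
  coord i := by rw [V, genDer_coord, vectorField_coord]
  gen y := by rw [V, genDer_gen]
  even i hi := P.h_even i.1 i.2.1 (left_ne_zero_of_mul hi)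
  parity := P.v_parity k n

@[simp] theorem V_coord (P : Pol N d) (k : Fin 3 → ℝ) (n : ℕ) (i : HJet N) :
    P.V k n (ofField N (coord i)) = algebraMap ℝ _ (P.φ k n i) :=
  (P.V_isScalarDer k n).coord i

@[simp] theorem V_gen (P : Pol N d) (k : Fin 3 → ℝ) (n : ℕ) (y : Gen N) :
    P.V k n (gen y) = algebraMap ℝ _ (P.v k n y) :=
  (P.V_isScalarDer k n).gen y

theorem V_h (P : Pol N d) (k : Fin 3 → ℝ) (n : ℕ) (a : Fin N) (μ ν ρ : Fin 3)
    (α : Multiset (Fin 3)) :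
    P.V k n (Spin3.h a μ ν ρ α) = algebraMap ℝ _ (P.h a (sort3 μ ν ρ) * pw k n α) :=
  P.V_coord k n _

theorem V_C (P : Pol N d) (k : Fin 3 → ℝ) (n : ℕ) (a : Fin N) (μ ν : Fin 3)
    (α : Multiset (Fin 3)) :
    P.V k n (Spin3.C a μ ν α) = algebraMap ℝ _ (P.C a (sort2 μ ν) * pw k n α) :=
  P.V_gen k n _

theorem V_hs (P : Pol N d) (k : Fin 3 → ℝ) (n : ℕ) (a : Fin N) (μ ν ρ : Fin 3)
    (α : Multiset (Fin 3)) :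
    P.V k n (Spin3.hs a μ ν ρ α) = algebraMap ℝ _ (P.hs a (sort3 μ ν ρ) * pw k n α) :=
  P.V_gen k n _

theorem V_Cs (P : Pol N d) (k : Fin 3 → ℝ) (n : ℕ) (a : Fin N) (μ ν : Fin 3)
    (α : Multiset (Fin 3)) :
    P.V k n (Spin3.Cs a μ ν α) = algebraMap ℝ _ (P.Cs a (sort2 μ ν) * pw k n α) :=
  P.V_gen k n _

end Pol

/-- Leibniz rule for `X` at products with left factor `a`. -/
def LeibAt (X : Loc N →ₗ[ℝ] Loc N) (s : ℝ) (a : Loc N) : Prop :=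
  ∀ z, X (a * z) = X a * z + s • (a * X z)

theorem LeibAt.zero (X : Loc N →ₗ[ℝ] Loc N) (s : ℝ) : LeibAt X s 0 := fun z => by simp

theorem LeibAt.add {X : Loc N →ₗ[ℝ] Loc N} {s : ℝ} {a b : Loc N} (ha : LeibAt X s a)
    (hb : LeibAt X s b) : LeibAt X s (a + b) := fun z => by
  rw [add_mul, map_add, ha, hb, map_add, add_mul, add_mul, smul_add]; abel

theorem LeibAt.smul {X : Loc N →ₗ[ℝ] Loc N} {s : ℝ} {a : Loc N} (r : ℝ) (ha : LeibAt X s a) :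
    LeibAt X s (r • a) := fun z => by
  rw [smul_mul_assoc, map_smul, ha, map_smul, smul_mul_assoc, smul_mul_assoc, smul_add,
    smul_comm r s]

theorem LeibAt.sub {X : Loc N →ₗ[ℝ] Loc N} {s : ℝ} {a b : Loc N} (ha : LeibAt X s a)
    (hb : LeibAt X s b) : LeibAt X s (a - b) := by
  rw [sub_eq_add_neg, ← neg_one_smul ℝ b]
  exact ha.add (hb.smul _)

theorem LeibAt.sum {X : Loc N →ₗ[ℝ] Loc N} {s : ℝ} {ι : Type} (t : Finset ι) {a : ι → Loc N}
    (ha : ∀ i, LeibAt X s (a i)) : LeibAt X s (∑ i ∈ t, a i) := by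
  classical
  induction t using Finset.induction_on with
  | empty => simpa using LeibAt.zero X s
  | insert i t hi h => rw [Finset.sum_insert hi]; exact (ha i).add h

section

variable {d : ℕ} {X : Loc N →ₗ[ℝ] Loc N} (hX : IsDer d X)

include hX

theorem IsDer.leib_h (a : Fin N) (μ ν ρ : Fin 3) (α : Multiset (Fin 3)) :
    LeibAt X 1 (h a μ ν ρ α) := fun z => by
  rw [one_smul]; exact hX.field_mul _ z

theorem IsDer.leib_gen (y : Gen N) : LeibAt X ((-1) ^ (d * y.parity)) (gen y) :=
  hX.gen_mul y

theorem IsDer.leib_C (a : Fin N) (μ ν : Fin 3) (α : Multiset (Fin 3)) :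
    LeibAt X ((-1) ^ d) (C a μ ν α) := by
  have := hX.leib_gen (.C a (sort2 μ ν) α)
  rwa [Gen.parity, mul_one] at this

theorem IsDer.leib_hs (a : Fin N) (μ ν ρ : Fin 3) (α : Multiset (Fin 3)) :
    LeibAt X ((-1) ^ d) (hs a μ ν ρ α) := by
  have := hX.leib_gen (.hs a (sort3 μ ν ρ) α)
  rwa [Gen.parity, mul_one] at this

theorem IsDer.leib_Cs (a : Fin N) (μ ν : Fin 3) (α : Multiset (Fin 3)) :
    LeibAt X 1 (Cs a μ ν α) := by
  have := hX.leib_gen (.Cs a (sort2 μ ν) α)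
  rwa [Gen.parity, mul_zero, pow_zero] at this

theorem IsDer.leib_htr (a : Fin N) (μ : Fin 3) (α : Multiset (Fin 3)) :
    LeibAt X 1 (htr a μ α) :=
  LeibAt.sum _ fun _ => (hX.leib_h _ _ _ _ _).smul _

theorem IsDer.leib_hstr (a : Fin N) (μ : Fin 3) (α : Multiset (Fin 3)) :
    LeibAt X ((-1) ^ d) (hstr a μ α) :=
  LeibAt.sum _ fun _ => (hX.leib_hs _ _ _ _ _).smul _

theorem IsDer.leib_Fronsdal (a : Fin N) (μ ν ρ : Fin 3) (α : Multiset (Fin 3)) :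
    LeibAt X 1 (Fronsdal a μ ν ρ α) :=
  ((LeibAt.sum _ fun _ => (hX.leib_h _ _ _ _ _).smul _).sub
    (LeibAt.sum _ fun _ => (((hX.leib_h _ _ _ _ _).add (hX.leib_h _ _ _ _ _)).add
      (hX.leib_h _ _ _ _ _)).smul _)).add
    (((hX.leib_htr _ _ _).add (hX.leib_htr _ _ _)).add (hX.leib_htr _ _ _))

theorem IsDer.leib_Fronsdaltr (a : Fin N) (μ : Fin 3) (α : Multiset (Fin 3)) :
    LeibAt X 1 (Fronsdaltr a μ α) :=
  LeibAt.sum _ fun _ => (hX.leib_Fronsdal _ _ _ _ _).smul _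

theorem IsDer.leib_Gtensor (a : Fin N) (μ ν ρ : Fin 3) (α : Multiset (Fin 3)) :
    LeibAt X 1 (Gtensor a μ ν ρ α) :=
  (hX.leib_Fronsdal _ _ _ _ _).sub (((((hX.leib_Fronsdaltr _ _ _).smul _).add
    ((hX.leib_Fronsdaltr _ _ _).smul _)).add ((hX.leib_Fronsdaltr _ _ _).smul _)).smul _)

end

/-- The commutator formula `IsScalarDer.comm` needs the Leibniz rule across `Y x` for generators
`x`. Here `Y x` is linear in ghosts, hence odd; the analogue for `δ` is next. -/
theorem leib_gamma_coord {d : ℕ} {X : Loc N →ₗ[ℝ] Loc N} (hX : IsDer d X) (i : HJet N) :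
    LeibAt X ((-1) ^ d) (γ N (ofField N (coord i))) := by
  obtain ⟨a, ⟨⟨μ, ν, ρ⟩, _⟩, α⟩ := i
  rw [gamma_coord]
  exact ((hX.leib_C _ _ _ _).add (hX.leib_C _ _ _ _)).add (hX.leib_C _ _ _ _)

theorem leib_delta_gen {d : ℕ} {X : Loc N →ₗ[ℝ] Loc N} (hX : IsDer d X) (y : Gen N) :
    LeibAt X ((-1) ^ (d * (y.parity + 1))) (δ N (gen y)) := by
  rw [delta_gen]
  obtain ⟨a, s, α⟩ | ⟨a, ⟨⟨μ, ν, ρ⟩, _⟩, α⟩ | ⟨a, ⟨⟨μ, ν⟩, _⟩, α⟩ := y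
  · exact LeibAt.zero _ _
  · have : (-1 : ℝ) ^ (d * (Gen.parity (.hs a ⟨(μ, ν, ρ), ‹_›⟩ α) + 1)) = 1 := by
      simp [Gen.parity, pow_mul']
    rw [this]
    exact (hX.leib_Gtensor _ _ _ _ _).smul _
  · simp only [Gen.parity, zero_add, mul_one]
    exact ((LeibAt.sum _ fun _ => hX.leib_hs _ _ _ _ _).sub
      (((LeibAt.sum _ fun _ => hX.leib_hstr _ _ _).smul _).smul _)).smul _

theorem isDer_zero (d : ℕ) : IsDer d (0 : Loc N →ₗ[ℝ] Loc N) :=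
  ⟨by simp, by simp, fun F => by
    change 0 = vectorField (ofField N) (0 : HJet N → Loc N) F
    rw [vectorField_zero]; rfl⟩

/-! ### Commutators of plane wave variations with the total derivatives and the differentials -/

namespace Pol

variable {d : ℕ}

theorem V_totalDeriv_zero (P : Pol N d) (k : Fin 3 → ℝ) (μ : Fin 3) (z : Loc N) :
    P.V k 0 (totalDeriv N μ z) = totalDeriv N μ (P.V k 0 z) := by
  have hX := P.V_isScalarDer k 0
  have := hX.comm (totalDeriv_isDer μ) (isDer_zero d) rfl ?_ ?_ ?_ ?_ z
  · rw [this]; simp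
  · rintro ⟨a, s, α⟩
    simp [shiftField, φ, pw_zero_cons]
  · rintro (_ | _ | _) <;> simp [shiftGen, v, pw_zero_cons]
  · rintro ⟨a, s, α⟩ z
    rw [totalDeriv_coord, mul_zero, pow_zero, one_smul]
    exact hX.field_mul _ _
  · rintro (_ | _ | _) z <;> rw [totalDeriv_gen] <;> exact hX.gen_mul _ _

/-- This is what makes alternating sums over orders annihilate divergences: the terms `k_μ V_n` of
neighbouring orders cancel, and the remaining terms are total derivatives, which vanish at the
origin. -/
theorem V_totalDeriv_succ (P : Pol N d) (k : Fin 3 → ℝ) (n : ℕ) (μ : Fin 3) (z : Loc N) :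
    P.V k (n + 1) (totalDeriv N μ z) = totalDeriv N μ (P.V k (n + 1) z) + k μ • P.V k n z := by
  have hX := P.V_isScalarDer k (n + 1)
  have hY := (P.V_isScalarDer k n).toIsDer
  have hZ : IsDer d (k μ • P.V k n) := by
    refine ⟨fun F z => ?_, fun y z => ?_, fun F => ?_⟩
    · simp only [LinearMap.smul_apply, hY.field_mul, smul_add, smul_mul_assoc, mul_smul_comm]
    · simp only [LinearMap.smul_apply, hY.gen_mul, smul_add, smul_mul_assoc, mul_smul_comm,
        smul_comm (k μ)]
    · obtain ⟨s, hs⟩ : ∃ s : Finset (HJet N), ∀ i, partialDeriv i F ≠ 0 → i ∈ s :=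
        ⟨(partialDeriv_finite F).toFinset, by simp⟩
      rw [LinearMap.smul_apply, hY.chain, vectorField_eq_sum _ _ F s hs,
        vectorField_eq_sum _ _ F s hs, Finset.smul_sum]
      simp only [LinearMap.smul_apply, mul_smul_comm]
  have := hX.comm (totalDeriv_isDer μ) hZ rfl ?_ ?_ ?_ ?_ z
  · rw [this]; simp
  · rintro ⟨a, s, α⟩
    simp only [totalDeriv_coord, shiftField, V_coord, φ, pw_succ_cons, LinearMap.smul_apply,
      Algebra.algebraMap_eq_smul_one, smul_smul]
    congr 1; ring
  · rintro (_ | _ | _) <;>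
    · simp only [totalDeriv_gen, shiftGen, V_gen, v, pw_succ_cons, LinearMap.smul_apply,
        Algebra.algebraMap_eq_smul_one, smul_smul]
      congr 1; ring
  · rintro ⟨a, s, α⟩ z
    rw [totalDeriv_coord, mul_zero, pow_zero, one_smul]
    exact hX.field_mul _ _
  · rintro (_ | _ | _) z <;> rw [totalDeriv_gen] <;> exact hX.gen_mul _ _

/-- A plane wave of the fields. -/
def ofh (H : Fin N → I3 → ℝ) : Pol N 0 where
  h := H
  C _ _ := 0
  hs _ _ := 0
  Cs _ _ := 0
  h_even := by simp
  C_odd := by simp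
  hs_odd := by simp
  Cs_even := by simp
  traceC := by simp
  traceCs := by simp

/-- A plane wave of the ghosts. -/
def ofC (c : Fin N → I2 → ℝ) (hc : ∀ a, ∑ μ, η μ * c a (sort2 μ μ) = 0) : Pol N 1 where
  h _ _ := 0
  C := c
  hs _ _ := 0
  Cs _ _ := 0
  h_even := by simp
  C_odd := by simp
  hs_odd := by simp
  Cs_even := by simp
  traceC := hc
  traceCs := by simp

/-- A plane wave of the antifields of antighost number one. -/
def ofhs (H : Fin N → I3 → ℝ) : Pol N 1 where
  h _ _ := 0
  C _ _ := 0
  hs := H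
  Cs _ _ := 0
  h_even := by simp
  C_odd := by simp
  hs_odd := by simp
  Cs_even := by simp
  traceC := by simp
  traceCs := by simp

/-- A plane wave of the antifields of antighost number two. -/
def ofCs (c : Fin N → I2 → ℝ) (hc : ∀ a, ∑ μ, η μ * c a (sort2 μ μ) = 0) : Pol N 0 where
  h _ _ := 0
  C _ _ := 0
  hs _ _ := 0
  Cs := c
  h_even := by simp
  C_odd := by simp
  hs_odd := by simp
  Cs_even := by simp
  traceC := by simp
  traceCs := hc

/-- The gauge variation of the fields along the ghosts of a plane wave. -/
def vee (c : Fin N → I2 → ℝ) (k : Fin 3 → ℝ) (a : Fin N) : I3 → ℝ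
  | ⟨(μ, ν, ρ), _⟩ => k μ * c a (sort2 ν ρ) + k ν * c a (sort2 μ ρ) + k ρ * c a (sort2 μ ν)

/-- `γ` already vanishes on ghosts and antifields, so the graded commutator can only be nonzero on
the fields. -/
theorem V_gamma_of_eq_zero (P : Pol N d) (k : Fin 3 → ℝ) (n : ℕ)
    (h0 : ∀ i, P.V k n (γ N (ofField N (coord i))) = 0) (z : Loc N) :
    P.V k n (γ N z) = (-1 : ℝ) ^ d • γ N (P.V k n z) := by
  have hX := P.V_isScalarDer k n
  have := hX.comm gamma_isDer (isDer_zero (d + 1)) rfl ?_ ?_ ?_ ?_ z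
  · rw [this]; simp
  · intro i; rw [h0]; rfl
  · simp
  · intro i z
    rw [mul_one]
    exact leib_gamma_coord hX.toIsDer i z
  · simp

theorem ofh_V_gamma (H : Fin N → I3 → ℝ) (k : Fin 3 → ℝ) (n : ℕ) (z : Loc N) :
    (ofh H).V k n (γ N z) = γ N ((ofh H).V k n z) := by
  rw [V_gamma_of_eq_zero, pow_zero, one_smul]
  rintro ⟨a, ⟨⟨μ, ν, ρ⟩, _⟩, α⟩
  simp [gammaField, V_C, ofh]

theorem ofhs_V_gamma (H : Fin N → I3 → ℝ) (k : Fin 3 → ℝ) (n : ℕ) (z : Loc N) :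
    (ofhs H).V k n (γ N z) = -γ N ((ofhs H).V k n z) := by
  rw [V_gamma_of_eq_zero, pow_one, neg_one_smul]
  rintro ⟨a, ⟨⟨μ, ν, ρ⟩, _⟩, α⟩
  simp [gammaField, V_C, ofhs]

theorem V_gamma_zero (P : Pol N d) (k : Fin 3 → ℝ) (z : Loc N) :
    P.V k 0 (γ N z) = (-1 : ℝ) ^ d • γ N (P.V k 0 z) := by
  rw [V_gamma_of_eq_zero]
  rintro ⟨a, ⟨⟨μ, ν, ρ⟩, _⟩, α⟩
  simp [gammaField, V_C, pw_zero_cons]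

/-- Since `γ h` is the symmetrized derivative of the ghost, varying the ghost along a wave varies
the field along its gauge variation, with one order spent on the derivative. Two odd derivations
have an even anticommutator, so the result is a field wave. -/
theorem V_gamma_succ (P : Pol N 1) (k : Fin 3 → ℝ) (n : ℕ) (z : Loc N) :
    P.V k (n + 1) (γ N z) = -γ N (P.V k (n + 1) z) + (ofh (vee P.C k)).V k n z := by
  have hX := P.V_isScalarDer k (n + 1)
  have := hX.comm gamma_isDer ((ofh (vee P.C k)).V_isScalarDer k n).toIsDer (by norm_num)
    ?_ ?_ ?_ ?_ z
  · rw [this, mul_one, pow_one, neg_one_smul]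
  · rintro ⟨a, ⟨⟨μ, ν, ρ⟩, _⟩, α⟩
    simp only [gamma_coord, gammaField, map_add, V_C, V_coord, φ, ofh, vee, pw_succ_cons]
    simp only [← map_add]
    congr 1; ring
  · intro y
    cases y <;> simp [v, ofh]
  · intro i z
    rw [mul_one]
    exact leib_gamma_coord hX.toIsDer i z
  · simp

theorem V_delta_of_eq_zero (P : Pol N d) (k : Fin 3 → ℝ) (n : ℕ)
    (h0 : ∀ y, P.V k n (δ N (gen y)) = 0) (z : Loc N) :
    P.V k n (δ N z) = (-1 : ℝ) ^ d • δ N (P.V k n z) := by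
  have hX := P.V_isScalarDer k n
  have := hX.comm delta_isDer (isDer_zero (d + 1)) rfl ?_ ?_ ?_ ?_ z
  · rw [this]; simp
  · simp
  · intro i; rw [h0]; rfl
  · simp
  · exact leib_delta_gen hX.toIsDer

theorem ofC_V_delta (c : Fin N → I2 → ℝ) (hc : ∀ a, ∑ μ, η μ * c a (sort2 μ μ) = 0)
    (k : Fin 3 → ℝ) (n : ℕ) (z : Loc N) :
    (ofC c hc).V k n (δ N z) = -δ N ((ofC c hc).V k n z) := by
  rw [V_delta_of_eq_zero, pow_one, neg_one_smul]
  have h1 : ∀ a μ ν ρ α, (ofC c hc).V k n (Spin3.h a μ ν ρ α) = 0 := by simp [V_h, ofC]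
  have h2 : ∀ a μ ν ρ α, (ofC c hc).V k n (Spin3.hs a μ ν ρ α) = 0 := by simp [V_hs, ofC]
  rintro (_ | ⟨a, ⟨⟨μ, ν, ρ⟩, _⟩, α⟩ | ⟨a, ⟨⟨μ, ν⟩, _⟩, α⟩) <;>
    simp [deltaGen, Gtensor, Fronsdal, Fronsdaltr, htr, hstr, h1, h2]

/-- The trace of a symmetric tensor. -/
def tr (H : I3 → ℝ) (μ : Fin 3) : ℝ := ∑ ν, η ν * H (sort3 μ ν ν)

/-- The Fronsdal tensor of a plane wave. -/
def fronsdal (H : I3 → ℝ) (k : Fin 3 → ℝ) (μ ν ρ : Fin 3) : ℝ :=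
  (∑ σ, η σ * (k σ * k σ)) * H (sort3 μ ν ρ)
    - ∑ σ, η σ * k σ * (k μ * H (sort3 ν ρ σ) + k ν * H (sort3 μ ρ σ) + k ρ * H (sort3 μ ν σ))
    + (k μ * k ν * tr H ρ + k μ * k ρ * tr H ν + k ν * k ρ * tr H μ)

/-- The trace of the Fronsdal tensor of a plane wave. -/
def fronsdaltr (H : I3 → ℝ) (k : Fin 3 → ℝ) (μ : Fin 3) : ℝ := ∑ ν, η ν * fronsdal H k μ ν ν

/-- The field equations of a plane wave, with upper indices. -/
def eom (H : Fin N → I3 → ℝ) (k : Fin 3 → ℝ) (a : Fin N) : I3 → ℝ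
  | ⟨(μ, ν, ρ), _⟩ => η μ * η ν * η ρ * (fronsdal (H a) k μ ν ρ
      - 1 / 2 * (metric μ ν * fronsdaltr (H a) k ρ + metric ν ρ * fronsdaltr (H a) k μ
        + metric μ ρ * fronsdaltr (H a) k ν))

theorem V_htr (P : Pol N d) (k : Fin 3 → ℝ) (n : ℕ) (a : Fin N) (μ : Fin 3)
    (α : Multiset (Fin 3)) :
    P.V k n (htr a μ α) = algebraMap ℝ _ (tr (P.h a) μ * pw k n α) := by
  simp only [htr, map_sum, map_smul, V_h, tr, Finset.sum_mul, mul_assoc]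
  simp only [Algebra.smul_def, ← map_mul]

theorem V_Fronsdal (P : Pol N d) (k : Fin 3 → ℝ) (n : ℕ) (a : Fin N) (μ ν ρ : Fin 3)
    (α : Multiset (Fin 3)) : P.V k (n + 2) (Fronsdal a μ ν ρ α) =
      algebraMap ℝ _ (fronsdal (P.h a) k μ ν ρ * pw k n α) := by
  simp only [Fronsdal, map_add, map_sub, map_sum, map_smul, V_h, V_htr, pw_succ_cons]
  simp only [Algebra.smul_def, ← map_mul, ← map_add, ← map_sum, ← map_sub]
  congr 1
  simp only [fronsdal, Fin.sum_univ_three]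
  ring

theorem V_Fronsdaltr (P : Pol N d) (k : Fin 3 → ℝ) (n : ℕ) (a : Fin N) (μ : Fin 3)
    (α : Multiset (Fin 3)) : P.V k (n + 2) (Fronsdaltr a μ α) =
      algebraMap ℝ _ (fronsdaltr (P.h a) k μ * pw k n α) := by
  simp only [Fronsdaltr, map_sum, map_smul, V_Fronsdal, fronsdaltr, Finset.sum_mul, mul_assoc]
  simp only [Algebra.smul_def, ← map_mul]

/-- The field equations contain exactly two derivatives, so they do not see the parts of order below
two. -/
theorem ofh_V_delta_low (H : Fin N → I3 → ℝ) (k : Fin 3 → ℝ) (n : ℕ) (hn : n < 2) (z : Loc N) :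
    (ofh H).V k n (δ N z) = δ N ((ofh H).V k n z) := by
  rw [V_delta_of_eq_zero, pow_zero, one_smul]
  have h1 : ∀ a μ ν ρ σ τ α, (ofh H).V k n (Spin3.h a μ ν ρ (σ ::ₘ τ ::ₘ α)) = 0 := by
    intro a μ ν ρ σ τ α
    interval_cases n <;> simp [V_h, pw]
  have h2 : ∀ a μ ν ρ α, (ofh H).V k n (Spin3.hs a μ ν ρ α) = 0 := by simp [V_hs, ofh]
  rintro (_ | ⟨a, ⟨⟨μ, ν, ρ⟩, _⟩, α⟩ | ⟨a, ⟨⟨μ, ν⟩, _⟩, α⟩) <;>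
    simp [deltaGen, Gtensor, Fronsdal, Fronsdaltr, htr, hstr, h1, h2]

/-- `δ h^*` is the field equation, so the commutator is the variation of the antifield along the
field equations of the wave, two orders lower. -/
theorem ofh_V_delta (H : Fin N → I3 → ℝ) (k : Fin 3 → ℝ) (n : ℕ) (z : Loc N) :
    (ofh H).V k (n + 2) (δ N z) =
      δ N ((ofh H).V k (n + 2) z) + (ofhs (eom H k)).V k n z := by
  have hX := (ofh H).V_isScalarDer k (n + 2)
  have := hX.comm delta_isDer ((ofhs (eom H k)).V_isScalarDer k n).toIsDer (by norm_num)
    ?_ ?_ ?_ ?_ z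
  · rw [this, zero_mul, pow_zero, one_smul]
  · rintro ⟨a, s, α⟩; simp [φ, ofhs]
  · rintro (_ | ⟨a, ⟨⟨μ, ν, ρ⟩, _⟩, α⟩ | ⟨a, ⟨⟨μ, ν⟩, _⟩, α⟩)
    · simp [deltaGen, v, ofhs]
    · simp only [delta_gen, deltaGen, Gtensor, map_sub, map_add, map_smul, V_Fronsdal,
        V_Fronsdaltr, V_gen, v]
      simp only [Algebra.smul_def, ← map_mul, ← map_add, ← map_sub]
      congr 1
      simp only [ofh, ofhs, eom]
      ring
    · have h2 : ∀ a μ ν ρ α, (ofh H).V k (n + 2) (Spin3.hs a μ ν ρ α) = 0 := by simp [V_hs, ofh]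
      simp [deltaGen, v, ofhs, hstr, h2]
  · simp
  · exact leib_delta_gen hX.toIsDer

theorem ofhs_V_delta_zero (H : Fin N → I3 → ℝ) (k : Fin 3 → ℝ) (z : Loc N) :
    (ofhs H).V k 0 (δ N z) = -δ N ((ofhs H).V k 0 z) := by
  rw [V_delta_of_eq_zero, pow_one, neg_one_smul]
  have h1 : ∀ a μ ν ρ α, (ofhs H).V k 0 (Spin3.h a μ ν ρ α) = 0 := by simp [V_h, ofhs]
  have h2 : ∀ a μ ν ρ σ α, (ofhs H).V k 0 (Spin3.hs a μ ν ρ (σ ::ₘ α)) = 0 := by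
    simp [V_hs, pw_zero_cons]
  rintro (_ | ⟨a, ⟨⟨μ, ν, ρ⟩, _⟩, α⟩ | ⟨a, ⟨⟨μ, ν⟩, _⟩, α⟩) <;>
    simp [deltaGen, Gtensor, Fronsdal, Fronsdaltr, htr, hstr, h1, h2]

/-- The Noether identities, evaluated at a plane wave. -/
def noether (H : Fin N → I3 → ℝ) (k : Fin 3 → ℝ) (a : Fin N) : I2 → ℝ
  | ⟨(μ, ν), _⟩ => -3 * ((∑ ρ, k ρ * H a (sort3 μ ν ρ))
      - 1 / 3 * metric μ ν * ∑ ρ, k ρ * tr (H a) ρ)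

/-- The trace of `η` is `3`, which the coefficient `1/3` compensates. This makes the Noether
identity an admissible polarisation of the traceless antifield `C^*`. -/
theorem noether_trace (H : Fin N → I3 → ℝ) (k : Fin 3 → ℝ) (a : Fin N) :
    ∑ μ, η μ * noether H k a (sort2 μ μ) = 0 := by
  have e₁ : sort3 0 1 1 = sort3 1 1 0 := by decide
  have e₂ : sort3 0 2 2 = sort3 2 2 0 := by decide
  have e₃ : sort3 1 2 2 = sort3 2 2 1 := by decide
  have e₄ : sort3 1 0 0 = sort3 0 0 1 := by decide
  have e₅ : sort3 2 0 0 = sort3 0 0 2 := by decide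
  have e₆ : sort3 2 1 1 = sort3 1 1 2 := by decide
  simp [sort2, noether, Fin.sum_univ_three, tr, metric, η, e₁, e₂, e₃, e₄, e₅, e₆]
  ring

theorem ofhs_V_delta_succ (H : Fin N → I3 → ℝ) (k : Fin 3 → ℝ) (n : ℕ) (z : Loc N) :
    (ofhs H).V k (n + 1) (δ N z) = -δ N ((ofhs H).V k (n + 1) z)
      + (ofCs (noether H k) (noether_trace H k)).V k n z := by
  have hX := (ofhs H).V_isScalarDer k (n + 1)
  have := hX.comm delta_isDer
    ((ofCs (noether H k) (noether_trace H k)).V_isScalarDer k n).toIsDer (by norm_num)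
    ?_ ?_ ?_ ?_ z
  · rw [this, mul_one, pow_one, neg_one_smul]
  · rintro ⟨a, s, α⟩; simp [φ, ofCs]
  · rintro (_ | ⟨a, ⟨⟨μ, ν, ρ⟩, _⟩, α⟩ | ⟨a, ⟨⟨μ, ν⟩, _⟩, α⟩)
    · simp [deltaGen, v, ofCs]
    · have h1 : ∀ a μ ν ρ α, (ofhs H).V k (n + 1) (Spin3.h a μ ν ρ α) = 0 := by simp [V_h, ofhs]
      simp [deltaGen, Gtensor, Fronsdal, Fronsdaltr, htr, h1, v, ofCs]
    · simp only [delta_gen, deltaGen, map_sub, map_sum, map_smul, hstr, V_hs, V_gen, v,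
        pw_succ_cons]
      simp only [Algebra.smul_def, ← map_mul, ← map_sum, ← map_sub]
      congr 1
      simp only [ofhs, ofCs, noether, Fin.sum_univ_three, tr]
      ring
  · simp
  · exact leib_delta_gen hX.toIsDer

/-- `noether` is defined by matching on an increasing pair; the formula is symmetric, so it holds
for indices in any order. -/
theorem noether_sort2 (H : Fin N → I3 → ℝ) (k : Fin 3 → ℝ) (a : Fin N) (μ ν : Fin 3) :
    noether H k a (sort2 μ ν) = -3 * ((∑ ρ, k ρ * H a (sort3 μ ν ρ))
      - 1 / 3 * metric μ ν * ∑ ρ, k ρ * tr (H a) ρ) := by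
  rcases le_total μ ν with hμν | hμν
  · simp [sort2, noether, hμν]
  · have e : ∀ ρ, sort3 ν μ ρ = sort3 μ ν ρ := by revert μ ν; decide
    have e' : metric ν μ = metric μ ν := by
      unfold metric
      by_cases h : μ = ν
      · simp [h]
      · simp [h, Ne.symm h]
    simp [sort2, noether, hμν, e, e']

end Pol


/-! ### The obstruction to the existence of a vertex -/

theorem IsDer.ext {d : ℕ} {X Y : Loc N →ₗ[ℝ] Loc N} (hX : IsDer d X) (hY : IsDer d Y)
    (hc : ∀ i, X (ofField N (coord i)) = Y (ofField N (coord i)))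
    (hg : ∀ y, X (gen y) = Y (gen y)) : X = Y := by
  ext z
  induction z using loc_induction with
  | one => rw [hX.map_one, hY.map_one]
  | add x y hx hy => rw [map_add, map_add, hx, hy]
  | smul r x hx => rw [map_smul, map_smul, hx]
  | mul y x hx => rw [hX.gen_mul, hY.gen_mul, hx, hg]
  | field F x hx =>
    have : (fun i => X (ofField N (coord i))) = fun i => Y (ofField N (coord i)) := funext hc
    rw [hX.field_mul, hY.field_mul, hx, hX.chain, hY.chain, this]

theorem IsDer.smul {d : ℕ} {X : Loc N →ₗ[ℝ] Loc N} (hX : IsDer d X) (r : ℝ) :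
    IsDer d (r • X) := by
  refine ⟨fun F z => ?_, fun y z => ?_, fun F => ?_⟩
  · simp only [LinearMap.smul_apply, hX.field_mul, smul_add, smul_mul_assoc, mul_smul_comm]
  · simp only [LinearMap.smul_apply, hX.gen_mul, smul_add, smul_mul_assoc, mul_smul_comm,
      smul_comm r]
  · obtain ⟨s, hs⟩ : ∃ s : Finset (HJet N), ∀ i, partialDeriv i F ≠ 0 → i ∈ s :=
      ⟨(partialDeriv_finite F).toFinset, by simp⟩
    rw [LinearMap.smul_apply, hX.chain, vectorField_eq_sum _ _ F s hs,
      vectorField_eq_sum _ _ F s hs, Finset.smul_sum]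
    simp only [LinearMap.smul_apply, mul_smul_comm]

theorem IsDer.add {d : ℕ} {X Y : Loc N →ₗ[ℝ] Loc N} (hX : IsDer d X) (hY : IsDer d Y) :
    IsDer d (X + Y) := by
  refine ⟨fun F z => ?_, fun y z => ?_, fun F => ?_⟩
  · simp only [LinearMap.add_apply, hX.field_mul, hY.field_mul, mul_add, add_mul]; abel
  · simp only [LinearMap.add_apply, hX.gen_mul, hY.gen_mul, mul_add, add_mul, smul_add]; abel
  · obtain ⟨s, hs⟩ : ∃ s : Finset (HJet N), ∀ i, partialDeriv i F ≠ 0 → i ∈ s :=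
      ⟨(partialDeriv_finite F).toFinset, by simp⟩
    rw [LinearMap.add_apply, hX.chain, hY.chain, vectorField_eq_sum _ _ F s hs,
      vectorField_eq_sum _ _ F s hs, vectorField_eq_sum _ _ F s hs, ← Finset.sum_add_distrib]
    simp only [LinearMap.add_apply, mul_add]

namespace Pol

variable {d : ℕ}

theorem V_congr {P Q : Pol N d} {k l : Fin 3 → ℝ} {n : ℕ} (hφ : P.φ k n = Q.φ l n)
    (hv : P.v k n = Q.v l n) : P.V k n = Q.V l n :=
  (P.V_isScalarDer k n).ext (Q.V_isScalarDer l n).toIsDer (by simp [hφ]) (by simp [hv])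

theorem pw_zero (k l : Fin 3 → ℝ) : pw k 0 = pw l 0 := by
  funext α
  simp only [pw, Multiset.card_eq_zero]
  split_ifs with h
  · simp [h]
  · rfl

/-- At order one only single derivatives contribute, linearly in `k`. This is the source of
`transf_momentum`. -/
theorem pw_one (k : Fin 3 → ℝ) (α : Multiset (Fin 3)) :
    pw k 1 α = k 0 * pw (Pi.single 0 1) 1 α + k 1 * pw (Pi.single 1 1) 1 α
      + k 2 * pw (Pi.single 2 1) 1 α := by
  simp only [pw]
  split_ifs with h
  · obtain ⟨μ, rfl⟩ := Multiset.card_eq_one.mp h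
    fin_cases μ <;> simp
  · simp

theorem V_zero (P : Pol N d) (k l : Fin 3 → ℝ) : P.V k 0 = P.V l 0 := by
  refine V_congr ?_ ?_
  · funext ⟨a, s, α⟩
    simp only [φ, pw_zero k l]
  · funext y
    cases y <;> simp only [v, pw_zero k l]

theorem V_one (P : Pol N d) (k : Fin 3 → ℝ) :
    P.V k 1 = k 0 • P.V (Pi.single 0 1) 1 + k 1 • P.V (Pi.single 1 1) 1
      + k 2 • P.V (Pi.single 2 1) 1 := by
  have hP := fun k => (P.V_isScalarDer k 1).toIsDer
  refine (hP k).ext ((((hP _).smul _).add ((hP _).smul _)).add ((hP _).smul _)) ?_ ?_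
  · rintro ⟨a, s, α⟩
    simp only [LinearMap.add_apply, LinearMap.smul_apply, V_coord, φ, pw_one k]
    simp only [Algebra.smul_def, ← map_mul, ← map_add]
    congr 1; ring
  · rintro (⟨a, s, α⟩ | ⟨a, s, α⟩ | ⟨a, s, α⟩) <;>
    · simp only [LinearMap.add_apply, LinearMap.smul_apply, V_gen, v, pw_one k]
      simp only [Algebra.smul_def, ← map_mul, ← map_add]
      congr 1; ring

theorem ofh_V_add_smul (H H' : Fin N → I3 → ℝ) (r : ℝ) (k : Fin 3 → ℝ) (n : ℕ) :
    (ofh (H + r • H')).V k n = (ofh H).V k n + r • (ofh H').V k n := by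
  have hP := fun H : Fin N → I3 → ℝ => ((ofh H).V_isScalarDer k n).toIsDer
  refine (hP _).ext ((hP _).add ((hP _).smul _)) ?_ ?_
  · rintro ⟨a, s, α⟩
    simp only [LinearMap.add_apply, LinearMap.smul_apply, V_coord, φ]
    simp only [ofh, Pi.add_apply, Pi.smul_apply, smul_eq_mul]
    simp only [Algebra.smul_def, ← map_mul, ← map_add]
    congr 1; ring
  · rintro (⟨a, s, α⟩ | ⟨a, s, α⟩ | ⟨a, s, α⟩) <;> simp [v, ofh]

/-- The values on generators are numbers, and one of the two derivations is even, so they commute.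
It is used to bring every term to the order of factors in `transf`. -/
theorem ofh_V_ofhs_V (H G : Fin N → I3 → ℝ) (k l : Fin 3 → ℝ) (n m : ℕ) (z : Loc N) :
    (ofh H).V k n ((ofhs G).V l m z) = (ofhs G).V l m ((ofh H).V k n z) := by
  have hX := (ofh H).V_isScalarDer k n
  have hY := (ofhs G).V_isScalarDer l m
  have h0 : ∀ r : ℝ, (ofh H).V k n (algebraMap ℝ _ r) = 0 := fun r => by
    rw [Algebra.algebraMap_eq_smul_one, map_smul, hX.map_one, smul_zero]
  have := hX.comm hY.toIsDer (isDer_zero 1) (by norm_num) ?_ ?_ ?_ ?_ z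
  · rw [this]; simp
  · intro i; rw [V_coord, h0]; rfl
  · intro y; rw [V_gen, h0]; rfl
  · intro i z
    rw [V_coord, h0, ← Algebra.smul_def, map_smul, ← Algebra.smul_def]
    simp
  · intro y z
    rw [V_gen, h0, ← Algebra.smul_def, map_smul, ← Algebra.smul_def]
    simp

theorem ofC_V_gamma_succ (c : Fin N → I2 → ℝ) (hc : ∀ a, ∑ μ, η μ * c a (sort2 μ μ) = 0)
    (k : Fin 3 → ℝ) (n : ℕ) (z : Loc N) : (ofC c hc).V k (n + 1) (γ N z) =
      -γ N ((ofC c hc).V k (n + 1) z) + (ofh (vee c k)).V k n z :=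
  V_gamma_succ _ k n z

/-- The part of first order in the derivatives of the transformations of the fields `H` with
constant ghosts `P`, contracted with `G`. -/
def transf (P : Pol N 1) (z : Loc N) (G : Fin N → I3 → ℝ) (k : Fin 3 → ℝ)
    (H : Fin N → I3 → ℝ) : ℝ :=
  aug N ((ofhs G).V k 0 ((ofh H).V k 1 (P.V 0 0 z)))
    - aug N ((ofhs G).V k 1 ((ofh H).V k 0 (P.V 0 0 z)))

theorem transf_add_smul (P : Pol N 1) (z : Loc N) (G : Fin N → I3 → ℝ) (k : Fin 3 → ℝ)
    (H H' : Fin N → I3 → ℝ) (r : ℝ) :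
    transf P z G k (H + r • H') = transf P z G k H + r * transf P z G k H' := by
  simp only [transf, ofh_V_add_smul, LinearMap.add_apply, LinearMap.smul_apply, map_add,
    map_smul, smul_eq_mul]
  ring

theorem transf_momentum (P : Pol N 1) (z : Loc N) (G : Fin N → I3 → ℝ) (k : Fin 3 → ℝ)
    (H : Fin N → I3 → ℝ) :
    transf P z G k H = k 0 * transf P z G (Pi.single 0 1) H
      + k 1 * transf P z G (Pi.single 1 1) H + k 2 * transf P z G (Pi.single 2 1) H := by
  simp only [transf]
  rw [(ofh H).V_one k, (ofhs G).V_one k, (ofh H).V_zero k 0, (ofhs G).V_zero k 0]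
  simp only [fun μ : Fin 3 => (ofh H).V_zero (Pi.single μ 1) 0,
    fun μ : Fin 3 => (ofhs G).V_zero (Pi.single μ 1) 0, LinearMap.add_apply,
    LinearMap.smul_apply, map_add, map_smul, smul_eq_mul]
  ring

/-- Integrating the lift equation against an antifield wave, a ghost wave of opposite momentum and a
constant ghost leaves, at second order in the momentum, the transformation of a pure gauge field
from `γ a₁` and the Noether identity contracted with the gauge algebra from `δ a₂`. The choice of
lift drops out. -/
theorem transf_vee {a₁ a₂ : Loc N} {b : Fin 3 → Loc N}
    (hlift : γ N a₁ + δ N a₂ + totalDiv b = 0) (c c' : Fin N → I2 → ℝ)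
    (hc : ∀ a, ∑ μ, η μ * c a (sort2 μ μ) = 0) (hc' : ∀ a, ∑ μ, η μ * c' a (sort2 μ μ) = 0)
    (G : Fin N → I3 → ℝ) (k : Fin 3 → ℝ) :
    transf (ofC c hc) a₁ G k (vee c' k) =
      aug N ((ofCs (noether G k) (noether_trace G k)).V k 1
        ((ofC c' hc').V k 0 ((ofC c hc).V 0 0 a₂)))
      - aug N ((ofCs (noether G k) (noether_trace G k)).V k 0
        ((ofC c' hc').V k 1 ((ofC c hc).V 0 0 a₂))) := by
  -- The alternating sum over splittings of the order `2` between the two waves. The constant ghost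
  -- is a wave of momentum and order zero: it commutes with total derivatives and sees only
  -- undifferentiated ghosts.
  let L : Loc N →ₗ[ℝ] ℝ := aug N ∘ₗ
    ((ofhs G).V k 0 ∘ₗ (ofC c' hc').V k 2 - (ofhs G).V k 1 ∘ₗ (ofC c' hc').V k 1
      + (ofhs G).V k 2 ∘ₗ (ofC c' hc').V k 0) ∘ₗ (ofC c hc).V 0 0
  have hL : ∀ z, L z = aug N ((ofhs G).V k 0 ((ofC c' hc').V k 2 ((ofC c hc).V 0 0 z)))
      - aug N ((ofhs G).V k 1 ((ofC c' hc').V k 1 ((ofC c hc).V 0 0 z)))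
      + aug N ((ofhs G).V k 2 ((ofC c' hc').V k 0 ((ofC c hc).V 0 0 z))) := by
    intro z
    simp [L]
  have hD : ∀ μ z, L (totalDeriv N μ z) = 0 := by
    intro μ z
    rw [hL]
    simp only [V_totalDeriv_zero, V_totalDeriv_succ, map_add, map_smul, aug_totalDeriv,
      smul_eq_mul]
    ring
  have hγ : L (γ N a₁) = -transf (ofC c hc) a₁ G k (vee c' k) := by
    rw [hL]
    simp only [V_gamma_zero, ofC_V_gamma_succ, map_add, map_smul, map_neg, ofhs_V_gamma,
      aug_gamma, pow_one, smul_eq_mul, transf]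
    ring
  have hδ : L (δ N a₂) = _ := hL _
  simp only [ofC_V_delta, map_neg, neg_neg, ofhs_V_delta_zero, ofhs_V_delta_succ, aug_delta,
    map_add] at hδ
  have h0 := congrArg L hlift
  simp only [totalDiv, map_add, map_sum, hD, hγ, hδ, map_zero, Finset.sum_const_zero] at h0
  linarith

/-- Infinitesimally this is the invariance of the quadratic action under the transformations with a
constant ghost. The vertex does not contribute: field waves and constant ghosts produce no
commutator with `γ`, so its contribution is `γ`-exact and vanishes at the origin. -/
theorem transf_eom {a₀ a₁ : Loc N} {b : Fin 3 → Loc N}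
    (hlift : γ N a₀ + δ N a₁ + totalDiv b = 0) (c : Fin N → I2 → ℝ)
    (hc : ∀ a, ∑ μ, η μ * c a (sort2 μ μ) = 0) (H H' : Fin N → I3 → ℝ) (k : Fin 3 → ℝ) :
    transf (ofC c hc) a₁ (eom H k) k H' = transf (ofC c hc) a₁ (eom H' k) k H := by
  -- The total order is `3`: two derivatives in the field equations and one in the transformation.
  -- The alternating signs of this odd order turn the equation into symmetry under the exchange of
  -- `H` and `H'`.
  let L : Loc N →ₗ[ℝ] ℝ := aug N ∘ₗ
    ((ofh H).V k 0 ∘ₗ (ofh H').V k 3 - (ofh H).V k 1 ∘ₗ (ofh H').V k 2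
      + (ofh H).V k 2 ∘ₗ (ofh H').V k 1 - (ofh H).V k 3 ∘ₗ (ofh H').V k 0) ∘ₗ (ofC c hc).V 0 0
  have hL : ∀ z, L z = aug N ((ofh H).V k 0 ((ofh H').V k 3 ((ofC c hc).V 0 0 z)))
      - aug N ((ofh H).V k 1 ((ofh H').V k 2 ((ofC c hc).V 0 0 z)))
      + aug N ((ofh H).V k 2 ((ofh H').V k 1 ((ofC c hc).V 0 0 z)))
      - aug N ((ofh H).V k 3 ((ofh H').V k 0 ((ofC c hc).V 0 0 z))) := by
    intro z
    simp [L]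
  have hD : ∀ μ z, L (totalDeriv N μ z) = 0 := by
    intro μ z
    rw [hL]
    simp only [V_totalDeriv_zero, V_totalDeriv_succ, map_add, map_smul, aug_totalDeriv,
      smul_eq_mul]
    ring
  have hγ : L (γ N a₀) = 0 := by
    rw [hL]
    simp only [V_gamma_zero, map_smul, ofh_V_gamma, aug_gamma, smul_zero]
    ring
  have hδ : L (δ N a₁) = _ := hL _
  simp only [ofC_V_delta, map_neg, ofh_V_delta, ofh_V_delta_low _ _ 0 (by norm_num),
    ofh_V_delta_low _ _ 1 (by norm_num), aug_delta, map_add, ofh_V_ofhs_V] at hδ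
  have h0 := congrArg L hlift
  simp only [totalDiv, map_add, map_sum, hD, hγ, hδ, map_zero, Finset.sum_const_zero] at h0
  simp only [transf]
  linarith

/-- The two ghost variations can hit the two ghosts in either order; ghosts are odd, whence the
relative sign. -/
theorem aug_V_Cs_C_C (n : Fin N → I2 → ℝ) (hn : ∀ a, ∑ μ, η μ * n a (sort2 μ μ) = 0)
    (c c' : Fin N → I2 → ℝ)
    (hc : ∀ a, ∑ μ, η μ * c a (sort2 μ μ) = 0) (hc' : ∀ a, ∑ μ, η μ * c' a (sort2 μ μ) = 0)
    (k : Fin 3 → ℝ) (i j : ℕ) (x y z : Fin N) (α β μ ν ρ τ : Fin 3) (A B : Multiset (Fin 3)) :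
    aug N ((ofCs n hn).V k i ((ofC c' hc').V k j ((ofC c hc).V 0 0
      (Spin3.Cs x α β 0 * Spin3.C y μ ν A * Spin3.C z ρ τ B)))) =
    n x (sort2 α β) * pw k i 0 * (c y (sort2 μ ν) * pw 0 0 A * (c' z (sort2 ρ τ) * pw k j B)
      - c z (sort2 ρ τ) * pw 0 0 B * (c' y (sort2 μ ν) * pw k j A)) := by
  have h1 := ((ofC c hc).V_isScalarDer 0 0).toIsDer
  have h2 := ((ofC c' hc').V_isScalarDer k j).toIsDer
  have h3 := ((ofCs n hn).V_isScalarDer k i).toIsDer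
  have e1 : (ofC c hc).V 0 0 (Spin3.Cs x α β 0 * Spin3.C y μ ν A * Spin3.C z ρ τ B) =
      Spin3.Cs x α β 0 * ((c y (sort2 μ ν) * pw 0 0 A) • Spin3.C z ρ τ B
        - (c z (sort2 ρ τ) * pw 0 0 B) • Spin3.C y μ ν A) := by
    rw [mul_assoc, h1.leib_Cs, h1.leib_C, V_Cs, V_C, V_C]
    simp only [Algebra.algebraMap_eq_smul_one]
    simp [ofC, sub_eq_add_neg]
  have e2 : (ofC c' hc').V k j (Spin3.Cs x α β 0 * ((c y (sort2 μ ν) * pw 0 0 A) •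
        Spin3.C z ρ τ B - (c z (sort2 ρ τ) * pw 0 0 B) • Spin3.C y μ ν A)) =
      (c y (sort2 μ ν) * pw 0 0 A * (c' z (sort2 ρ τ) * pw k j B)
      - c z (sort2 ρ τ) * pw 0 0 B * (c' y (sort2 μ ν) * pw k j A)) • Spin3.Cs x α β 0 := by
    rw [h2.leib_Cs, V_Cs, map_sub, map_smul, map_smul, V_C, V_C]
    simp only [Algebra.algebraMap_eq_smul_one]
    simp [ofC, smul_smul, sub_smul, mul_sub]
  rw [e1, e2, map_smul, map_smul, V_Cs, Algebra.algebraMap_eq_smul_one, map_smul, aug_one]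
  simp only [ofCs, smul_eq_mul, mul_one]
  ring

theorem aug_V_a₂ (f : Fin N → Fin N → Fin N → ℝ)
    (n : Fin N → I2 → ℝ) (hn : ∀ a, ∑ μ, η μ * n a (sort2 μ μ) = 0)
    (c c' : Fin N → I2 → ℝ)
    (hc : ∀ a, ∑ μ, η μ * c a (sort2 μ μ) = 0) (hc' : ∀ a, ∑ μ, η μ * c' a (sort2 μ μ) = 0)
    (k : Fin 3 → ℝ) (i j : ℕ) :
    aug N ((ofCs n hn).V k i ((ofC c' hc').V k j ((ofC c hc).V 0 0 (a₂ f)))) =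
    ∑ x, ∑ y, ∑ z, f x y z * (pw k i 0 * ∑ μ, ∑ ν, ∑ ρ, ε μ ν ρ * ∑ α, ∑ β,
      n x (sort2 α β) * c y (sort2 μ α) * (1 / 2 *
        (c' z (sort2 ρ β) * pw k j {ν} - c' z (sort2 ν β) * pw k j {ρ}))) := by
  -- A constant ghost has no derivative, so it cannot occupy the differentiated slot of `a₂`; only
  -- one of the two assignments survives.
  have hpw : ∀ ν, pw 0 0 {ν} = 0 := fun ν => pw_zero_cons 0 ν 0
  have hpw0 : pw 0 0 0 = 1 := by simp [pw]
  simp only [a₂, T, map_sum, map_smul, mul_sub, mul_smul_comm, map_sub, aug_V_Cs_C_C, hpw, hpw0,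
    smul_eq_mul, Finset.mul_sum]
  refine Finset.sum_congr rfl fun _ _ => Finset.sum_congr rfl fun _ _ =>
    Finset.sum_congr rfl fun _ _ => Finset.sum_congr rfl fun _ _ => Finset.sum_congr rfl fun _ _ =>
    Finset.sum_congr rfl fun _ _ => Finset.sum_congr rfl fun _ _ => Finset.sum_congr rfl fun _ _ => ?_
  ring

/-- The component `t` of a symmetric tensor. -/
def comp3 (t : Fin 3 × Fin 3 × Fin 3) (s : I3) : ℝ := if s.1 = t then 1 else 0

/-- The component `t` of a symmetric tensor. -/
def comp2 (t : Fin 3 × Fin 3) (s : I2) : ℝ := if s.1 = t then 1 else 0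

/-- The coefficient of `f` in the commutator of the gauge transformations with constant ghosts `c`
and with ghosts `c'` of momentum `k`, contracted with `G`. -/
def bracket (G : I3 → ℝ) (c : I2 → ℝ) (k : Fin 3 → ℝ) (c' : I2 → ℝ) : ℝ :=
  ∑ μ, ∑ ν, ∑ ρ, ε μ ν ρ * ∑ α, ∑ β, noether (N := 1) (fun _ => G) k 0 (sort2 α β) *
    c (sort2 μ α) * (1 / 2 * (c' (sort2 ρ β) * k ν - c' (sort2 ν β) * k ρ))

theorem single_trace {c : I2 → ℝ} (hc : ∑ μ, η μ * c (sort2 μ μ) = 0) (b a : Fin N) :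
    ∑ μ, η μ * Pi.single (M := fun _ => I2 → ℝ) b c a (sort2 μ μ) = 0 := by
  by_cases h : a = b
  · subst h; simpa using hc
  · simp [Pi.single_eq_of_ne h]

/-- Polarisations concentrated on single internal indices isolate one structure constant. Only the
term with an order-zero `C^*` wave remains, since `C^*` is undifferentiated in `a₂`. -/
theorem transf_single {f : Fin N → Fin N → Fin N → ℝ} {a1 : Loc N} {b : Fin 3 → Loc N}
    (hlift : γ N a1 + δ N (a₂ f) + totalDiv b = 0) (x y z : Fin N) (G : I3 → ℝ) {c c' : I2 → ℝ}
    (hc : ∑ μ, η μ * c (sort2 μ μ) = 0) (hc' : ∑ μ, η μ * c' (sort2 μ μ) = 0)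
    (k : Fin 3 → ℝ) :
    transf (ofC _ (single_trace hc y)) a1 (Pi.single x G) k (vee (Pi.single z c') k) =
      -(f x y z * bracket G c k c') := by
  rw [transf_vee hlift _ _ _ (single_trace hc' z), aug_V_a₂, aug_V_a₂]
  have h1 : pw k 1 0 = 0 := by simp [pw]
  have h0 : pw k 0 0 = 1 := by simp [pw]
  have hk : ∀ ν, pw k 1 {ν} = k ν := by simp [pw]
  have hn : ∀ a s, a ≠ x →
      noether (Pi.single (M := fun _ => I3 → ℝ) x G) k a s = 0 := by
    rintro a ⟨⟨μ, ν⟩, _⟩ h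
    simp [noether, tr, Pi.single_eq_of_ne h]
  have hn' : ∀ s, noether (Pi.single (M := fun _ => I3 → ℝ) x G) k x s =
      noether (N := 1) (fun _ => G) k 0 s := by
    rintro ⟨⟨μ, ν⟩, _⟩
    simp [noether, tr]
  simp only [h1, h0, hk, zero_mul, mul_zero, one_mul, Finset.sum_const_zero, zero_sub]
  rw [Finset.sum_eq_single x, Finset.sum_eq_single y, Finset.sum_eq_single z]
  · simp [bracket, hn']
  · intro b _ hb
    simp [Pi.single_eq_of_ne hb]
  · simp
  · intro b _ hb
    simp [Pi.single_eq_of_ne hb]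
  · simp
  · intro b _ hb
    simp [hn b _ hb]
  · simp

theorem eom_single (x : Fin N) (X : I3 → ℝ) (k : Fin 3 → ℝ) :
    eom (Pi.single x X) k = Pi.single x (eom (N := 1) (fun _ => X) k 0) := by
  funext a ⟨⟨μ, ν, ρ⟩, _⟩
  by_cases h : a = x
  · subst h
    simp [eom]
  · simp [eom, Pi.single_eq_of_ne h, fronsdal, fronsdaltr, tr]

/-- Linearity in the momentum splits the value at the sum of two basis momenta, and linearity in the
field splits `H₁` at the momentum `e_0`. In the application `H₀` and `H₁` are pure gauge at each
momentum where they are used, although `H` at momentum `e_0` need not be. -/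
theorem transf_decomp (P : Pol N 1) (z : Loc N) (G H H₀ H₁ : Fin N → I3 → ℝ) (i : Fin 3)
    (hi : i ≠ 0) (h1 : H₁ = H₀ + (2 : ℝ) • H) :
    transf P z G (Pi.single 0 1) H = 1 / 2 * (transf P z G (Pi.single 0 1 + Pi.single i 1) H₁
      - transf P z G (Pi.single 0 1) H₀ - transf P z G (Pi.single i 1) H₁) := by
  have e : transf P z G (Pi.single 0 1 + Pi.single i 1) H₁ =
      transf P z G (Pi.single 0 1) H₁ + transf P z G (Pi.single i 1) H₁ := by
    rw [transf_momentum]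
    fin_cases i
    · exact absurd rfl hi
    · simp
    · simp
  rw [e, h1, transf_add_smul P z G (Pi.single 0 1)]
  ring

theorem comp2_trace {t : Fin 3 × Fin 3} (ht : t.1 ≠ t.2) :
    ∑ μ, η μ * comp2 t (sort2 μ μ) = 0 := by
  obtain ⟨i, j⟩ := t
  refine Finset.sum_eq_zero fun μ _ => ?_
  have : (μ, μ) ≠ (i, j) := fun h => ht ((congrArg Prod.fst h).symm.trans (congrArg Prod.snd h))
  simp [comp2, sort2, this]

theorem comp2_add_trace {t t' : Fin 3 × Fin 3} (ht : t.1 ≠ t.2) (ht' : t'.1 ≠ t'.2) :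
    ∑ μ, η μ * (comp2 t + comp2 t') (sort2 μ μ) = 0 := by
  simp only [Pi.add_apply, mul_add, Finset.sum_add_distrib, comp2_trace ht, comp2_trace ht',
    add_zero]

/-- A traceless constant ghost. -/
def ghost₀ : I2 → ℝ := comp2 (0, 0) + comp2 (1, 1)

theorem ghost₀_trace : ∑ μ, η μ * ghost₀ (sort2 μ μ) = 0 := by
  simp +decide [ghost₀, comp2, sort2, Fin.sum_univ_three, η]

theorem fronsdal_time (X : I3 → ℝ) (h0 : ∀ μ ν, X (sort3 μ ν 0) = 0) (μ ν ρ : Fin 3) :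
    fronsdal X (Pi.single 0 1) μ ν ρ = -X (sort3 μ ν ρ)
      + ((Pi.single 0 1 : Fin 3 → ℝ) μ * (Pi.single 0 1 : Fin 3 → ℝ) ν * tr X ρ
        + (Pi.single 0 1 : Fin 3 → ℝ) μ * (Pi.single 0 1 : Fin 3 → ℝ) ρ * tr X ν
        + (Pi.single 0 1 : Fin 3 → ℝ) ν * (Pi.single 0 1 : Fin 3 → ℝ) ρ * tr X μ) := by
  simp [fronsdal, Fin.sum_univ_three, h0, η]

/-- For a spatial tensor with momentum along time the divergence vanishes, and the trace of the
Fronsdal tensor is `-2` in direction `2`. The trace subtraction cancels the components `(1,1,2)` and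
`(0,0,2)` and leaves `(2,2,2)`. -/
theorem eom_112 : eom (N := 1) (fun _ => comp3 (1, 1, 2)) (Pi.single 0 1) 0 =
    (3 : ℝ) • comp3 (2, 2, 2) := by
  have h0 : ∀ μ ν, comp3 (1, 1, 2) (sort3 μ ν 0) = 0 := fun μ ν =>
    if_neg (by revert μ ν; decide)
  have ht : tr (comp3 (1, 1, 2)) = Pi.single 2 1 := by
    funext μ
    fin_cases μ <;> simp +decide [tr, comp3, sort3, Fin.sum_univ_three, η]
  have hF := fun μ ν ρ => fronsdal_time _ h0 μ ν ρ
  simp only [ht] at hF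
  have hFt : fronsdaltr (comp3 (1, 1, 2)) (Pi.single 0 1) = Pi.single 2 (-2) := by
    funext μ
    simp only [fronsdaltr, hF]
    fin_cases μ <;> simp +decide [comp3, sort3, Fin.sum_univ_three, η]
    norm_num
  funext ⟨⟨μ, ν, ρ⟩, h⟩
  simp only [eom, hF, hFt]
  fin_cases μ <;> fin_cases ν <;> fin_cases ρ <;> revert h <;>
    simp +decide [comp3, η, metric]
  norm_num

theorem eom_122 : eom (N := 1) (fun _ => comp3 (1, 2, 2)) (Pi.single 0 1) 0 =
    (3 : ℝ) • comp3 (1, 1, 1) := by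
  have h0 : ∀ μ ν, comp3 (1, 2, 2) (sort3 μ ν 0) = 0 := fun μ ν =>
    if_neg (by revert μ ν; decide)
  have ht : tr (comp3 (1, 2, 2)) = Pi.single 1 1 := by
    funext μ
    fin_cases μ <;> simp +decide [tr, comp3, sort3, Fin.sum_univ_three, η]
  have hF := fun μ ν ρ => fronsdal_time _ h0 μ ν ρ
  simp only [ht] at hF
  have hFt : fronsdaltr (comp3 (1, 2, 2)) (Pi.single 0 1) = Pi.single 1 (-2) := by
    funext μ
    simp only [fronsdaltr, hF]
    fin_cases μ <;> simp +decide [comp3, sort3, Fin.sum_univ_three, η]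
    norm_num
  funext ⟨⟨μ, ν, ρ⟩, h⟩
  simp only [eom, hF, hFt]
  fin_cases μ <;> fin_cases ν <;> fin_cases ρ <;> revert h <;>
    simp +decide [comp3, η, metric]
  norm_num

theorem noether_222 (k : Fin 3 → ℝ) (μ ν : Fin 3) :
    noether (N := 1) (fun _ => (3 : ℝ) • comp3 (2, 2, 2)) k 0 (sort2 μ ν) =
      k 2 * if μ = ν then (if μ = 2 then -6 else 3 * η μ) else 0 := by
  have ht : tr ((3 : ℝ) • comp3 (2, 2, 2)) = Pi.single 2 3 := by
    funext μ
    fin_cases μ <;> simp +decide [tr, comp3, sort3, Fin.sum_univ_three, η]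
  rw [noether_sort2]
  simp only [ht]
  fin_cases μ <;> fin_cases ν <;>
    simp +decide [comp3, sort3, η, metric, Fin.sum_univ_three]
  all_goals ring

theorem noether_111 (k : Fin 3 → ℝ) (μ ν : Fin 3) :
    noether (N := 1) (fun _ => (3 : ℝ) • comp3 (1, 1, 1)) k 0 (sort2 μ ν) =
      k 1 * if μ = ν then (if μ = 1 then -6 else 3 * η μ) else 0 := by
  have ht : tr ((3 : ℝ) • comp3 (1, 1, 1)) = Pi.single 1 3 := by
    funext μ
    fin_cases μ <;> simp +decide [tr, comp3, sort3, Fin.sum_univ_three, η]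
  rw [noether_sort2]
  simp only [ht]
  fin_cases μ <;> fin_cases ν <;>
    simp +decide [comp3, sort3, η, metric, Fin.sum_univ_three]
  all_goals ring

theorem ghost₀_sort2 (μ ν : Fin 3) :
    ghost₀ (sort2 μ ν) = if μ = ν then (if μ = 2 then 0 else 1) else 0 := by
  fin_cases μ <;> fin_cases ν <;> simp +decide [ghost₀, comp2, sort2]

/-- `ghost₀` is diagonal with entries `1, 1, 0`. With a diagonal Noether polarisation the indices
`μ, α, β` therefore coincide and take only the values `0` and `1`. -/
theorem bracket_of_diagonal {G : I3 → ℝ} {k n : Fin 3 → ℝ}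
    (hn : ∀ μ ν, noether (N := 1) (fun _ => G) k 0 (sort2 μ ν) = if μ = ν then n μ else 0)
    (c' : I2 → ℝ) : bracket G ghost₀ k c' =
      n 0 * (1 / 2 * (c' (sort2 2 0) * k 1 - c' (sort2 1 0) * k 2)) * 2
      + n 1 * (1 / 2 * (c' (sort2 0 1) * k 2 - c' (sort2 2 1) * k 0)) * 2 := by
  simp only [bracket, hn, ghost₀_sort2]
  simp [Fin.sum_univ_three, ε]
  ring

/-- The component `(1,2,2)` at momentum `e_0` is reached by `transf_decomp` from three pure gauge
waves, on which any lift is governed by `a₂`. -/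
theorem transf_112_122 {f : Fin N → Fin N → Fin N → ℝ} {a1 : Loc N} {b : Fin 3 → Loc N}
    (hlift : γ N a1 + δ N (a₂ f) + totalDiv b = 0) (x y z : Fin N) :
    transf (ofC _ (single_trace ghost₀_trace y)) a1
      (eom (Pi.single x (comp3 (1, 1, 2))) (Pi.single 0 1)) (Pi.single 0 1)
      (Pi.single z (comp3 (1, 2, 2))) = 9 / 2 * f x y z := by
  have hc : ∑ μ, η μ * comp2 (1, 2) (sort2 μ μ) = 0 := comp2_trace (by decide)
  have hc' : ∑ μ, η μ * (comp2 (1, 2) + comp2 (0, 1)) (sort2 μ μ) = 0 :=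
    comp2_add_trace (by decide) (by decide)
  -- A ghost in the component `(1,2)` produces `(0,1,2)` from the momentum `e_0` and `2 · (1,2,2)`
  -- from `e_2`.
  have h1 : vee (Pi.single z (comp2 (1, 2))) (Pi.single 0 1 + Pi.single 2 1) =
      vee (Pi.single z (comp2 (1, 2))) (Pi.single 0 1)
        + (2 : ℝ) • (Pi.single z (comp3 (1, 2, 2)) : Fin N → I3 → ℝ) := by
    funext a ⟨⟨μ, ν, ρ⟩, h⟩
    by_cases ha : a = z
    · subst ha
      fin_cases μ <;> fin_cases ν <;> fin_cases ρ <;> revert h <;>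
        simp +decide [vee, comp2, comp3, sort2]
      norm_num
    · simp [vee, Pi.single_eq_of_ne ha]
  -- The same field is also pure gauge at momentum `e_2` alone: the component `(0,1)` of another
  -- ghost supplies `(0,1,2)`.
  have h2 : vee (Pi.single z (comp2 (1, 2))) (Pi.single 0 1 + Pi.single 2 1) =
      vee (Pi.single z (comp2 (1, 2) + comp2 (0, 1))) (Pi.single 2 1) := by
    funext a ⟨⟨μ, ν, ρ⟩, h⟩
    by_cases ha : a = z
    · subst ha
      fin_cases μ <;> fin_cases ν <;> fin_cases ρ <;> revert h <;>
        simp +decide [vee, comp2, sort2]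
    · simp [vee, Pi.single_eq_of_ne ha]
  have hn : ∀ (k : Fin 3 → ℝ) (μ ν : Fin 3),
      noether (N := 1) (fun _ => (3 : ℝ) • comp3 (2, 2, 2)) k 0 (sort2 μ ν) =
        if μ = ν then k 2 * (if μ = 2 then -6 else 3 * η μ) else 0 := fun k μ ν => by
    rw [noether_222, mul_ite, mul_zero]
  rw [transf_decomp _ _ _ _ _ _ 2 (by decide) h1]
  conv_lhs => enter [2, 2]; rw [h2]
  rw [eom_single, eom_112, transf_single hlift x y z _ ghost₀_trace hc,
    transf_single hlift x y z _ ghost₀_trace hc, transf_single hlift x y z _ ghost₀_trace hc',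
    bracket_of_diagonal (hn _), bracket_of_diagonal (hn _), bracket_of_diagonal (hn _)]
  simp +decide [comp2, sort2, η]
  ring

/-- The mirror image under the exchange of the spatial directions `1` and `2`. The Levi-Civita
density is odd under this reflection, which is the origin of the opposite sign and hence of the
obstruction. -/
theorem transf_122_112 {f : Fin N → Fin N → Fin N → ℝ} {a1 : Loc N} {b : Fin 3 → Loc N}
    (hlift : γ N a1 + δ N (a₂ f) + totalDiv b = 0) (x y z : Fin N) :
    transf (ofC _ (single_trace ghost₀_trace y)) a1
      (eom (Pi.single x (comp3 (1, 2, 2))) (Pi.single 0 1)) (Pi.single 0 1)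
      (Pi.single z (comp3 (1, 1, 2))) = -(9 / 2 * f x y z) := by
  have hc : ∑ μ, η μ * comp2 (1, 2) (sort2 μ μ) = 0 := comp2_trace (by decide)
  have hc' : ∑ μ, η μ * (comp2 (1, 2) + comp2 (0, 2)) (sort2 μ μ) = 0 :=
    comp2_add_trace (by decide) (by decide)
  have h1 : vee (Pi.single z (comp2 (1, 2))) (Pi.single 0 1 + Pi.single 1 1) =
      vee (Pi.single z (comp2 (1, 2))) (Pi.single 0 1)
        + (2 : ℝ) • (Pi.single z (comp3 (1, 1, 2)) : Fin N → I3 → ℝ) := by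
    funext a ⟨⟨μ, ν, ρ⟩, h⟩
    by_cases ha : a = z
    · subst ha
      fin_cases μ <;> fin_cases ν <;> fin_cases ρ <;> revert h <;>
        simp +decide [vee, comp2, comp3, sort2]
      norm_num
    · simp [vee, Pi.single_eq_of_ne ha]
  have h2 : vee (Pi.single z (comp2 (1, 2))) (Pi.single 0 1 + Pi.single 1 1) =
      vee (Pi.single z (comp2 (1, 2) + comp2 (0, 2))) (Pi.single 1 1) := by
    funext a ⟨⟨μ, ν, ρ⟩, h⟩
    by_cases ha : a = z
    · subst ha
      fin_cases μ <;> fin_cases ν <;> fin_cases ρ <;> revert h <;>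
        simp +decide [vee, comp2, sort2]
    · simp [vee, Pi.single_eq_of_ne ha]
  have hn : ∀ (k : Fin 3 → ℝ) (μ ν : Fin 3),
      noether (N := 1) (fun _ => (3 : ℝ) • comp3 (1, 1, 1)) k 0 (sort2 μ ν) =
        if μ = ν then k 1 * (if μ = 1 then -6 else 3 * η μ) else 0 := fun k μ ν => by
    rw [noether_111, mul_ite, mul_zero]
  rw [transf_decomp _ _ _ _ _ _ 1 (by decide) h1]
  conv_lhs => enter [2, 2]; rw [h2]
  rw [eom_single, eom_122, transf_single hlift x y z _ ghost₀_trace hc,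
    transf_single hlift x y z _ ghost₀_trace hc, transf_single hlift x y z _ ghost₀_trace hc',
    bracket_of_diagonal (hn _), bracket_of_diagonal (hn _), bracket_of_diagonal (hn _)]
  simp +decide [comp2, sort2, η]
  ring

end Pol

/-- If `a₂` and one of its lifts lift, then the structure constants are totally antisymmetric. -/
theorem totallyAntisymmetric_of_lift {f : Fin N → Fin N → Fin N → ℝ}
    (hf : ∀ a b c, f a b c = -f a c b) {a1 a0 : Loc N} (h1 : IsLift₁ a1 (a₂ f))
    (h0 : IsLift₀ a0 a1) : TotallyAntisymmetric f := by
  obtain ⟨-, b₁, hb₁⟩ := h1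
  obtain ⟨-, b₀, hb₀⟩ := h0
  -- The polarisations `(1,1,2)` and `(1,2,2)` are exchanged by `transf_eom`, and their two values
  -- have opposite signs.
  have key : ∀ a b c, f a b c = -f c b a := by
    intro a b c
    have := Pol.transf_eom hb₀ _ (Pol.single_trace Pol.ghost₀_trace b)
      (Pi.single a (Pol.comp3 (1, 1, 2))) (Pi.single c (Pol.comp3 (1, 2, 2))) (Pi.single 0 1)
    rw [Pol.transf_112_122 hb₁, Pol.transf_122_112 hb₁] at this
    linarith
  intro a b c
  refine ⟨?_, hf a b c⟩
  rw [key a b c, hf c b a, neg_neg, key c a b]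


/-! ### Umbral calculus -/

/-- Polynomials in a tensor slot `u` (`false`) and its momentum `k` (`true`). -/
abbrev SlotPoly : Type := MvPolynomial (Bool × Fin 3) ℝ

/-- Polynomials in three slots and their momenta. -/
abbrev TriPoly : Type := MvPolynomial (Fin 3 × Bool × Fin 3) ℝ

/-- Jets of a symmetric tensor, indexed by tensor indices and derivative indices. -/
abbrev Slot (N : ℕ) : Type := Multiset (Fin 3) → Multiset (Fin 3) → Loc N

/-- The multiset with multiplicities `g`. -/
def ofCount (g : Fin 3 → ℕ) : Multiset (Fin 3) := ∑ i, g i • {i}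

theorem count_ofCount (g : Fin 3 → ℕ) (i : Fin 3) : (ofCount g).count i = g i := by
  simp only [ofCount, Multiset.count_sum', Multiset.count_nsmul, Multiset.count_singleton]
  simp

theorem ofCount_eq {g : Fin 3 → ℕ} {s : Multiset (Fin 3)} (h : ∀ i, g i = s.count i) :
    ofCount g = s := Multiset.ext.2 fun i => by rw [count_ofCount, h]

/-- Replace monomials in `u` and `k` by jets. -/
def psi (X : Slot N) : SlotPoly →ₗ[ℝ] Loc N :=
  (MvPolynomial.basisMonomials (Bool × Fin 3) ℝ).constr ℝ fun m =>
    X (ofCount fun i => m (false, i)) (ofCount fun i => m (true, i))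

/-- Replace monomials in three slots by products of jets. -/
def umb (X Y Z : Slot N) : TriPoly →ₗ[ℝ] Loc N :=
  (MvPolynomial.basisMonomials (Fin 3 × Bool × Fin 3) ℝ).constr ℝ fun m =>
    X (ofCount fun i => m (0, false, i)) (ofCount fun i => m (0, true, i)) *
    Y (ofCount fun i => m (1, false, i)) (ofCount fun i => m (1, true, i)) *
    Z (ofCount fun i => m (2, false, i)) (ofCount fun i => m (2, true, i))

theorem psi_monomial (X : Slot N) (m : Bool × Fin 3 →₀ ℕ) :
    psi X (MvPolynomial.monomial m 1) =
      X (ofCount fun i => m (false, i)) (ofCount fun i => m (true, i)) := by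
  have := (MvPolynomial.basisMonomials (Bool × Fin 3) ℝ).constr_basis ℝ (fun m =>
    X (ofCount fun i => m (false, i)) (ofCount fun i => m (true, i))) m
  rwa [MvPolynomial.coe_basisMonomials] at this

theorem umb_monomial (X Y Z : Slot N) (m : Fin 3 × Bool × Fin 3 →₀ ℕ) :
    umb X Y Z (MvPolynomial.monomial m 1) =
      X (ofCount fun i => m (0, false, i)) (ofCount fun i => m (0, true, i)) *
      Y (ofCount fun i => m (1, false, i)) (ofCount fun i => m (1, true, i)) *
      Z (ofCount fun i => m (2, false, i)) (ofCount fun i => m (2, true, i)) := by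
  have := (MvPolynomial.basisMonomials (Fin 3 × Bool × Fin 3) ℝ).constr_basis ℝ (fun m =>
    X (ofCount fun i => m (0, false, i)) (ofCount fun i => m (0, true, i)) *
      Y (ofCount fun i => m (1, false, i)) (ofCount fun i => m (1, true, i)) *
      Z (ofCount fun i => m (2, false, i)) (ofCount fun i => m (2, true, i))) m
  rwa [MvPolynomial.coe_basisMonomials] at this

/-- The inclusion of the polynomials in the slot `s`. -/
def inSlot (s : Fin 3) : SlotPoly →ₐ[ℝ] TriPoly := MvPolynomial.rename (Prod.mk s)

/-- Linear maps out of polynomials agree if they agree on monomials. -/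
theorem poly_linear_ext {σ M : Type} [AddCommGroup M] [Module ℝ M]
    {φ ψ : MvPolynomial σ ℝ →ₗ[ℝ] M}
    (h : ∀ m, φ (MvPolynomial.monomial m 1) = ψ (MvPolynomial.monomial m 1))
    (p : MvPolynomial σ ℝ) : φ p = ψ p := by
  have : φ = ψ := (MvPolynomial.basisMonomials σ ℝ).ext fun m => by
    simpa [MvPolynomial.coe_basisMonomials] using h m
  rw [this]

theorem mapDomain_slot (s t : Fin 3) (m : Bool × Fin 3 →₀ ℕ) (b : Bool) (i : Fin 3) :
    Finsupp.mapDomain (Prod.mk s) m (t, b, i) = if s = t then m (b, i) else 0 := by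
  split_ifs with h
  · subst h
    exact Finsupp.mapDomain_apply (Prod.mk_right_injective s) m (b, i)
  · refine Finsupp.mapDomain_of_notMem_range m _ ?_
    rintro ⟨x, hx⟩
    exact h (congrArg Prod.fst hx)

/-- Exponents in different slots do not interact, so `umb` factorizes. By linearity monomials
suffice, one slot at a time. Read from right to left, it converts products of jets into one
polynomial. -/
theorem umb_inSlot (X Y Z : Slot N) (p q r : SlotPoly) :
    umb X Y Z (inSlot 0 p * inSlot 1 q * inSlot 2 r) = psi X p * psi Y q * psi Z r := by
  have h1 : ∀ m n, ∀ r, umb X Y Z (inSlot 0 (MvPolynomial.monomial m 1) *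
      inSlot 1 (MvPolynomial.monomial n 1) * inSlot 2 r) =
      psi X (MvPolynomial.monomial m 1) * psi Y (MvPolynomial.monomial n 1) * psi Z r := by
    intro m n
    refine poly_linear_ext (φ := umb X Y Z ∘ₗ LinearMap.mulLeft ℝ _ ∘ₗ (inSlot 2).toLinearMap)
      (ψ := LinearMap.mulLeft ℝ _ ∘ₗ psi Z) fun l => ?_
    simp only [LinearMap.comp_apply, LinearMap.mulLeft_apply, AlgHom.toLinearMap_apply, inSlot,
      MvPolynomial.rename_monomial, MvPolynomial.monomial_mul, mul_one, umb_monomial,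
      psi_monomial, Finsupp.add_apply, mapDomain_slot]
    simp
  have h2 : ∀ m r, ∀ q, umb X Y Z (inSlot 0 (MvPolynomial.monomial m 1) *
      inSlot 1 q * inSlot 2 r) = psi X (MvPolynomial.monomial m 1) * psi Y q * psi Z r := by
    intro m r
    exact poly_linear_ext (φ := umb X Y Z ∘ₗ LinearMap.mulRight ℝ _ ∘ₗ LinearMap.mulLeft ℝ _ ∘ₗ
      (inSlot 1).toLinearMap)
      (ψ := LinearMap.mulRight ℝ _ ∘ₗ LinearMap.mulLeft ℝ _ ∘ₗ psi Y) fun n => h1 m n r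
  exact poly_linear_ext (φ := umb X Y Z ∘ₗ LinearMap.mulRight ℝ _ ∘ₗ LinearMap.mulRight ℝ _ ∘ₗ
      (inSlot 0).toLinearMap)
      (ψ := LinearMap.mulRight ℝ _ ∘ₗ LinearMap.mulRight ℝ _ ∘ₗ psi X) (fun m => h2 m r q) p

/-- The tensor variable of the slot `s`. -/
def tv (s : Fin 3) (i : Fin 3) : TriPoly := MvPolynomial.X (s, false, i)

/-- The momentum variable of the slot `s`. -/
def mv (s : Fin 3) (i : Fin 3) : TriPoly := MvPolynomial.X (s, true, i)

/-- The tensor variable. -/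
def su (i : Fin 3) : SlotPoly := MvPolynomial.X (false, i)

/-- The momentum variable. -/
def sk (i : Fin 3) : SlotPoly := MvPolynomial.X (true, i)

@[simp] theorem inSlot_su (s i : Fin 3) : inSlot s (su i) = tv s i := by
  simp [inSlot, su, tv]

@[simp] theorem inSlot_sk (s i : Fin 3) : inSlot s (sk i) = mv s i := by
  simp [inSlot, sk, mv]

/-- The value of a slot on a product of tensor and momentum variables. -/
theorem psi_prod (X : Slot N) (s α : Multiset (Fin 3)) :
    psi X ((s.map su).prod * (α.map sk).prod) = X s α := by
  have h1 : ∀ (b : Bool) (s : Multiset (Fin 3)),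
      (s.map fun i => (MvPolynomial.X (b, i) : SlotPoly)).prod = MvPolynomial.monomial
        ((s.map fun i => Finsupp.single (b, i) 1).sum) 1 := by
    intro b s
    induction s using Multiset.induction_on with
    | empty => simp
    | cons i s ih =>
      rw [Multiset.map_cons, Multiset.prod_cons, ih, MvPolynomial.X, MvPolynomial.monomial_mul,
        one_mul, Multiset.map_cons, Multiset.sum_cons]
  have h2 : ∀ (b c : Bool) (i : Fin 3) (s : Multiset (Fin 3)),
      (s.map fun i => Finsupp.single (b, i) 1).sum (c, i) =
        if b = c then s.count i else 0 := by
    intro b c i s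
    induction s using Multiset.induction_on with
    | empty => simp
    | cons j s ih =>
      rw [Multiset.map_cons, Multiset.sum_cons, Finsupp.add_apply, ih, Multiset.count_cons,
        Finsupp.single_apply]
      by_cases h : b = c <;> by_cases h' : j = i <;> simp [h, h', eq_comm, add_comm]
  rw [show su = fun i => MvPolynomial.X (false, i) from rfl,
    show sk = fun i => MvPolynomial.X (true, i) from rfl, h1, h1, MvPolynomial.monomial_mul,
    one_mul, psi_monomial]
  congr 1
  · exact ofCount_eq fun i => by simp [h2]
  · exact ofCount_eq fun i => by simp [h2]

/-! ### The slots of the fields, ghosts and antifields -/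

/-- The increasing list of the elements of a multiset. -/
def sortedList (s : Multiset (Fin 3)) : List (Fin 3) :=
  List.replicate (s.count 0) 0 ++ List.replicate (s.count 1) 1 ++ List.replicate (s.count 2) 2

theorem length_sortedList (s : Multiset (Fin 3)) : (sortedList s).length = s.card := by
  induction s using Multiset.induction_on with
  | empty => simp [sortedList]
  | cons i s ih =>
    rw [Multiset.card_cons, ← ih]
    fin_cases i <;> simp [sortedList] <;> omega

/-- A function of three indices, as a slot. -/
def slot3 (F : Fin 3 → Fin 3 → Fin 3 → Multiset (Fin 3) → Loc N) : Slot N := fun s α =>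
  match sortedList s with
  | [x, y, z] => F x y z α
  | _ => 0

/-- A function of two indices, as a slot. -/
def slot2 (F : Fin 3 → Fin 3 → Multiset (Fin 3) → Loc N) : Slot N := fun s α =>
  match sortedList s with
  | [x, y] => F x y α
  | _ => 0

/-- The field slot. -/
def hU (a : Fin N) : Slot N := slot3 (h a)

/-- The antifield slot. -/
def hsU (a : Fin N) : Slot N := slot3 (hs a)

/-- The ghost slot. -/
def CU (a : Fin N) : Slot N := slot2 (C a)

theorem sortedList_triple : ∀ x y z : Fin 3, ∃ x' y' z', sortedList {x, y, z} = [x', y', z'] ∧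
    sort3 x' y' z' = sort3 x y z := by decide

theorem sortedList_pair : ∀ x y : Fin 3, ∃ x' y', sortedList {x, y} = [x', y'] ∧
    sort2 x' y' = sort2 x y := by decide

theorem hU_triple (a : Fin N) (x y z : Fin 3) (α : Multiset (Fin 3)) :
    hU a {x, y, z} α = h a x y z α := by
  obtain ⟨x', y', z', h1, h2⟩ := sortedList_triple x y z
  simp only [hU, slot3, h1, h, h2]

theorem hsU_triple (a : Fin N) (x y z : Fin 3) (α : Multiset (Fin 3)) :
    hsU a {x, y, z} α = hs a x y z α := by
  obtain ⟨x', y', z', h1, h2⟩ := sortedList_triple x y z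
  simp only [hsU, slot3, h1, hs, h2]

theorem CU_pair (a : Fin N) (x y : Fin 3) (α : Multiset (Fin 3)) :
    CU a {x, y} α = C a x y α := by
  obtain ⟨x', y', h1, h2⟩ := sortedList_pair x y
  simp only [CU, slot2, h1, C, h2]

theorem slot3_of_card {F : Fin 3 → Fin 3 → Fin 3 → Multiset (Fin 3) → Loc N}
    {s : Multiset (Fin 3)} (hs : s.card ≠ 3) (α : Multiset (Fin 3)) : slot3 F s α = 0 := by
  rw [← length_sortedList] at hs
  unfold slot3
  split
  · rename_i h; simp [h] at hs
  · rfl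

theorem slot2_of_card {F : Fin 3 → Fin 3 → Multiset (Fin 3) → Loc N}
    {s : Multiset (Fin 3)} (hs : s.card ≠ 2) (α : Multiset (Fin 3)) : slot2 F s α = 0 := by
  rw [← length_sortedList] at hs
  unfold slot2
  split
  · rename_i h; simp [h] at hs
  · rfl

/-- A property of jets which holds for the components of a tensor and for zero holds for its
slot. -/
theorem slot3_induction {F : Fin 3 → Fin 3 → Fin 3 → Multiset (Fin 3) → Loc N}
    {p : Loc N → Prop} (zero : p 0) (h : ∀ x y z α, p (F x y z α)) (s α) : p (slot3 F s α) := by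
  unfold slot3
  split
  · exact h _ _ _ _
  · exact zero

theorem slot2_induction {F : Fin 3 → Fin 3 → Multiset (Fin 3) → Loc N}
    {p : Loc N → Prop} (zero : p 0) (h : ∀ x y α, p (F x y α)) (s α) : p (slot2 F s α) := by
  unfold slot2
  split
  · exact h _ _ _
  · exact zero

/-- Total derivatives shift the momenta of a slot. -/
def Slot.Shift (X : Slot N) : Prop := ∀ μ s α, totalDeriv N μ (X s α) = X s (μ ::ₘ α)

theorem hU_shift (a : Fin N) : (hU a).Shift := by
  intro μ s α
  unfold hU slot3
  split <;> simp [h, totalDeriv_coord, shiftField]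

theorem hsU_shift (a : Fin N) : (hsU a).Shift := by
  intro μ s α
  unfold hsU slot3
  split <;> simp [hs, totalDeriv_gen, shiftGen]

theorem CU_shift (a : Fin N) : (CU a).Shift := by
  intro μ s α
  unfold CU slot2
  split <;> simp [C, totalDeriv_gen, shiftGen]

/-- `γ` maps the slot `X` to the symmetrized derivative of the slot `X'`. -/
def Slot.Gamma (X X' : Slot N) : Prop := ∀ s α, γ N (X s α) =
  ∑ i, (s.count i : ℝ) • X' (s.erase i) (i ::ₘ α)

theorem hsU_gamma (a : Fin N) : (hsU a).Gamma 0 := by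
  intro s α
  unfold hsU slot3
  split <;> simp [hs]

theorem CU_gamma (a : Fin N) : (CU a).Gamma 0 := by
  intro s α
  unfold CU slot2
  split <;> simp [C]

/-- `gammaField` is given on increasing triples only; the sum over the three ways of singling out an
index does not depend on their order. -/
theorem gamma_h (a : Fin N) (x y z : Fin 3) (α : Multiset (Fin 3)) :
    γ N (h a x y z α) = C a y z (x ::ₘ α) + C a x z (y ::ₘ α) + C a x y (z ::ₘ α) := by
  have h1 : ∀ x y z : Fin 3, ∀ g : Fin 3 → I2 → Loc N,
      (match sort3 x y z with
      | ⟨(μ, ν, ρ), _⟩ => g μ (sort2 ν ρ) + g ν (sort2 μ ρ) + g ρ (sort2 μ ν)) =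
      g x (sort2 y z) + g y (sort2 x z) + g z (sort2 x y) := by
    intro x y z g
    fin_cases x <;> fin_cases y <;> fin_cases z <;> simp +decide [sort3, sort2] <;> abel
  rw [h, gamma_coord]
  exact h1 x y z fun i s => gen (.C a s (i ::ₘ α))

/-- The multiplicity of `i` is the exponent produced by differentiating a monomial in `u`, so this
form makes `γ` a derivation of polynomials. -/
theorem hU_gamma (a : Fin N) : (hU a).Gamma (CU a) := by
  intro s α
  by_cases hc : s.card = 3
  · obtain ⟨x, y, z, rfl⟩ := Multiset.card_eq_three.1 hc
    rw [hU_triple, gamma_h]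
    have e : ∀ x y z i : Fin 3, (({x, y, z} : Multiset (Fin 3)).count i : ℝ) •
        CU a (({x, y, z} : Multiset (Fin 3)).erase i) (i ::ₘ α) =
        (if x = i then CU a {y, z} (i ::ₘ α) else 0) +
        (if y = i then CU a {x, z} (i ::ₘ α) else 0) +
        (if z = i then CU a {x, y} (i ::ₘ α) else 0) := by
      intro x y z i
      have e2 : ∀ x y z : Fin 3, ({x, y, z} : Multiset (Fin 3)) = {y, x, z} := by decide
      have e3 : ∀ x y z : Fin 3, ({x, y, z} : Multiset (Fin 3)) = {z, x, y} := by decide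
      have c : (({x, y, z} : Multiset (Fin 3)).count i : ℝ) =
        (if x = i then 1 else 0) + (if y = i then 1 else 0) + (if z = i then 1 else 0) := by
        simp only [Multiset.insert_eq_cons, Multiset.count_cons, Multiset.count_singleton]
        push_cast
        simp only [eq_comm (a := i)]
        ring
      rw [c, add_smul, add_smul]
      congr 1
      · congr 1
        · split_ifs with h
          · subst h; rw [one_smul]; congr 1; simp
          · simp
        · split_ifs with h
          · subst h; rw [one_smul, e2]; congr 1; simp
          · simp
      · split_ifs with h
        · subst h; rw [one_smul, e3]; congr 1; simp
        · simp
    simp only [e, Finset.sum_add_distrib, Finset.sum_ite_eq, Finset.mem_univ, if_true, CU_pair]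
  -- Away from degree three the field slot is zero; an erased index leaves a degree different from
  -- two, where the ghost slot is zero as well.
  · rw [hU, slot3_of_card hc, map_zero]
    symm
    refine Finset.sum_eq_zero fun i _ => ?_
    by_cases hi : i ∈ s
    · rw [CU, slot2_of_card, smul_zero]
      have := Multiset.card_erase_add_one hi
      omega
    · simp [Multiset.count_eq_zero.2 hi]

/-- The slot is traceless. -/
def Slot.Traceless (X : Slot N) : Prop := ∀ s α, ∑ i, η i • X (i ::ₘ i ::ₘ s) α = 0

theorem CU_traceless (a : Fin N) : (CU a).Traceless := by
  intro s α
  by_cases hs : s = 0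
  · subst hs
    have : ∀ i, CU a (i ::ₘ i ::ₘ 0) α = gen (.C a (sort2 i i) α) := fun i => CU_pair a i i α
    simp only [this]
    exact gen_compatible.traceC a α
  · refine Finset.sum_eq_zero fun i _ => ?_
    rw [CU, slot2_of_card, smul_zero]
    have := Multiset.card_pos.2 hs
    simp only [Multiset.card_cons]
    omega


/-! ### Derivations and umbral expressions -/

/-- The total momentum. -/
def totalMom (μ : Fin 3) : TriPoly := mv 0 μ + mv 1 μ + mv 2 μ

theorem X_mul_monomial {σ : Type} (x : σ) (m : σ →₀ ℕ) :
    (MvPolynomial.X x * MvPolynomial.monomial m 1 : MvPolynomial σ ℝ) =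
      MvPolynomial.monomial (Finsupp.single x 1 + m) 1 := by
  rw [MvPolynomial.X, MvPolynomial.monomial_mul, one_mul]

theorem ofCount_single_add (x : Fin 3 × Bool × Fin 3) (m : Fin 3 × Bool × Fin 3 →₀ ℕ)
    (s : Fin 3) (b : Bool) :
    (ofCount fun i => (Finsupp.single x 1 + m : Fin 3 × Bool × Fin 3 →₀ ℕ) (s, b, i)) =
      if (x.1, x.2.1) = (s, b) then x.2.2 ::ₘ ofCount fun i => m (s, b, i)
      else ofCount fun i => m (s, b, i) := by
  obtain ⟨t, c, j⟩ := x
  refine ofCount_eq fun i => ?_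
  by_cases h1 : t = s <;> by_cases h2 : c = b <;> by_cases h3 : j = i <;>
    simp [Finsupp.single_apply, Multiset.count_cons, count_ofCount, h1, h2, h3,
      add_comm, eq_comm (a := i) (b := j)]

/-- Each of the three Leibniz terms adds a derivative index to one slot, that is, multiplies by the
momentum of that slot. -/
theorem totalDeriv_umb {X Y Z : Slot N} (hX : X.Shift) (hY : Y.Shift) (hZ : Z.Shift)
    (eX : ∀ μ s α, LeibAt (totalDeriv N μ) 1 (X s α))
    (eY : ∀ μ s α, LeibAt (totalDeriv N μ) 1 (Y s α)) (μ : Fin 3) (p : TriPoly) :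
    totalDeriv N μ (umb X Y Z p) = umb X Y Z (totalMom μ * p) := by
  refine poly_linear_ext (φ := totalDeriv N μ ∘ₗ umb X Y Z)
    (ψ := umb X Y Z ∘ₗ LinearMap.mulLeft ℝ (totalMom μ)) (fun m => ?_) p
  simp only [LinearMap.comp_apply, LinearMap.mulLeft_apply, totalMom, add_mul, map_add, mv,
    X_mul_monomial, umb_monomial, ofCount_single_add]
  simp +decide only [if_true, if_false]
  rw [mul_assoc, eX, eY, hX, hY, hZ]
  simp only [one_smul, mul_add, mul_assoc, add_assoc]

/-- The derivation replacing a tensor variable of the slot `s` by its momentum. -/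
def grad (s : Fin 3) : Derivation ℝ TriPoly TriPoly :=
  MvPolynomial.mkDerivation ℝ fun x => if x.1 = s ∧ x.2.1 = false then mv s x.2.2 else 0

@[simp] theorem grad_tv_self (s i : Fin 3) : grad s (tv s i) = mv s i := by
  simp [grad, tv]

theorem grad_tv_of_ne {s t : Fin 3} (h : t ≠ s) (i : Fin 3) : grad s (tv t i) = 0 := by
  simp [grad, tv, h]

@[simp] theorem grad_mv (s t i : Fin 3) : grad s (mv t i) = 0 := by
  simp [grad, mv]

theorem grad_monomial (s : Fin 3) (m : Fin 3 × Bool × Fin 3 →₀ ℕ) :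
    grad s (MvPolynomial.monomial m 1) = ∑ i, (m (s, false, i) : ℝ) •
      (mv s i * MvPolynomial.monomial (m - Finsupp.single (s, false, i) 1) 1) := by
  have hsup : ∀ g : Fin 3 × Bool × Fin 3 → ℕ → TriPoly, (∀ x, g x 0 = 0) →
      m.sum g = ∑ x, g x (m x) := fun g hg => Finsupp.sum_fintype m g hg
  rw [grad, MvPolynomial.mkDerivation_monomial, one_smul, hsup _ (by simp),
    Fintype.sum_prod_type, Finset.sum_eq_single s, Fintype.sum_prod_type, Fintype.sum_bool]
  · simp only [Bool.true_eq_false, and_false, if_false, smul_zero, Finset.sum_const_zero,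
      zero_add, and_self, if_true]
    refine Finset.sum_congr rfl fun i _ => ?_
    rw [smul_eq_mul, mul_comm, ← mul_smul_comm, MvPolynomial.smul_monomial, smul_eq_mul, mul_one]
  · intro t _ ht
    simp [ht]
  · simp

theorem ofCount_erase {g g' : Fin 3 → ℕ} {i : Fin 3} (h : ∀ j, g' j = g j - if i = j then 1 else 0) :
    ofCount g' = (ofCount g).erase i := by
  refine ofCount_eq fun j => ?_
  rw [h]
  by_cases hij : i = j
  · subst hij; simp [count_ofCount]
  · rw [Multiset.count_erase_of_ne (Ne.symm hij), count_ofCount]; simp [hij]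

theorem ofCount_sub (s t : Fin 3) (i : Fin 3) (m : Fin 3 × Bool × Fin 3 →₀ ℕ) :
    (ofCount fun j => (m - Finsupp.single (s, false, i) 1 : Fin 3 × Bool × Fin 3 →₀ ℕ) (t, false, j)) =
      if s = t then (ofCount fun j => m (t, false, j)).erase i
      else ofCount fun j => m (t, false, j) := by
  split_ifs with h
  · subst h
    refine ofCount_erase fun j => ?_
    simp [Finsupp.single_apply]
  · congr 1; funext j; simp [h]

theorem ofCount_sub_true (s t : Fin 3) (i : Fin 3) (m : Fin 3 × Bool × Fin 3 →₀ ℕ) :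
    (ofCount fun j => (m - Finsupp.single (s, false, i) 1 : Fin 3 × Bool × Fin 3 →₀ ℕ) (t, true, j)) =
      ofCount fun j => m (t, true, j) := by
  congr 1; funext j; simp

/-- The signs `e` and `e * e'` arise from moving `γ` past the first slot and past the first two; on
each slot `γ` acts as `grad`. -/
theorem gamma_umb {X Y Z X' Y' Z' : Slot N} (hX : X.Gamma X') (hY : Y.Gamma Y')
    (hZ : Z.Gamma Z') {e e' : ℝ} (eX : ∀ s α, LeibAt (γ N) e (X s α))
    (eY : ∀ s α, LeibAt (γ N) e' (Y s α)) (p : TriPoly) :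
    γ N (umb X Y Z p) = umb X' Y Z (grad 0 p) + e • umb X Y' Z (grad 1 p)
      + (e * e') • umb X Y Z' (grad 2 p) := by
  refine poly_linear_ext (φ := γ N ∘ₗ umb X Y Z)
    (ψ := umb X' Y Z ∘ₗ (grad 0).toLinearMap + e • (umb X Y' Z ∘ₗ (grad 1).toLinearMap)
      + (e * e') • (umb X Y Z' ∘ₗ (grad 2).toLinearMap)) (fun m => ?_) p
  simp only [LinearMap.comp_apply, LinearMap.add_apply, LinearMap.smul_apply,
    Derivation.coeFn_coe, grad_monomial, map_sum, map_smul, mv,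
    X_mul_monomial, umb_monomial, ofCount_single_add, ofCount_sub, ofCount_sub_true]
  simp +decide only [if_true, if_false]
  rw [mul_assoc, eX, eY, hX, hY, hZ]
  simp only [Finset.sum_mul, Finset.mul_sum, mul_add, smul_mul_assoc, mul_smul_comm, mul_assoc,
    count_ofCount, smul_add, smul_smul, add_assoc]

/-- The contraction of two vectors with the metric. -/
def dot {A : Type} [CommRing A] (x y : Fin 3 → A) : A := -(x 0 * y 0) + x 1 * y 1 + x 2 * y 2

/-- The contraction of three vectors with the Levi-Civita density. -/
def det {A : Type} [CommRing A] (x y z : Fin 3 → A) : A :=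
  x 0 * y 1 * z 2 - x 0 * y 2 * z 1 - x 1 * y 0 * z 2 + x 1 * y 2 * z 0 + x 2 * y 0 * z 1
    - x 2 * y 1 * z 0

/-- Multiplication by `u · u` inserts a contracted pair of tensor indices in the slot, which a
traceless slot annihilates. -/
theorem umb_traceless_right {X Y Z : Slot N} (hZ : Z.Traceless) (p : TriPoly) :
    umb X Y Z (dot (tv 2) (tv 2) * p) = 0 := by
  refine poly_linear_ext (φ := umb X Y Z ∘ₗ LinearMap.mulLeft ℝ (dot (tv 2) (tv 2)))
    (ψ := 0) (fun m => ?_) p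
  have := hZ (ofCount fun i => m (2, false, i)) (ofCount fun i => m (2, true, i))
  rw [Fin.sum_univ_three] at this
  simp only [LinearMap.comp_apply, LinearMap.mulLeft_apply, dot, tv, add_mul, neg_mul, mul_assoc,
    X_mul_monomial, umb_monomial, ofCount_single_add, map_add, map_neg, LinearMap.zero_apply]
  simp +decide only [if_true, if_false]
  rw [← mul_neg, ← mul_neg, ← mul_add, ← mul_add, ← mul_add, ← mul_add]
  simp only [η] at this
  simp at this
  rw [this, mul_zero, mul_zero]

theorem umb_traceless_middle {X Y Z : Slot N} (hY : Y.Traceless) (p : TriPoly) :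
    umb X Y Z (dot (tv 1) (tv 1) * p) = 0 := by
  refine poly_linear_ext (φ := umb X Y Z ∘ₗ LinearMap.mulLeft ℝ (dot (tv 1) (tv 1)))
    (ψ := 0) (fun m => ?_) p
  have := hY (ofCount fun i => m (1, false, i)) (ofCount fun i => m (1, true, i))
  rw [Fin.sum_univ_three] at this
  simp only [LinearMap.comp_apply, LinearMap.mulLeft_apply, dot, tv, add_mul, neg_mul, mul_assoc,
    X_mul_monomial, umb_monomial, ofCount_single_add, map_add, map_neg, LinearMap.zero_apply]
  simp +decide only [if_true, if_false]
  rw [← mul_neg, ← neg_mul, ← mul_add, ← mul_add, ← add_mul, ← add_mul]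
  simp only [η] at this
  simp at this
  rw [this, zero_mul, mul_zero]

/-- Rename the slots. -/
def permSlots (σ : Equiv.Perm (Fin 3)) : TriPoly →ₐ[ℝ] TriPoly :=
  MvPolynomial.rename fun x => (σ x.1, x.2)

@[simp] theorem permSlots_tv (σ : Equiv.Perm (Fin 3)) (s i : Fin 3) :
    permSlots σ (tv s i) = tv (σ s) i := by simp [permSlots, tv]

@[simp] theorem permSlots_mv (σ : Equiv.Perm (Fin 3)) (s i : Fin 3) :
    permSlots σ (mv s i) = mv (σ s) i := by simp [permSlots, mv]

theorem permSlots_monomial (σ : Equiv.Perm (Fin 3)) (m : Fin 3 × Bool × Fin 3 →₀ ℕ) :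
    ∃ m', permSlots σ (MvPolynomial.monomial m 1) = MvPolynomial.monomial m' 1 ∧
      ∀ s b i, m' (σ s, b, i) = m (s, b, i) := by
  refine ⟨_, MvPolynomial.rename_monomial _ _ _, fun s b i => ?_⟩
  refine Finsupp.mapDomain_apply (f := fun x : Fin 3 × Bool × Fin 3 => (σ x.1, x.2)) ?_ m (s, b, i)
  rintro ⟨x, x'⟩ ⟨y, y'⟩ h
  simpa using h

theorem umb_swap_left {X Y : Slot N} {e : ℝ}
    (hXY : ∀ s α t β, X s α * Y t β = e • (Y t β * X s α)) (Z : Slot N) (p : TriPoly) :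
    umb X Y Z p = e • umb Y X Z (permSlots (Equiv.swap 0 1) p) := by
  refine poly_linear_ext (φ := umb X Y Z)
    (ψ := e • (umb Y X Z ∘ₗ (permSlots (Equiv.swap 0 1)).toLinearMap)) (fun m => ?_) p
  obtain ⟨m', h1, h2⟩ := permSlots_monomial (Equiv.swap 0 1) m
  have h20 : ∀ b i, m' (1, b, i) = m (0, b, i) := fun b i => by simpa using h2 0 b i
  have h21 : ∀ b i, m' (0, b, i) = m (1, b, i) := fun b i => by simpa using h2 1 b i
  have h22 : ∀ b i, m' (2, b, i) = m (2, b, i) := fun b i => by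
    have := h2 2 b i
    rwa [Equiv.swap_apply_of_ne_of_ne (by decide) (by decide)] at this
  simp only [LinearMap.smul_apply, LinearMap.comp_apply, AlgHom.toLinearMap_apply, h1,
    umb_monomial, h20, h21, h22]
  rw [hXY, smul_mul_assoc]

theorem umb_swap_right {Y Z : Slot N} {e : ℝ}
    (hYZ : ∀ s α t β, Y s α * Z t β = e • (Z t β * Y s α)) (X : Slot N) (p : TriPoly) :
    umb X Y Z p = e • umb X Z Y (permSlots (Equiv.swap 1 2) p) := by
  refine poly_linear_ext (φ := umb X Y Z)
    (ψ := e • (umb X Z Y ∘ₗ (permSlots (Equiv.swap 1 2)).toLinearMap)) (fun m => ?_) p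
  obtain ⟨m', h1, h2⟩ := permSlots_monomial (Equiv.swap 1 2) m
  have h20 : ∀ b i, m' (2, b, i) = m (1, b, i) := fun b i => by simpa using h2 1 b i
  have h21 : ∀ b i, m' (1, b, i) = m (2, b, i) := fun b i => by simpa using h2 2 b i
  have h22 : ∀ b i, m' (0, b, i) = m (0, b, i) := fun b i => by
    have := h2 0 b i
    rwa [Equiv.swap_apply_of_ne_of_ne (by decide) (by decide)] at this
  simp only [LinearMap.smul_apply, LinearMap.comp_apply, AlgHom.toLinearMap_apply, h1,
    umb_monomial, h20, h21, h22]
  rw [mul_assoc, hYZ, mul_smul_comm, mul_assoc]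

/-! ### Sums over the internal indices -/

/-- The umbral map contracted with the structure constants. -/
def umbSum (f : Fin N → Fin N → Fin N → ℝ) (X Y Z : Fin N → Slot N) : TriPoly →ₗ[ℝ] Loc N :=
  ∑ a, ∑ b, ∑ c, f a b c • umb (X a) (Y b) (Z c)

theorem umbSum_apply (f : Fin N → Fin N → Fin N → ℝ) (X Y Z : Fin N → Slot N) (p : TriPoly) :
    umbSum f X Y Z p = ∑ a, ∑ b, ∑ c, f a b c • umb (X a) (Y b) (Z c) p := by
  simp [umbSum, LinearMap.sum_apply]

/-- The sign is the product of `-1` from the structure constants and `e` from commuting the factors: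
two fields give `-1`, two ghosts would give `+1`. -/
theorem umbSum_swap_left {f : Fin N → Fin N → Fin N → ℝ} (hf : ∀ a b c, f a b c = -f b a c)
    {X Y : Fin N → Slot N} {e : ℝ}
    (hXY : ∀ a b s α t β, X a s α * Y b t β = e • (Y b t β * X a s α)) (Z : Fin N → Slot N)
    (p : TriPoly) :
    umbSum f X Y Z p = (-e) • umbSum f Y X Z (permSlots (Equiv.swap 0 1) p) := by
  simp only [umbSum_apply, umb_swap_left (hXY _ _), Finset.smul_sum]
  rw [Finset.sum_comm]
  refine Finset.sum_congr rfl fun a _ => Finset.sum_congr rfl fun b _ =>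
    Finset.sum_congr rfl fun c _ => ?_
  rw [hf b a c, smul_smul, smul_smul]
  congr 1; ring

theorem umbSum_swap_right {f : Fin N → Fin N → Fin N → ℝ} (hf : ∀ a b c, f a b c = -f a c b)
    {Y Z : Fin N → Slot N} {e : ℝ}
    (hYZ : ∀ a b s α t β, Y a s α * Z b t β = e • (Z b t β * Y a s α)) (X : Fin N → Slot N)
    (p : TriPoly) :
    umbSum f X Y Z p = (-e) • umbSum f X Z Y (permSlots (Equiv.swap 1 2) p) := by
  simp only [umbSum_apply, umb_swap_right (hYZ _ _), Finset.smul_sum]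
  refine Finset.sum_congr rfl fun a _ => ?_
  rw [Finset.sum_comm]
  refine Finset.sum_congr rfl fun b _ => Finset.sum_congr rfl fun c _ => ?_
  rw [hf a c b, smul_smul, smul_smul]
  congr 1; ring

theorem hU_comm (a b : Fin N) (s α t β) : hU a s α * hU b t β = (1 : ℝ) • (hU b t β * hU a s α) := by
  rw [one_smul]
  exact slot3_induction (p := fun z => z * hU b t β = hU b t β * z) (by simp)
    (fun x y z α => (ofField_commute _ _).eq) s α

theorem hU_comm_CU (a b : Fin N) (s α t β) :
    hU a s α * CU b t β = (1 : ℝ) • (CU b t β * hU a s α) := by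
  rw [one_smul]
  exact slot3_induction (p := fun z => z * CU b t β = CU b t β * z) (by simp)
    (fun x y z α => (ofField_commute _ _).eq) s α

theorem CU_comm_hU (a b : Fin N) (s α t β) :
    CU a s α * hU b t β = (1 : ℝ) • (hU b t β * CU a s α) := by
  rw [hU_comm_CU, one_smul, one_smul]

theorem CU_comm (a b : Fin N) (s α t β) :
    CU a s α * CU b t β = (-1 : ℝ) • (CU b t β * CU a s α) := by
  refine slot2_induction (p := fun z => z * CU b t β = (-1 : ℝ) • (CU b t β * z)) (by simp)
    (fun x y α => ?_) s α
  refine slot2_induction (p := fun z => C a x y α * z = (-1 : ℝ) • (z * C a x y α)) (by simp)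
    (fun x' y' β => ?_) t β
  have := gen_compatible.comm (.C a (sort2 x y) α) (.C b (sort2 x' y') β)
  simpa [Gen.parity, C] using this


/-! ### Umbral forms of the jets -/

theorem h_eq_psi (a : Fin N) (x y z : Fin 3) (α : Multiset (Fin 3)) :
    h a x y z α = psi (hU a) (su x * su y * su z * (α.map sk).prod) := by
  rw [← hU_triple, ← psi_prod (hU a)]
  simp [mul_assoc]

theorem hs_eq_psi (a : Fin N) (x y z : Fin 3) (α : Multiset (Fin 3)) :
    hs a x y z α = psi (hsU a) (su x * su y * su z * (α.map sk).prod) := by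
  rw [← hsU_triple, ← psi_prod (hsU a)]
  simp [mul_assoc]

theorem C_eq_psi (a : Fin N) (x y : Fin 3) (α : Multiset (Fin 3)) :
    C a x y α = psi (CU a) (su x * su y * (α.map sk).prod) := by
  rw [← CU_pair, ← psi_prod (CU a)]
  simp

theorem sum_eta_smul {M : Type} [AddCommGroup M] [Module ℝ M] (F : Fin 3 → M) :
    ∑ μ, η μ • F μ = -F 0 + F 1 + F 2 := by
  rw [Fin.sum_univ_three]
  simp [η]

theorem sum_eps_smul {M : Type} [AddCommGroup M] [Module ℝ M] (F : Fin 3 → Fin 3 → Fin 3 → M) :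
    ∑ μ, ∑ ν, ∑ ρ, ε μ ν ρ • F μ ν ρ =
      F 0 1 2 - F 0 2 1 - F 1 0 2 + F 1 2 0 + F 2 0 1 - F 2 1 0 := by
  simp only [Fin.sum_univ_three, ε]
  norm_num
  abel

theorem htr_eq_psi (a : Fin N) (x : Fin 3) (α : Multiset (Fin 3)) :
    htr a x α = psi (hU a) (su x * dot su su * (α.map sk).prod) := by
  simp only [htr, h_eq_psi, ← map_smul, ← map_sum]
  congr 1
  rw [sum_eta_smul, dot]
  ring

theorem hstr_eq_psi (a : Fin N) (x : Fin 3) (α : Multiset (Fin 3)) :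
    hstr a x α = psi (hsU a) (su x * dot su su * (α.map sk).prod) := by
  simp only [hstr, hs_eq_psi, ← map_smul, ← map_sum]
  congr 1
  rw [sum_eta_smul, dot]
  ring

theorem T_eq_psi (a : Fin N) (ν ρ β : Fin 3) :
    T a ν ρ β = psi (CU a) ((1 / 2 : ℝ) • (su ρ * su β * sk ν - su ν * su β * sk ρ)) := by
  simp [T, C_eq_psi]

/-- The symbol of the Fronsdal tensor. -/
def fronsdalPoly {A : Type} [CommRing A] (u k : Fin 3 → A) (x y z : Fin 3) : A :=
  dot k k * (u x * u y * u z)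
    - dot u k * (k x * u y * u z + k y * u x * u z + k z * u x * u y)
    + dot u u * (k x * k y * u z + k x * k z * u y + k y * k z * u x)

/-- The symbol of the trace of the Fronsdal tensor. -/
def fronsdalTrPoly {A : Type} [CommRing A] (u k : Fin 3 → A) (x : Fin 3) : A :=
  (2 * dot k k * dot u u - 2 * dot u k ^ 2) * u x + dot u k * dot u u * k x

theorem Fronsdal_eq_psi (a : Fin N) (x y z : Fin 3) :
    Fronsdal a x y z 0 = psi (hU a) (fronsdalPoly su sk x y z) := by
  simp only [Fronsdal, h_eq_psi, htr_eq_psi, ← map_smul, ← map_sum, ← map_add, ← map_sub]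
  congr 1
  simp only [Multiset.map_cons, Multiset.prod_cons, Multiset.map_zero, Multiset.prod_zero,
    sum_eta_smul, fronsdalPoly, dot]
  ring

theorem Fronsdaltr_eq_psi (a : Fin N) (x : Fin 3) :
    Fronsdaltr a x 0 = psi (hU a) (fronsdalTrPoly su sk x) := by
  simp only [Fronsdaltr, Fronsdal_eq_psi, ← map_smul, ← map_sum]
  congr 1
  simp only [sum_eta_smul, fronsdalPoly, fronsdalTrPoly, dot]
  ring

/-- The symbol of the field equations. -/
def gPoly {A : Type} [CommRing A] [Algebra ℝ A] (u k : Fin 3 → A) (x y z : Fin 3) : A :=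
  fronsdalPoly u k x y z - (1 / 2 : ℝ) • (metric x y • fronsdalTrPoly u k z
    + metric y z • fronsdalTrPoly u k x + metric x z • fronsdalTrPoly u k y)

theorem metric_comm (x y : Fin 3) : metric x y = metric y x := by
  unfold metric
  by_cases h : x = y
  · subst h; rfl
  · rw [if_neg h, if_neg (Ne.symm h)]

theorem gPoly_swap_left {A : Type} [CommRing A] [Algebra ℝ A] (u k : Fin 3 → A) (x y z : Fin 3) :
    gPoly u k x y z = gPoly u k y x z := by
  have h : fronsdalPoly u k x y z = fronsdalPoly u k y x z := by unfold fronsdalPoly; ring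
  unfold gPoly
  rw [h, metric_comm y x]
  congr 2
  abel

theorem gPoly_swap_right {A : Type} [CommRing A] [Algebra ℝ A] (u k : Fin 3 → A) (x y z : Fin 3) :
    gPoly u k x y z = gPoly u k x z y := by
  have h : fronsdalPoly u k x y z = fronsdalPoly u k x z y := by unfold fronsdalPoly; ring
  unfold gPoly
  rw [h, metric_comm z y]
  congr 2
  abel

theorem Gtensor_eq_psi (a : Fin N) (x y z : Fin 3) :
    Gtensor a x y z 0 = psi (hU a) (gPoly su sk x y z) := by
  simp only [Gtensor, Fronsdal_eq_psi, Fronsdaltr_eq_psi, gPoly, ← map_smul, ← map_add, ← map_sub]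

/-- `deltaGen` is defined on increasing indices; the total symmetry of `gPoly` removes the ordering.
-/
theorem delta_hs_zero (a : Fin N) (x y z : Fin 3) :
    δ N (hs a x y z 0) = psi (hU a) ((η x * η y * η z) • gPoly su sk x y z) := by
  have h1 : ∀ x y z : Fin 3, ∀ G : Fin 3 → Fin 3 → Fin 3 → Loc N,
      (∀ x y z, G x y z = G y x z) → (∀ x y z, G x y z = G x z y) →
      (match sort3 x y z with | ⟨(μ, ν, ρ), _⟩ => G μ ν ρ) = G x y z := by
    intro x y z G g1 g2
    have g3 : ∀ x y z, G x y z = G z y x := fun x y z => by rw [g1, g2, g1]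
    have g4 : ∀ x y z, G x y z = G y z x := fun x y z => by rw [g1, g2]
    have g5 : ∀ x y z, G x y z = G z x y := fun x y z => by rw [g2, g1]
    have : ∃ x' y' z' h, sort3 x y z = ⟨(x', y', z'), h⟩ ∧ ((x', y', z') = (x, y, z) ∨
        (x', y', z') = (y, x, z) ∨ (x', y', z') = (x, z, y) ∨ (x', y', z') = (z, y, x) ∨
        (x', y', z') = (y, z, x) ∨ (x', y', z') = (z, x, y)) := by
      revert x y z
      intro x y z
      refine ⟨_, _, _, _, rfl, ?_⟩
      clear g1 g2 g3 g4 g5 G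
      revert x y z
      decide
    obtain ⟨x', y', z', h, e, h'⟩ := this
    rw [e]
    simp only [Prod.mk.injEq] at h'
    rcases h' with ⟨rfl, rfl, rfl⟩ | ⟨rfl, rfl, rfl⟩ | ⟨rfl, rfl, rfl⟩ | ⟨rfl, rfl, rfl⟩ |
      ⟨rfl, rfl, rfl⟩ | ⟨rfl, rfl, rfl⟩
    · rfl
    · exact g1 _ _ _
    · exact g2 _ _ _
    · exact g3 _ _ _
    · exact g5 x' y' z'
    · exact g4 x' y' z'
  rw [hs, delta_gen, map_smul, ← Gtensor_eq_psi]
  refine h1 x y z (fun x y z => (η x * η y * η z) • Gtensor a x y z 0) ?_ ?_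
  · intro x y z
    simp only [Gtensor_eq_psi]
    rw [gPoly_swap_left, mul_comm (η x)]
  · intro x y z
    simp only [Gtensor_eq_psi]
    rw [gPoly_swap_right, mul_right_comm (η x)]

theorem delta_Cs_zero (a : Fin N) (x y : Fin 3) :
    δ N (Cs a x y 0) = psi (hsU a) ((-3 : ℝ) • ((su x * su y * ∑ ρ, su ρ * sk ρ)
      - (1 / 3 : ℝ) • metric x y • (dot su su * ∑ ρ, su ρ * sk ρ))) := by
  have h1 : δ N (Cs a x y 0) = (-3 : ℝ) • ((∑ ρ, hs a x y ρ {ρ})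
      - (1 / 3 : ℝ) • metric x y • ∑ ρ, hstr a ρ {ρ}) := by
    rw [Cs, delta_gen]
    rcases le_total x y with hxy | hxy
    · simp only [sort2, deltaGen, min_eq_left hxy, max_eq_right hxy]
      rfl
    · simp only [sort2, deltaGen, min_eq_right hxy, max_eq_left hxy]
      have hs' : ∀ ρ, hs a y x ρ {ρ} = hs a x y ρ {ρ} := fun ρ => by
        have : ∀ x y ρ : Fin 3, sort3 y x ρ = sort3 x y ρ := by decide
        rw [hs, hs, this]
      rw [metric_comm y x]
      refine congrArg (fun z => (-3 : ℝ) • (z - _)) (Finset.sum_congr rfl fun ρ _ => hs' ρ)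
  rw [h1]
  simp only [hs_eq_psi, hstr_eq_psi, ← map_smul, ← map_sum, ← map_sub]
  congr 1
  simp only [Multiset.map_singleton, Multiset.prod_singleton, Finset.mul_sum]
  have e : ∑ x, su x * dot su su * sk x = ∑ x, dot su su * (su x * sk x) :=
    Finset.sum_congr rfl fun ρ _ => by ring
  rw [e]
  simp only [mul_assoc]


/-! ### Contractions of symbols -/

section Contractions

variable {A : Type} [CommRing A] [Algebra ℝ A]

/-- The trace of a symmetric tensor with three indices. -/
def tr3 {M : Type} [AddCommGroup M] [Module ℝ M] (g : Fin 3 → Fin 3 → Fin 3 → M) (l : Fin 3) : M :=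
  ∑ ν, η ν • g l ν ν

/-- Lower the index of a vector. -/
def lower (t : Fin 3 → A) (μ : Fin 3) : A := η μ • t μ

/-- The full contraction of a tensor with three vectors. -/
def contr3 (g : Fin 3 → Fin 3 → Fin 3 → A) (x y z : Fin 3 → A) : A :=
  ∑ α, ∑ β, ∑ l, g α β l * (x α * y β * z l)

/-- The contraction of the traceless projection occurring in `a₁` with three vectors. -/
def contrTraceless (g : Fin 3 → Fin 3 → Fin 3 → A) (x y z : Fin 3 → A) : A :=
  contr3 g x y z - (1 / 3 : ℝ) • (dot x y * dot (lower (tr3 g)) z)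

/-- Links the subtraction of the trace in components, as in `a₁`, to the scalar product form used in
the symbol identities. -/
theorem contrTraceless_eq (g : Fin 3 → Fin 3 → Fin 3 → A) (x y z : Fin 3 → A) :
    contrTraceless g x y z = ∑ α, ∑ β, ∑ l,
      (g α β l - (1 / 3 : ℝ) • metric α β • tr3 g l) * (x α * y β * z l) := by
  have : dot x y * dot (lower (tr3 g)) z =
      ∑ α, ∑ β, ∑ l, (metric α β • tr3 g l) * (x α * y β * z l) := by
    generalize tr3 g = t
    simp only [Fin.sum_univ_three, metric, lower, η, dot]
    simp
    ring
  simp only [contrTraceless, contr3, this, Finset.smul_sum, sub_mul, smul_mul_assoc,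
    Finset.sum_sub_distrib]

theorem contraction_left (g : Fin 3 → Fin 3 → Fin 3 → A) (v k w : Fin 3 → A) :
    ∑ μ, ∑ ν, ∑ ρ, ε μ ν ρ • ∑ α, ∑ β, ∑ l, (3 : ℝ) • (1 / 3 : ℝ) •
      ((g α β l - (1 / 3 : ℝ) • metric α β • tr3 g l) * (v α * v μ * v l) *
        (1 / 2 : ℝ) • (w ρ * w β * k ν - w ν * w β * k ρ)) =
      det v k w * contrTraceless g v w v := by
  have h : ∀ μ ν ρ, ∑ α, ∑ β, ∑ l, (3 : ℝ) • (1 / 3 : ℝ) •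
      ((g α β l - (1 / 3 : ℝ) • metric α β • tr3 g l) * (v α * v μ * v l) *
        (1 / 2 : ℝ) • (w ρ * w β * k ν - w ν * w β * k ρ)) =
      (1 / 2 : ℝ) • (v μ * (w ρ * k ν - w ν * k ρ) * contrTraceless g v w v) := by
    intro μ ν ρ
    rw [contrTraceless_eq]
    simp only [Finset.mul_sum, Finset.smul_sum, smul_smul, mul_smul_comm]
    refine Finset.sum_congr rfl fun α _ => Finset.sum_congr rfl fun β _ =>
      Finset.sum_congr rfl fun l _ => ?_
    norm_num only
    congr 1
    ring
  simp only [h]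
  rw [sum_eps_smul]
  simp only [← smul_sub, ← smul_add]
  rw [one_div, inv_smul_eq_iff₀ two_ne_zero, ofNat_smul_eq_nsmul]
  simp only [det, nsmul_eq_mul]
  push_cast
  ring

theorem contraction_right (g : Fin 3 → Fin 3 → Fin 3 → A) (v k w : Fin 3 → A) :
    ∑ μ, ∑ ν, ∑ ρ, ε μ ν ρ • ∑ α, ∑ β, ∑ l, (3 : ℝ) • (1 / 2 : ℝ) •
      ((g α β l - (1 / 3 : ℝ) • metric α β • tr3 g l) * (v α * v μ) *
        (1 / 2 : ℝ) • (w ν * w β * w l * k ρ - w ρ * w β * w l * k ν)) =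
      (-3 / 2 : ℝ) • (det v k w * contrTraceless g v w w) := by
  have h : ∀ μ ν ρ, ∑ α, ∑ β, ∑ l, (3 : ℝ) • (1 / 2 : ℝ) •
      ((g α β l - (1 / 3 : ℝ) • metric α β • tr3 g l) * (v α * v μ) *
        (1 / 2 : ℝ) • (w ν * w β * w l * k ρ - w ρ * w β * w l * k ν)) =
      (-3 / 4 : ℝ) • (v μ * (w ρ * k ν - w ν * k ρ) * contrTraceless g v w w) := by
    intro μ ν ρ
    rw [contrTraceless_eq]
    simp only [Finset.mul_sum, Finset.smul_sum, smul_smul, mul_smul_comm]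
    refine Finset.sum_congr rfl fun α _ => Finset.sum_congr rfl fun β _ =>
      Finset.sum_congr rfl fun l _ => ?_
    norm_num only
    rw [neg_smul, ← smul_neg]
    congr 1
    ring
  simp only [h]
  rw [sum_eps_smul]
  simp only [← smul_sub, ← smul_add]
  rw [show (-3 / 2 : ℝ) = (-3 / 4) * 2 by norm_num, mul_smul, ofNat_smul_eq_nsmul]
  congr 1
  simp only [det, nsmul_eq_mul]
  push_cast
  ring

/-- The part proportional to `v μ * v ν` is symmetric and drops out against the Levi-Civita density,
leaving a single determinant. -/
theorem contraction_trace (t : Fin 3 → A) (v k w : Fin 3 → A) (W : A) :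
    ∑ μ, ∑ ν, ∑ ρ, ε μ ν ρ • ∑ l, (1 / 3 : ℝ) •
      (t l * (1 / 2 : ℝ) • (v ν * v μ * k l - v l * v μ * k ν) * (w ρ * W)) =
      (-1 / 6 : ℝ) • (det v k w * dot (lower t) v * W) := by
  have h : ∀ μ ν ρ, ∑ l, (1 / 3 : ℝ) •
      (t l * (1 / 2 : ℝ) • (v ν * v μ * k l - v l * v μ * k ν) * (w ρ * W)) =
      (-1 / 6 : ℝ) • (v μ * w ρ * W * (k ν * dot (lower t) v - v ν * dot (lower t) k)) := by
    intro μ ν ρ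
    simp only [← Finset.smul_sum, mul_smul_comm, smul_mul_assoc, smul_smul]
    norm_num only
    rw [neg_smul, ← smul_neg]
    congr 1
    simp only [Fin.sum_univ_three, dot, lower, η]
    simp
    ring
  simp only [h]
  rw [sum_eps_smul]
  simp only [← smul_sub, ← smul_add]
  congr 1
  simp only [det]
  ring

theorem contraction_divergence (t : Fin 3 → A) (v k w : Fin 3 → A) (W : A) :
    ∑ μ, ∑ ν, ∑ ρ, ε μ ν ρ • ∑ x, (η μ * η x) •
      (t μ * (v ν * v x) * ((-1 / 2 : ℝ) • ∑ l, η l • (w l * w x * w ρ * k l) +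
        ((1 / 2 : ℝ) • (w ρ * W * k x) + (1 / 2 : ℝ) • (w x * W * k ρ)))) =
      (1 / 2 : ℝ) • (-(det (lower t) v w * dot v w * dot w k) + det (lower t) v w * dot v k * W
        + det (lower t) v k * dot v w * W) := by
  have h : ∀ μ ν ρ, ∑ x, (η μ * η x) •
      (t μ * (v ν * v x) * ((-1 / 2 : ℝ) • ∑ l, η l • (w l * w x * w ρ * k l) +
        ((1 / 2 : ℝ) • (w ρ * W * k x) + (1 / 2 : ℝ) • (w x * W * k ρ)))) =
      (1 / 2 : ℝ) • (lower t μ * v ν * (-(w ρ * dot v w * dot w k) + w ρ * dot v k * W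
        + k ρ * dot v w * W)) := by
    intro μ ν ρ
    have e : ∀ x, (-1 / 2 : ℝ) • ∑ l, η l • (w l * w x * w ρ * k l) +
        ((1 / 2 : ℝ) • (w ρ * W * k x) + (1 / 2 : ℝ) • (w x * W * k ρ)) =
        (1 / 2 : ℝ) • (-(w x * w ρ * dot w k) + (w ρ * W * k x + w x * W * k ρ)) := by
      intro x
      rw [smul_add, smul_neg, ← smul_add, neg_div, neg_smul]
      congr 3
      rw [sum_eta_smul, dot]
      ring
    simp only [e, mul_smul_comm]
    simp only [smul_comm _ (1 / 2 : ℝ), ← Finset.smul_sum]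
    congr 1
    simp only [mul_smul, sum_eta_smul, dot, lower, ← Finset.smul_sum, smul_mul_assoc]
    congr 1
    ring
  simp only [h]
  rw [sum_eps_smul]
  simp only [← smul_sub, ← smul_add]
  congr 1
  simp only [det]
  ring

theorem contraction_antifield (G : Fin 3 → Fin 3 → A) (v k w : Fin 3 → A) :
    ∑ μ, ∑ ν, ∑ ρ, ε μ ν ρ • ∑ α, ∑ β, (G α β * (v μ * v α) *
        (1 / 2 : ℝ) • (w ρ * w β * k ν - w ν * w β * k ρ)) =
      det v k w * ∑ α, ∑ β, G α β * (v α * w β) := by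
  have h : ∀ μ ν ρ, ∑ α, ∑ β, (G α β * (v μ * v α) *
        (1 / 2 : ℝ) • (w ρ * w β * k ν - w ν * w β * k ρ)) =
      (1 / 2 : ℝ) • (v μ * (w ρ * k ν - w ν * k ρ) * ∑ α, ∑ β, G α β * (v α * w β)) := by
    intro μ ν ρ
    simp only [Finset.mul_sum, Finset.smul_sum, mul_smul_comm]
    refine Finset.sum_congr rfl fun α _ => Finset.sum_congr rfl fun β _ => ?_
    congr 1
    ring
  simp only [h]
  rw [sum_eps_smul]
  simp only [← smul_sub, ← smul_add]
  rw [one_div, inv_smul_eq_iff₀ two_ne_zero, ofNat_smul_eq_nsmul]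
  simp only [det, nsmul_eq_mul]
  push_cast
  ring

end Contractions

/-! ### Umbral forms of `a₂` and `a₁` -/

/-- The contraction of a tensor of antifield type with the jets in `a₁`. -/
def liftBody (H : Fin 3 → Fin 3 → Fin 3 → Loc N) (b c : Fin N) : Loc N :=
  ∑ μ, ∑ ν, ∑ ρ, ε μ ν ρ •
    ((∑ α, ∑ β, ∑ l, (3 : ℝ) • ((H α β l - (1 / 3 : ℝ) • metric α β • tr3 H l) *
        ((1 / 3 : ℝ) • (h b α μ l 0 * T c ν ρ β)
          + (1 / 2 : ℝ) • (C b α μ 0 *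
              ((1 / 2 : ℝ) • (h c ν β l {ρ} - h c ρ β l {ν}))))))
    + (∑ l, (1 / 3 : ℝ) • (tr3 H l * T b l ν μ * htr c ρ 0))
    + ∑ α, (η μ * η α) • (tr3 H μ * C b ν α 0 *
        ((-1 / 2 : ℝ) • (∑ l, η l • h c l α ρ {l})
          + (1 / 2 : ℝ) • (htr c ρ {α} + htr c α {ρ}))))

theorem a₁_eq (f : Fin N → Fin N → Fin N → ℝ) :
    a₁ f = ∑ a, ∑ b, ∑ c, f a b c • liftBody (fun x y z => hs a x y z 0) b c := by
  simp only [a₁, liftBody, mul_smul, ← Finset.smul_sum]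
  rfl

/-- The symbol of the terms of `a₁` with an undifferentiated field. -/
def liftPolyLeft (g : Fin 3 → Fin 3 → Fin 3 → TriPoly) : TriPoly :=
  det (tv 1) (mv 2) (tv 2) * contrTraceless g (tv 1) (tv 2) (tv 1)

/-- The symbol of the terms of `a₁` with an undifferentiated ghost or its trace part. -/
def liftPolyRight (g : Fin 3 → Fin 3 → Fin 3 → TriPoly) : TriPoly :=
  (-3 / 2 : ℝ) • (det (tv 1) (mv 2) (tv 2) * contrTraceless g (tv 1) (tv 2) (tv 2))
  + ((-1 / 6 : ℝ) • (det (tv 1) (mv 1) (tv 2) * dot (lower (tr3 g)) (tv 1) * dot (tv 2) (tv 2))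
  + (1 / 2 : ℝ) • (-(det (lower (tr3 g)) (tv 1) (tv 2) * dot (tv 1) (tv 2) * dot (tv 2) (mv 2))
    + det (lower (tr3 g)) (tv 1) (tv 2) * dot (tv 1) (mv 2) * dot (tv 2) (tv 2)
    + det (lower (tr3 g)) (tv 1) (mv 2) * dot (tv 1) (tv 2) * dot (tv 2) (tv 2)))

theorem inSlot_dot (s : Fin 3) (x y : Fin 3 → SlotPoly) :
    inSlot s (dot x y) = dot (fun i => inSlot s (x i)) (fun i => inSlot s (y i)) := by
  simp [dot]

/-- Stated for any tensor `g` in the first slot, so that one computation serves both `a₁`, with the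
antifield, and `δ a₁`, with the field equations in its place. -/
theorem liftBody_psi (X : Slot N) (g : Fin 3 → Fin 3 → Fin 3 → SlotPoly) (b c : Fin N) :
    liftBody (fun x y z => psi X (g x y z)) b c =
      umb X (hU b) (CU c) (liftPolyLeft fun x y z => inSlot 0 (g x y z)) +
      umb X (CU b) (hU c) (liftPolyRight fun x y z => inSlot 0 (g x y z)) := by
  have ht : ∀ l, tr3 (fun x y z => psi X (g x y z)) l = psi X (tr3 g l) := fun l => by
    simp only [tr3, map_sum, map_smul]
  have ht' : ∀ l, inSlot 0 (tr3 g l) = tr3 (fun x y z => inSlot 0 (g x y z)) l := fun l => by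
    simp only [tr3, map_sum, map_smul]
  simp only [liftBody, ht, h_eq_psi, htr_eq_psi, C_eq_psi, T_eq_psi, ← map_smul, ← map_sum,
    ← map_sub, ← map_add, mul_add, mul_smul_comm, ← mul_assoc, ← umb_inSlot, smul_add,
    Finset.sum_add_distrib]
  simp only [← map_smul, ← map_sum, ← map_add, add_assoc]
  congr 2
  · simp only [map_sub, map_smul, map_mul, inSlot_su, inSlot_sk, Multiset.map_zero,
      Multiset.prod_zero, mul_one, ht']
    exact contraction_left _ (tv 1) (mv 2) (tv 2)
  · simp only [map_sub, map_smul, map_sum, map_mul, map_add, inSlot_su, inSlot_sk,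
      Multiset.map_singleton, Multiset.prod_singleton, Multiset.map_zero, Multiset.prod_zero,
      mul_one, ht', inSlot_dot]
    exact congrArg₂ (· + ·) (contraction_right _ (tv 1) (mv 2) (tv 2))
      (congrArg₂ (· + ·) (contraction_trace _ (tv 1) (mv 1) (tv 2) _)
        (contraction_divergence _ (tv 1) (mv 2) (tv 2) _))

theorem a₁_umb (f : Fin N → Fin N → Fin N → ℝ) :
    a₁ f = umbSum f hsU hU CU (liftPolyLeft fun x y z => tv 0 x * tv 0 y * tv 0 z) +
      umbSum f hsU CU hU (liftPolyRight fun x y z => tv 0 x * tv 0 y * tv 0 z) := by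
  simp only [a₁_eq, umbSum_apply, ← Finset.sum_add_distrib, ← smul_add, hs_eq_psi, liftBody_psi]
  simp

/-- `δ` annihilates fields and ghosts, and the antifield stands leftmost in every term, so it is
simply replaced by its image without signs. -/
theorem delta_liftBody (a b c : Fin N) :
    δ N (liftBody (fun x y z => hs a x y z 0) b c) =
      liftBody (fun x y z => δ N (hs a x y z 0)) b c := by
  have dh : ∀ a x y z α, δ N (h a x y z α) = 0 := fun a x y z α => delta_coord _
  have dC : ∀ a x y α, δ N (C a x y α) = 0 := fun a x y α => delta_gen _
  have l1 : ∀ a x y z α w, δ N (hs a x y z α * w) = δ N (hs a x y z α) * w - hs a x y z α * δ N w :=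
    fun a x y z α w => by
      rw [delta_isDer.leib_hs a x y z α w]; simp [sub_eq_add_neg]
  have l2 : ∀ a x y z α w, δ N (h a x y z α * w) = h a x y z α * δ N w :=
    fun a x y z α w => by
      rw [delta_isDer.leib_h a x y z α w, dh]; simp
  have l3 : ∀ a x y α w, δ N (C a x y α * w) = - (C a x y α * δ N w) :=
    fun a x y α w => by
      rw [delta_isDer.leib_C a x y α w, dC]; simp
  simp only [liftBody, tr3, T, htr, sub_mul, Finset.sum_mul, smul_mul_assoc, mul_assoc, map_sum,
    map_smul, map_add, map_sub, l1, l2, l3, dh, dC, mul_add, mul_sub, Finset.mul_sum, mul_smul_comm,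
    mul_zero, sub_zero, smul_zero, add_zero, neg_zero, Finset.sum_const_zero]

theorem delta_a₁_umb (f : Fin N → Fin N → Fin N → ℝ) :
    δ N (a₁ f) =
      umbSum f hU hU CU (liftPolyLeft fun x y z => (η x * η y * η z) • gPoly (tv 0) (mv 0) x y z) +
      umbSum f hU CU hU (liftPolyRight fun x y z =>
        (η x * η y * η z) • gPoly (tv 0) (mv 0) x y z) := by
  have hg : ∀ x y z, inSlot 0 ((η x * η y * η z) • gPoly su sk x y z) =
      (η x * η y * η z) • gPoly (tv 0) (mv 0) x y z := fun x y z => by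
    simp only [gPoly, fronsdalPoly, fronsdalTrPoly, inSlot_dot, map_smul, map_sub, map_add,
      map_mul, map_pow, map_ofNat, inSlot_su, inSlot_sk]
  rw [a₁_eq]
  simp only [map_sum, (δ N).map_smul]
  simp only [delta_liftBody, delta_hs_zero, liftBody_psi, hg, umbSum_apply,
    ← Finset.sum_add_distrib, ← smul_add]

/-- The symbol of `δ a₂`. -/
def deltaPoly : TriPoly :=
  (-3 : ℝ) • (det (tv 1) (mv 2) (tv 2) * dot (lower (tv 0)) (mv 0) *
    (dot (lower (tv 0)) (tv 1) * dot (lower (tv 0)) (tv 2)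
      - (1 / 3 : ℝ) • (dot (tv 0) (tv 0) * dot (tv 1) (tv 2))))

theorem delta_a₂_umb (f : Fin N → Fin N → Fin N → ℝ) :
    δ N (a₂ f) = umbSum f hsU CU CU deltaPoly := by
  have dC : ∀ a x y α, δ N (C a x y α) = 0 := fun a x y α => delta_gen _
  have l1 : ∀ a x y α w, δ N (Cs a x y α * w) = δ N (Cs a x y α) * w + Cs a x y α * δ N w :=
    fun a x y α w => by rw [delta_isDer.leib_Cs a x y α w]; simp
  have l3 : ∀ a x y α w, δ N (C a x y α * w) = - (C a x y α * δ N w) :=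
    fun a x y α w => by
      rw [delta_isDer.leib_C a x y α w, dC]; simp
  have e : ∀ a b c, δ N (∑ μ, ∑ ν, ∑ ρ, ε μ ν ρ • ∑ α, ∑ β, Cs a α β 0 * C b μ α 0 * T c ν ρ β) =
      umb (hsU a) (CU b) (CU c) deltaPoly := by
    intro a b c
    have e1 : δ N (∑ μ, ∑ ν, ∑ ρ, ε μ ν ρ • ∑ α, ∑ β, Cs a α β 0 * C b μ α 0 * T c ν ρ β) =
        ∑ μ, ∑ ν, ∑ ρ, ε μ ν ρ • ∑ α, ∑ β, δ N (Cs a α β 0) * C b μ α 0 * T c ν ρ β := by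
      simp only [T, map_sum, map_smul, mul_assoc, l1, l3, dC, map_sub, sub_zero, smul_zero,
        mul_zero, neg_zero, add_zero]
    rw [e1]
    simp only [delta_Cs_zero, C_eq_psi, T_eq_psi, ← umb_inSlot, ← map_sum, ← map_smul]
    congr 1
    simp only [map_sub, map_smul, map_sum, map_mul, map_add, inSlot_su, inSlot_sk,
      Multiset.map_zero, Multiset.prod_zero, mul_one, inSlot_dot]
    rw [contraction_antifield (fun α β => (-3 : ℝ) • (tv 0 α * tv 0 β * ∑ ρ, tv 0 ρ * mv 0 ρ -
      (1 / 3 : ℝ) • metric α β • (dot (tv 0) (tv 0) * ∑ ρ, tv 0 ρ * mv 0 ρ))), deltaPoly,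
      mul_assoc, ← mul_smul_comm]
    congr 1
    simp only [smul_mul_assoc, ← Finset.smul_sum, sub_mul, Finset.sum_sub_distrib]
    congr 1
    rw [mul_sub, mul_smul_comm]
    have e2 : ∑ ρ, tv 0 ρ * mv 0 ρ = dot (lower (tv 0)) (mv 0) := by
      simp [Fin.sum_univ_three, dot, lower, η]
    rw [e2]
    generalize dot (lower (tv 0)) (mv 0) = q
    congr 1
    · simp [Fin.sum_univ_three, dot, lower, η]
      ring
    · congr 1
      generalize dot (tv 0) (tv 0) = U
      simp [Fin.sum_univ_three, dot, metric, η]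
      ring
  simp only [umbSum_apply, ← e, ← map_smul, ← map_sum]
  congr 1
  simp only [a₂, mul_smul, ← Finset.smul_sum]


/-! ### The umbral form of the cubic vertex -/

section Vertex

variable {A : Type} [CommRing A]

/-- The terms of the symbol of `8 a₀` with a derivative contracted with `ε` and with the free
indices in the fields `a` and `c`. -/
def vertexAC (a₂ a₃ b₁ b₂ b₃ l c₂ c₃ : Fin 3 → A) : A :=
  2 * (dot a₂ l * dot a₃ b₁ * dot b₂ b₃ * dot c₂ c₃)
    + 2 * (dot a₂ l * dot a₃ b₁ * dot b₂ c₂ * dot b₃ c₃)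
    - 10 * (dot a₂ l * dot b₁ c₂ * dot b₂ b₃ * dot a₃ c₃)
    - 3 * (dot a₂ a₃ * dot b₁ l * dot b₂ b₃ * dot c₂ c₃)
    + 2 * (dot b₁ l * dot b₂ b₃ * dot a₂ c₂ * dot a₃ c₃)
    - 8 * (dot a₂ a₃ * dot b₁ l * dot b₂ c₂ * dot b₃ c₃)
    + 4 * (dot a₂ b₁ * dot b₂ l * dot b₃ c₂ * dot a₃ c₃)
    + 16 * (dot a₂ a₃ * dot c₂ l * dot b₁ b₂ * dot b₃ c₃)
    - 2 * (dot a₂ b₁ * dot a₃ b₂ * dot c₂ l * dot b₃ c₃)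
    - 2 * (dot c₂ l * dot a₂ b₁ * dot b₂ b₃ * dot a₃ c₃)

/-- The terms of the symbol of `8 a₀` with two derivatives contracted with `ε`. -/
def vertexA (a₂ a₃ b₁ b₂ b₃ c₁ c₂ c₃ : Fin 3 → A) : A :=
  -(5 * (dot a₂ a₃ * dot b₁ b₂ * dot b₃ c₁ * dot c₂ c₃))
    + 7 * (dot a₂ b₁ * dot a₃ b₂ * dot b₃ c₁ * dot c₂ c₃)

/-- The terms of the symbol of `8 a₀` with the free indices in the fields `a` and `b`. -/
def vertexAB (a₂ a₃ b₂ b₃ l c₁ c₂ c₃ : Fin 3 → A) : A :=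
  2 * (dot a₂ b₂ * dot b₃ l * dot a₃ c₁ * dot c₂ c₃)
    + 2 * (dot a₂ a₃ * dot b₂ l * dot b₃ c₁ * dot c₂ c₃)
    - 2 * (dot b₂ l * dot b₃ c₁ * dot a₂ c₂ * dot a₃ c₃)
    - dot a₂ a₃ * dot b₂ b₃ * dot c₁ l * dot c₂ c₃
    - dot a₂ b₂ * dot a₃ b₃ * dot c₁ l * dot c₂ c₃

/-- The polarized symbol of `8 a₀`. -/
def vertex (a₁ a₂ a₃ k b₁ b₂ b₃ l c₁ c₂ c₃ : Fin 3 → A) : A :=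
  det k a₁ c₁ * vertexAC a₂ a₃ b₁ b₂ b₃ l c₂ c₃ + det k a₁ l * vertexA a₂ a₃ b₁ b₂ b₃ c₁ c₂ c₃
    + det k a₁ b₁ * vertexAB a₂ a₃ b₂ b₃ l c₁ c₂ c₃

-- Each of the seventeen index contractions becomes a monomial in scalar products. All coefficients
-- are multiples of `1/8`, which is factored out so that the remaining symbol is integral.
set_option maxHeartbeats 4000000 in
theorem contraction_vertex [Algebra ℝ A] (a k b l c : Fin 3 → A) (μ ν ρ : Fin 3) :
    (1 / 4 : ℝ) • (∑ x, ∑ y, (η x * η y) •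
        (a ν * a x * a y * k μ * (b y * dot b b * l x) * (c ρ * dot c c)))
    + (1 / 4 : ℝ) • (∑ x, ∑ y, ∑ z, ∑ w, (η x * η y * η z * η w) •
        (a ν * a x * a y * k μ * (b y * b z * b w * l x) * (c ρ * c z * c w)))
    - (5 / 4 : ℝ) • (∑ x, ∑ y, ∑ z, (η x * η y * η z) •
        (a ν * a x * a y * k μ * (b z * dot b b * l x) * (c ρ * c z * c y)))
    - (3 / 8 : ℝ) • (∑ x, η x •
        (a ν * dot a a * k μ * (b x * dot b b * l x) * (c ρ * dot c c)))
    + (1 / 4 : ℝ) • (∑ x, ∑ y, ∑ z, (η x * η y * η z) •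
        (a ν * a x * a y * k μ * (b z * dot b b * l z) * (c ρ * c x * c y)))
    - (∑ x, ∑ y, ∑ z, (η x * η y * η z) •
        (a ν * dot a a * k μ * (b x * b y * b z * l z) * (c ρ * c x * c y)))
    + (1 / 2 : ℝ) • (∑ x, ∑ y, ∑ z, ∑ w, (η x * η y * η z * η w) •
        (a ν * a x * a y * k μ * (b x * b z * b w * l z) * (c ρ * c y * c w)))
    + (2 : ℝ) • (∑ y, ∑ z, (η y * η z) •
        (a ν * dot a a * k μ * (b z * dot b b * l y) * (c ρ * c y * c z)))
    - (1 / 4 : ℝ) • (∑ x, ∑ y, ∑ z, ∑ w, (η x * η y * η z * η w) •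
        (a ν * a x * a y * k μ * (b x * b y * b w * l z) * (c ρ * c z * c w)))
    - (1 / 4 : ℝ) • (∑ x, ∑ y, ∑ z, (η x * η y * η z) •
        (a ν * a x * a y * k μ * (b y * dot b b * l z) * (c ρ * c z * c x)))
    - (5 / 8 : ℝ) • (∑ y, η y •
        (a ν * dot a a * k μ * (b y * dot b b * l ρ) * (c y * dot c c)))
    + (7 / 8 : ℝ) • (∑ x, ∑ y, ∑ z, (η x * η y * η z) •
        (a ν * a x * a y * k μ * (b x * b y * b z * l ρ) * (c z * dot c c)))
    + (1 / 4 : ℝ) • (∑ x, ∑ y, ∑ z, (η x * η y * η z) •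
        (a ν * a x * a y * k μ * (b ρ * b x * b z * l z) * (c y * dot c c)))
    + (1 / 4 : ℝ) • (∑ x, ∑ y, (η x * η y) •
        (a ν * dot a a * k μ * (b ρ * b x * b y * l x) * (c y * dot c c)))
    - (1 / 4 : ℝ) • (∑ x, ∑ y, ∑ z, ∑ w, (η x * η y * η z * η w) •
        (a ν * a x * a y * k μ * (b ρ * b z * b w * l z) * (c x * c y * c w)))
    - (1 / 8 : ℝ) • (∑ x, η x •
        (a ν * dot a a * k μ * (b ρ * dot b b * l x) * (c x * dot c c)))
    - (1 / 8 : ℝ) • (∑ x, ∑ y, ∑ z, (η x * η y * η z) •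
        (a ν * a x * a y * k μ * (b ρ * b x * b y * l z) * (c z * dot c c))) =
    (1 / 8 : ℝ) • (k μ * a ν * c ρ * vertexAC a a b b b l c c + k μ * a ν * l ρ * vertexA a a b b b c c c
      + k μ * a ν * b ρ * vertexAB a a b b l c c c) := by
  have t0 : ∑ x, ∑ y, (η x * η y) • (a ν * a x * a y * k μ * (b y * dot b b * l x) * (c ρ * dot c c)) =
      k μ * a ν * c ρ * (dot a l * dot a b * dot b b * dot c c) := by
    simp only [mul_smul, ← Finset.smul_sum, sum_eta_smul, dot]
    ring
  have t1 : ∑ x, ∑ y, ∑ z, ∑ w, (η x * η y * η z * η w) • (a ν * a x * a y * k μ * (b y * b z * b w * l x) * (c ρ * c z * c w)) =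
      k μ * a ν * c ρ * (dot a l * dot a b * dot b c * dot b c) := by
    simp only [mul_smul, ← Finset.smul_sum, sum_eta_smul, dot]
    ring
  have t2 : ∑ x, ∑ y, ∑ z, (η x * η y * η z) • (a ν * a x * a y * k μ * (b z * dot b b * l x) * (c ρ * c z * c y)) =
      k μ * a ν * c ρ * (dot a l * dot b c * dot b b * dot a c) := by
    simp only [mul_smul, ← Finset.smul_sum, sum_eta_smul, dot]
    ring
  have t3 : ∑ x, η x • (a ν * dot a a * k μ * (b x * dot b b * l x) * (c ρ * dot c c)) =
      k μ * a ν * c ρ * (dot a a * dot b l * dot b b * dot c c) := by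
    simp only [mul_smul, ← Finset.smul_sum, sum_eta_smul, dot]
    ring
  have t4 : ∑ x, ∑ y, ∑ z, (η x * η y * η z) • (a ν * a x * a y * k μ * (b z * dot b b * l z) * (c ρ * c x * c y)) =
      k μ * a ν * c ρ * (dot b l * dot b b * dot a c * dot a c) := by
    simp only [mul_smul, ← Finset.smul_sum, sum_eta_smul, dot]
    ring
  have t5 : ∑ x, ∑ y, ∑ z, (η x * η y * η z) • (a ν * dot a a * k μ * (b x * b y * b z * l z) * (c ρ * c x * c y)) =
      k μ * a ν * c ρ * (dot a a * dot b l * dot b c * dot b c) := by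
    simp only [mul_smul, ← Finset.smul_sum, sum_eta_smul, dot]
    ring
  have t6 : ∑ x, ∑ y, ∑ z, ∑ w, (η x * η y * η z * η w) • (a ν * a x * a y * k μ * (b x * b z * b w * l z) * (c ρ * c y * c w)) =
      k μ * a ν * c ρ * (dot a b * dot b l * dot b c * dot a c) := by
    simp only [mul_smul, ← Finset.smul_sum, sum_eta_smul, dot]
    ring
  have t7 : ∑ y, ∑ z, (η y * η z) • (a ν * dot a a * k μ * (b z * dot b b * l y) * (c ρ * c y * c z)) =
      k μ * a ν * c ρ * (dot a a * dot c l * dot b b * dot b c) := by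
    simp only [mul_smul, ← Finset.smul_sum, sum_eta_smul, dot]
    ring
  have t8 : ∑ x, ∑ y, ∑ z, ∑ w, (η x * η y * η z * η w) • (a ν * a x * a y * k μ * (b x * b y * b w * l z) * (c ρ * c z * c w)) =
      k μ * a ν * c ρ * (dot a b * dot a b * dot c l * dot b c) := by
    simp only [mul_smul, ← Finset.smul_sum, sum_eta_smul, dot]
    ring
  have t9 : ∑ x, ∑ y, ∑ z, (η x * η y * η z) • (a ν * a x * a y * k μ * (b y * dot b b * l z) * (c ρ * c z * c x)) =
      k μ * a ν * c ρ * (dot c l * dot a b * dot b b * dot a c) := by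
    simp only [mul_smul, ← Finset.smul_sum, sum_eta_smul, dot]
    ring
  have t10 : ∑ y, η y • (a ν * dot a a * k μ * (b y * dot b b * l ρ) * (c y * dot c c)) =
      k μ * a ν * l ρ * (dot a a * dot b b * dot b c * dot c c) := by
    simp only [mul_smul, ← Finset.smul_sum, sum_eta_smul, dot]
    ring
  have t11 : ∑ x, ∑ y, ∑ z, (η x * η y * η z) • (a ν * a x * a y * k μ * (b x * b y * b z * l ρ) * (c z * dot c c)) =
      k μ * a ν * l ρ * (dot a b * dot a b * dot b c * dot c c) := by
    simp only [mul_smul, ← Finset.smul_sum, sum_eta_smul, dot]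
    ring
  have t12 : ∑ x, ∑ y, ∑ z, (η x * η y * η z) • (a ν * a x * a y * k μ * (b ρ * b x * b z * l z) * (c y * dot c c)) =
      k μ * a ν * b ρ * (dot a b * dot b l * dot a c * dot c c) := by
    simp only [mul_smul, ← Finset.smul_sum, sum_eta_smul, dot]
    ring
  have t13 : ∑ x, ∑ y, (η x * η y) • (a ν * dot a a * k μ * (b ρ * b x * b y * l x) * (c y * dot c c)) =
      k μ * a ν * b ρ * (dot a a * dot b l * dot b c * dot c c) := by
    simp only [mul_smul, ← Finset.smul_sum, sum_eta_smul, dot]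
    ring
  have t14 : ∑ x, ∑ y, ∑ z, ∑ w, (η x * η y * η z * η w) • (a ν * a x * a y * k μ * (b ρ * b z * b w * l z) * (c x * c y * c w)) =
      k μ * a ν * b ρ * (dot b l * dot b c * dot a c * dot a c) := by
    simp only [mul_smul, ← Finset.smul_sum, sum_eta_smul, dot]
    ring
  have t15 : ∑ x, η x • (a ν * dot a a * k μ * (b ρ * dot b b * l x) * (c x * dot c c)) =
      k μ * a ν * b ρ * (dot a a * dot b b * dot c l * dot c c) := by
    simp only [mul_smul, ← Finset.smul_sum, sum_eta_smul, dot]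
    ring
  have t16 : ∑ x, ∑ y, ∑ z, (η x * η y * η z) • (a ν * a x * a y * k μ * (b ρ * b x * b y * l z) * (c z * dot c c)) =
      k μ * a ν * b ρ * (dot a b * dot a b * dot c l * dot c c) := by
    simp only [mul_smul, ← Finset.smul_sum, sum_eta_smul, dot]
    ring
  rw [t0, t1, t2, t3, t4, t5, t6, t7, t8, t9, t10, t11, t12, t13, t14, t15, t16]
  have e : ∀ (n : ℕ) (x : A), ((n : ℝ) / 8) • x = (1 / 8 : ℝ) • ((n : A) * x) := fun n x => by
    rw [← nsmul_eq_mul, ← Nat.cast_smul_eq_nsmul ℝ, smul_smul]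
    congr 1
    ring
  have e1 : ∀ x : A, x = (1 / 8 : ℝ) • (((8 : ℕ) : A) * x) := fun x => by
    rw [← e]; norm_num
  rw [e1 (k μ * a ν * c ρ * (dot a a * dot b l * dot b c * dot b c)),
    show (1 / 4 : ℝ) = (2 : ℕ) / 8 by norm_num, show (5 / 4 : ℝ) = (10 : ℕ) / 8 by norm_num,
    show (3 / 8 : ℝ) = (3 : ℕ) / 8 by norm_num, show (1 / 2 : ℝ) = (4 : ℕ) / 8 by norm_num,
    show (2 : ℝ) = (16 : ℕ) / 8 by norm_num,
    show (5 / 8 : ℝ) = (5 : ℕ) / 8 by norm_num, show (7 / 8 : ℝ) = (7 : ℕ) / 8 by norm_num]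
  simp only [e, ← smul_add, ← smul_sub]
  congr 1
  simp only [vertexAC, vertexA, vertexAB]
  push_cast
  ring

theorem contraction_vertex_eps [Algebra ℝ A] (a k b l c : Fin 3 → A) :
    ∑ μ, ∑ ν, ∑ ρ, ε μ ν ρ • (1 / 8 : ℝ) • (k μ * a ν * c ρ * vertexAC a a b b b l c c
      + k μ * a ν * l ρ * vertexA a a b b b c c c + k μ * a ν * b ρ * vertexAB a a b b l c c c) =
    (1 / 8 : ℝ) • vertex a a a k b b b l c c c := by
  rw [sum_eps_smul]
  simp only [← smul_sub, ← smul_add]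
  congr 1
  simp only [vertex, det]
  ring

end Vertex


set_option maxHeartbeats 2000000 in
theorem a₀_umb (f : Fin N → Fin N → Fin N → ℝ) :
    a₀ f = umbSum f hU hU hU ((1 / 8 : ℝ) • vertex (tv 0) (tv 0) (tv 0) (mv 0)
      (tv 1) (tv 1) (tv 1) (mv 1) (tv 2) (tv 2) (tv 2)) := by
  have hf : ∀ (r : ℝ) (B : Fin 3 → Fin 3 → Fin 3 → Loc N),
      ∑ μ, ∑ ν, ∑ ρ, (r * ε μ ν ρ) • B μ ν ρ = r • ∑ μ, ∑ ν, ∑ ρ, ε μ ν ρ • B μ ν ρ := fun r B => by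
    simp only [mul_smul, Finset.smul_sum]
  rw [umbSum_apply, a₀]
  refine Finset.sum_congr rfl fun a _ => Finset.sum_congr rfl fun b _ =>
    Finset.sum_congr rfl fun c _ => (hf _ _).trans (congrArg (f a b c • ·) ?_)
  simp (config := { maxSteps := 2000000 }) only [h_eq_psi, htr_eq_psi, ← umb_inSlot, ← map_smul, ← map_sum, ← map_add, ← map_sub]
  congr 1
  simp (config := { maxSteps := 2000000 }) only [map_mul, inSlot_su, inSlot_sk, inSlot_dot, Multiset.map_singleton,
    Multiset.prod_singleton, Multiset.map_zero, Multiset.prod_zero, mul_one]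
  rw [← contraction_vertex_eps]
  refine Finset.sum_congr rfl fun μ _ => Finset.sum_congr rfl fun ν _ =>
    Finset.sum_congr rfl fun ρ _ => congrArg (ε μ ν ρ • ·) ?_
  exact contraction_vertex (tv 0) (mv 0) (tv 1) (mv 1) (tv 2) μ ν ρ


/-! ### Identities between contractions in three dimensions -/

section Identities

variable {A : Type} [CommRing A]

theorem dot_comm (x y : Fin 3 → A) : dot x y = dot y x := by simp only [dot]; ring

theorem dot_neg_sub_left (k l x : Fin 3 → A) : dot (-k - l) x = -dot k x - dot l x := by
  simp only [dot, Pi.sub_apply, Pi.neg_apply]; ring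

theorem dot_neg_sub_right (k l x : Fin 3 → A) : dot x (-k - l) = -dot x k - dot x l := by
  simp only [dot, Pi.sub_apply, Pi.neg_apply]; ring

theorem det_neg_sub_left (k l x y : Fin 3 → A) : det (-k - l) x y = -det k x y - det l x y := by
  simp only [det, Pi.sub_apply, Pi.neg_apply]; ring

theorem det_neg_sub_middle (k l x y : Fin 3 → A) :
    det x (-k - l) y = -det x k y - det x l y := by
  simp only [det, Pi.sub_apply, Pi.neg_apply]; ring

theorem det_neg_sub_right (k l x y : Fin 3 → A) : det x y (-k - l) = -det x y k - det x y l := by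
  simp only [det, Pi.sub_apply, Pi.neg_apply]; ring

theorem det_swap_left (x y z : Fin 3 → A) : det y x z = -det x y z := by
  simp only [det]; ring

theorem det_swap_right (x y z : Fin 3 → A) : det x z y = -det x y z := by
  simp only [det]; ring

theorem det_rotate (x y z : Fin 3 → A) : det y z x = det x y z := by
  simp only [det]; ring

theorem det_rotate' (x y z : Fin 3 → A) : det z x y = det x y z := by
  simp only [det]; ring

theorem det_reverse (x y z : Fin 3 → A) : det z y x = -det x y z := by
  simp only [det]; ring

theorem det_self_left (x y : Fin 3 → A) : det x x y = 0 := by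
  simp only [det]; ring

theorem det_self_right (x y : Fin 3 → A) : det y x x = 0 := by
  simp only [det]; ring

theorem det_self_outer (x y : Fin 3 → A) : det x y x = 0 := by
  simp only [det]; ring

/-- Antisymmetrization over four indices vanishes in three dimensions. -/
theorem schouten (a b c d e : Fin 3 → A) :
    det b c d * dot a e - det a c d * dot b e + det a b d * dot c e - det a b c * dot d e = 0 := by
  simp only [det, dot]; ring

/-- The polarized symbol of the first kind of terms in `6 a₁`. -/
def leftSym (G : (Fin 3 → A) → (Fin 3 → A) → (Fin 3 → A) → A) (t v₁ v₂ v₃ k w : Fin 3 → A) : A :=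
  det v₁ k w * (6 * G v₂ w v₃ - 2 * (dot v₂ w * dot t v₃))

/-- The polarized symbol of the second kind of terms in `6 a₁`. -/
def rightSym (G : (Fin 3 → A) → (Fin 3 → A) → (Fin 3 → A) → A) (t v k w₁ w₂ w₃ l : Fin 3 → A) :
    A :=
  det v l w₁ * (-9 * G v w₂ w₃ + 3 * (dot v w₂ * dot t w₃)) - dot t v * det v k w₁ * dot w₂ w₃
    + 3 * (-(det t v w₁ * dot v w₂ * dot w₃ l) + det t v w₁ * dot v l * dot w₂ w₃
      + det t v l * dot v w₁ * dot w₂ w₃)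

/-- The symbol of `6 γ a₁`. -/
def ghostSymAux (G : (Fin 3 → A) → (Fin 3 → A) → (Fin 3 → A) → A) (t w k y l : Fin 3 → A) : A :=
  rightSym G t w k l y y l + rightSym G t w k y l y l + rightSym G t w k y y l l
    - (leftSym G t k w w l y + leftSym G t w k w l y + leftSym G t w w k l y)

/-- The symbol of `6 (γ a₁ + δ a₂)`. -/
def ghostSym (u w k y l : Fin 3 → A) : A :=
  ghostSymAux (fun x y z => dot u x * dot u y * dot u z) (dot u u • u) w k y l
    - 18 * (det w l y * dot u (-k - l) * dot u w * dot u y)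
    + 6 * (det w l y * dot u (-k - l) * dot w y * dot u u)

theorem dot_smul_left (r : A) (x y : Fin 3 → A) : dot (r • x) y = r * dot x y := by
  simp only [dot, Pi.smul_apply, smul_eq_mul]; ring

theorem det_smul_left (r : A) (x y z : Fin 3 → A) : det (r • x) y z = r * det x y z := by
  simp only [det, Pi.smul_apply, smul_eq_mul]; ring

/-- `w, y` stand for the two traceless ghosts with momenta `k, l`, and `u` for the antifield with
momentum `-k - l`. Only the part symmetric under exchange of the ghosts survives the contraction
with `f`, and it vanishes by dimension-dependent identities. -/
theorem ghostSym_add_swap {w y : Fin 3 → A} (hw : dot w w = 0) (hy : dot y y = 0)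
    (u k l : Fin 3 → A) : ghostSym u w k y l + ghostSym u y l w k = 0 := by
  have sch_klwy_u := schouten k l w y u
  have sch_klwy_w := schouten k l w y w
  have sch_klwy_y := schouten k l w y y
  have sch_kuwy_k := schouten k u w y k
  have sch_kuwy_w := schouten k u w y w
  have sch_luwy_l := schouten l u w y l
  have sch_luwy_y := schouten l u w y y
  simp only [ghostSym, ghostSymAux, leftSym, rightSym, dot_neg_sub_right, dot_smul_left, det_smul_left,
    det_self_left, det_self_right, det_self_outer]
  -- Scalar products and determinants are brought to a fixed order of the vectors, so that they can
  -- be treated as independent atoms.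
  simp only [hw, hy,
    dot_comm l k, dot_comm u k, dot_comm w k, dot_comm y k, dot_comm u l, dot_comm w l,
    dot_comm y l, dot_comm w u, dot_comm y u, dot_comm y w, det_swap_left k l u,
    det_swap_right k l u, det_rotate k l u, det_rotate' k l u, det_reverse k l u,
    det_swap_left k l w, det_swap_right k l w, det_rotate k l w, det_rotate' k l w,
    det_reverse k l w, det_swap_left k l y, det_swap_right k l y, det_rotate k l y,
    det_rotate' k l y, det_reverse k l y, det_swap_left k u w, det_swap_right k u w,
    det_rotate k u w, det_rotate' k u w, det_reverse k u w, det_swap_left k u y,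
    det_swap_right k u y, det_rotate k u y, det_rotate' k u y, det_reverse k u y,
    det_swap_left k w y, det_swap_right k w y, det_rotate k w y, det_rotate' k w y,
    det_reverse k w y, det_swap_left l u w, det_swap_right l u w, det_rotate l u w,
    det_rotate' l u w, det_reverse l u w, det_swap_left l u y, det_swap_right l u y,
    det_rotate l u y, det_rotate' l u y, det_reverse l u y, det_swap_left l w y,
    det_swap_right l w y, det_rotate l w y, det_rotate' l w y, det_reverse l w y,
    det_swap_left u w y, det_swap_right u w y, det_rotate u w y, det_rotate' u w y,
    det_reverse u w y] at sch_klwy_u sch_klwy_w sch_klwy_y sch_kuwy_k sch_kuwy_w sch_luwy_l sch_luwy_y ⊢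
  -- After this normalization the claim lies in the module spanned by the Schouten identities; the
  -- coefficients are the solution of a linear system.
  linear_combination
    (-6) * (dot u w * dot u y) * sch_klwy_u + (-3) * (dot u u * dot w y) * sch_luwy_l + (-2)
    * (dot u u * dot u w) * sch_klwy_y + (-2) * (dot u u * dot u y) * sch_klwy_w + (3) *
    (dot l w * dot u u) * sch_luwy_y + (4) * (dot u u * dot w y) * sch_klwy_u + (-3) * (dot
    k y * dot u u) * sch_kuwy_w + (3) * (dot u u * dot w y) * sch_kuwy_k

end Identities


/-! ### The dimension-dependent identity behind the cubic vertex -/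

section Identities

variable {A : Type} [CommRing A]

/-- The contraction of the symbol of the Fronsdal tensor with three vectors. -/
def fronsdalSym (v p x y z : Fin 3 → A) : A :=
  dot p p * (dot v x * dot v y * dot v z)
    - dot v p * (dot p x * dot v y * dot v z + dot p y * dot v x * dot v z
      + dot p z * dot v x * dot v y)
    + dot v v * (dot p x * dot p y * dot v z + dot p x * dot p z * dot v y
      + dot p y * dot p z * dot v x)

/-- The contraction of the symbol of the trace of the Fronsdal tensor with a vector. -/
def fronsdalTrSym (v p x : Fin 3 → A) : A :=
  (2 * dot p p * dot v v - 2 * dot v p ^ 2) * dot v x + dot v p * dot v v * dot p x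

/-- The contraction of twice the symbol of the field equations with three vectors. -/
def eomSym (v p x y z : Fin 3 → A) : A :=
  2 * fronsdalSym v p x y z - (dot x y * fronsdalTrSym v p z + dot y z * fronsdalTrSym v p x
    + dot x z * fronsdalTrSym v p y)

/-- Twice the symbol of the trace of the field equations. -/
def eomTrSym (v p : Fin 3 → A) : Fin 3 → A :=
  (-3 * (2 * dot p p * dot v v - 2 * dot v p ^ 2)) • v + (-3 * (dot v p * dot v v)) • p

/-- The symbol of `24 (γ a₀ + δ a₁)`. -/
def vertexSym (a k b l w m : Fin 3 → A) : A :=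
  2 * (leftSym (eomSym a k) (eomTrSym a k) b b b m w
      - rightSym (eomSym a k) (eomTrSym a k) w m b b b l)
    + 3 * (vertex a a a k b b b l m w w + vertex a a a k b b b l w m w
      + vertex a a a k b b b l w w m)
    - 3 * (vertex a a a k m w w m b b b + vertex a a a k w m w m b b b
      + vertex a a a k w w m m b b b)
    + 3 * (vertex m w w m a a a k b b b + vertex w m w m a a a k b b b
      + vertex w w m m a a a k b b b)

theorem dot_smul_add_left (r s : A) (x x' y : Fin 3 → A) :
    dot (r • x + s • x') y = r * dot x y + s * dot x' y := by
  simp only [dot, Pi.add_apply, Pi.smul_apply, smul_eq_mul]; ring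

theorem det_smul_add_left (r s : A) (x x' y z : Fin 3 → A) :
    det (r • x + s • x') y z = r * det x y z + s * det x' y z := by
  simp only [det, Pi.add_apply, Pi.smul_apply, smul_eq_mul]; ring

-- `a, b` stand for the fields with momenta `k, l`, and `w` for the traceless ghost with momentum
-- `-k - l`. The part antisymmetric under exchange of the two fields vanishes; each four of the
-- vectors `a, b, k, l, w`, paired with each of the five, supply the Schouten identities needed.
set_option maxHeartbeats 20000000 in
set_option maxRecDepth 100000 in
theorem vertexSym_sub_swap {w : Fin 3 → A} (hw : dot w w = 0) (a k b l : Fin 3 → A) :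
    vertexSym a k b l w (-k - l) - vertexSym b l a k w (-k - l) = 0 := by
  have sch_abkl_a := schouten a b k l a
  have sch_abkl_b := schouten a b k l b
  have sch_abkl_k := schouten a b k l k
  have sch_abkl_l := schouten a b k l l
  have sch_abkl_w := schouten a b k l w
  have sch_abkw_a := schouten a b k w a
  have sch_abkw_b := schouten a b k w b
  have sch_abkw_k := schouten a b k w k
  have sch_abkw_l := schouten a b k w l
  have sch_abkw_w := schouten a b k w w
  have sch_ablw_a := schouten a b l w a
  have sch_ablw_b := schouten a b l w b
  have sch_ablw_k := schouten a b l w k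
  have sch_ablw_l := schouten a b l w l
  have sch_ablw_w := schouten a b l w w
  have sch_aklw_a := schouten a k l w a
  have sch_aklw_b := schouten a k l w b
  have sch_aklw_k := schouten a k l w k
  have sch_aklw_l := schouten a k l w l
  have sch_aklw_w := schouten a k l w w
  have sch_bklw_a := schouten b k l w a
  have sch_bklw_b := schouten b k l w b
  have sch_bklw_k := schouten b k l w k
  have sch_bklw_l := schouten b k l w l
  have sch_bklw_w := schouten b k l w w
  simp only [vertexSym, leftSym, rightSym, eomSym, eomTrSym, fronsdalSym, fronsdalTrSym, vertex,
    vertexAC, vertexA, vertexAB, dot_smul_add_left, det_smul_add_left,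
    dot_neg_sub_right, dot_neg_sub_left, det_neg_sub_left, det_neg_sub_middle, det_neg_sub_right,
    det_self_left, det_self_right, det_self_outer]
  simp only [hw,
    dot_comm b a, dot_comm k a, dot_comm l a, dot_comm w a, dot_comm k b, dot_comm l b,
    dot_comm w b, dot_comm l k, dot_comm w k, dot_comm w l, det_swap_left a b k,
    det_swap_right a b k, det_rotate a b k, det_rotate' a b k, det_reverse a b k,
    det_swap_left a b l, det_swap_right a b l, det_rotate a b l, det_rotate' a b l,
    det_reverse a b l, det_swap_left a b w, det_swap_right a b w, det_rotate a b w,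
    det_rotate' a b w, det_reverse a b w, det_swap_left a k l, det_swap_right a k l,
    det_rotate a k l, det_rotate' a k l, det_reverse a k l, det_swap_left a k w,
    det_swap_right a k w, det_rotate a k w, det_rotate' a k w, det_reverse a k w,
    det_swap_left a l w, det_swap_right a l w, det_rotate a l w, det_rotate' a l w,
    det_reverse a l w, det_swap_left b k l, det_swap_right b k l, det_rotate b k l,
    det_rotate' b k l, det_reverse b k l, det_swap_left b k w, det_swap_right b k w,
    det_rotate b k w, det_rotate' b k w, det_reverse b k w, det_swap_left b l w,
    det_swap_right b l w, det_rotate b l w, det_rotate' b l w, det_reverse b l w,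
    det_swap_left k l w, det_swap_right k l w, det_rotate k l w, det_rotate' k l w,
    det_reverse k l w] at sch_abkl_a sch_abkl_b sch_abkl_k sch_abkl_l sch_abkl_w sch_abkw_a sch_abkw_b sch_abkw_k sch_abkw_l sch_abkw_w sch_ablw_a sch_ablw_b sch_ablw_k sch_ablw_l sch_ablw_w sch_aklw_a sch_aklw_b sch_aklw_k sch_aklw_l sch_aklw_w sch_bklw_a sch_bklw_b sch_bklw_k sch_bklw_l sch_bklw_w ⊢
  linear_combination
    ((6) * (dot a w * dot b k * dot b w) + (6) * (dot a l * dot b w * dot b w) - (24) * (dot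
    a w * dot b l * dot b w) - (60) * (dot a w * dot b b * dot l w) - (36) * (dot a w * dot
    b b * dot k w) + (12) * (dot a k * dot b w * dot b w) - (48) * (dot a b * dot b w * dot
    l w) - (42) * (dot a b * dot b w * dot k w)) * sch_abkl_a + ((-12) * (dot a w * dot a w
    * dot b l) + (48) * (dot a b * dot a w * dot l w) + (78) * (dot a b * dot a w * dot k w)
    + (12) * (dot a a * dot b w * dot k w) + (90) * (dot a a * dot b w * dot l w)) *
    sch_abkl_b + ((24) * (dot a b * dot a w * dot b w)) * sch_abkl_k + ((-36) * (dot a w *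
    dot a w * dot b b) + (24) * (dot a b * dot a w * dot b w)) * sch_abkl_l + ((-48) * (dot
    a l * dot a w * dot b b) - (24) * (dot a k * dot a w * dot b b) + (60) * (dot a b * dot
    a w * dot b l) + (6) * (dot a b * dot a w * dot b k) - (6) * (dot a b * dot a b * dot k
    w) + (12) * (dot a b * dot a b * dot l w) + (24) * (dot a a * dot b l * dot b w) - (48)
    * (dot a a * dot b k * dot b w) + (6) * (dot a a * dot b b * dot l w)) * sch_abkl_w +
    ((-18) * (dot a w * dot b k * dot b l) - (6) * (dot a w * dot b k * dot b k) + (36) *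
    (dot a w * dot b b * dot l l) + (12) * (dot a l * dot b l * dot b w) + (24) * (dot a l *
    dot b b * dot k w) + (36) * (dot a l * dot b b * dot l w) - (36) * (dot a k * dot b l *
    dot b w) - (6) * (dot a k * dot b k * dot b w) + (12) * (dot a k * dot b b * dot k w) +
    (36) * (dot a k * dot b b * dot l w) + (18) * (dot a b * dot b w * dot k k) - (42) *
    (dot a b * dot b l * dot k w) - (12) * (dot a b * dot b w * dot l l) - (6) * (dot a b *
    dot b k * dot k w) + (36) * (dot a b * dot b w * dot k l) - (36) * (dot a b * dot b l *
    dot l w)) * sch_abkw_a + ((-6) * (dot a l * dot a w * dot b k) + (24) * (dot a k * dot a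
    w * dot b l) + (6) * (dot a k * dot a w * dot b k) + (6) * (dot a k * dot a k * dot b w)
    - (36) * (dot a b * dot a w * dot k l) - (6) * (dot a b * dot a w * dot k k) + (6) *
    (dot a b * dot a l * dot k w) - (30) * (dot a b * dot a k * dot k w) - (72) * (dot a b *
    dot a k * dot l w) - (24) * (dot a a * dot b w * dot l l) - (48) * (dot a a * dot b w *
    dot k l) - (24) * (dot a a * dot b w * dot k k) + (24) * (dot a a * dot b k * dot k w) +
    (96) * (dot a a * dot b k * dot l w) + (12) * (dot a a * dot b l * dot k w) - (54) *
    (dot a a * dot b l * dot l w)) * sch_abkw_b + ((24) * (dot a l * dot a w * dot b b) -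
    (24) * (dot a b * dot a w * dot b l) + (6) * (dot a b * dot a w * dot b k) - (18) * (dot
    a b * dot a k * dot b w) + (24) * (dot a b * dot a b * dot l w) + (12) * (dot a b * dot
    a b * dot k w) - (12) * (dot a b * dot a l * dot b w) + (36) * (dot a a * dot b l * dot
    b w) + (24) * (dot a a * dot b k * dot b w) - (30) * (dot a a * dot b b * dot l w) -
    (18) * (dot a a * dot b b * dot k w)) * sch_abkw_k + ((84) * (dot a l * dot a w * dot b
    b) - (60) * (dot a b * dot a w * dot b l) - (6) * (dot a b * dot a w * dot b k) + (24) *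
    (dot a b * dot a k * dot b w) - (6) * (dot a b * dot a b * dot l w) - (30) * (dot a a *
    dot b b * dot l w) - (12) * (dot a a * dot b b * dot k w)) * sch_abkw_l + ((-24) * (dot
    a k * dot a l * dot b b) - (12) * (dot a k * dot a k * dot b b) + (12) * (dot a b * dot
    a k * dot b l) + (36) * (dot a b * dot a k * dot b k) - (30) * (dot a b * dot a b * dot
    l l) - (12) * (dot a b * dot a b * dot k k) + (60) * (dot a a * dot b k * dot b l) -
    (24) * (dot a a * dot b k * dot b k) + (36) * (dot a a * dot b b * dot k l) + (18) *
    (dot a a * dot b b * dot k k)) * sch_abkw_w + ((6) * (dot a w * dot b l * dot b l) + (6)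
    * (dot a w * dot b k * dot b k) - (24) * (dot a w * dot b b * dot l l) - (24) * (dot a w
    * dot b b * dot k k) + (6) * (dot a l * dot b l * dot b w) + (24) * (dot a l * dot b b *
    dot l w) - (84) * (dot a w * dot b b * dot k l) - (6) * (dot a b * dot b w * dot l l) -
    (30) * (dot a b * dot b l * dot l w) - (6) * (dot a b * dot b k * dot k w) + (12) * (dot
    a b * dot b w * dot k k)) * sch_ablw_a + ((-6) * (dot a l * dot a w * dot b l) - (6) *
    (dot a l * dot a l * dot b w) - (36) * (dot a k * dot a w * dot b l) - (6) * (dot a k *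
    dot a w * dot b k) - (12) * (dot a k * dot a l * dot b w) + (48) * (dot a b * dot a w *
    dot k l) + (18) * (dot a b * dot a w * dot l l) + (24) * (dot a b * dot a w * dot k k) -
    (6) * (dot a b * dot a l * dot l w) - (48) * (dot a b * dot a k * dot l w) + (30) * (dot
    a b * dot a k * dot k w) + (12) * (dot a a * dot b l * dot l w) + (36) * (dot a a * dot
    b l * dot k w) + (78) * (dot a a * dot b k * dot l w) - (72) * (dot a a * dot b k * dot
    k w)) * sch_ablw_b + ((12) * (dot a b * dot a w * dot b l) + (42) * (dot a b * dot a w *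
    dot b k) - (60) * (dot a b * dot a k * dot b w) + (48) * (dot a a * dot b k * dot b w) -
    (24) * (dot a a * dot b b * dot k w)) * sch_ablw_k + ((24) * (dot a l * dot a w * dot b
    b) - (18) * (dot a b * dot a w * dot b l) + (6) * (dot a b * dot a l * dot b w) + (12) *
    (dot a b * dot a k * dot b w) + (12) * (dot a b * dot a b * dot l w) + (30) * (dot a b *
    dot a b * dot k w) + (24) * (dot a a * dot b k * dot b w) - (18) * (dot a a * dot b b *
    dot l w) - (36) * (dot a a * dot b b * dot k w)) * sch_ablw_l + ((-24) * (dot a l * dot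
    a l * dot b b) - (36) * (dot a k * dot a l * dot b b) + (36) * (dot a b * dot a l * dot
    b l) + (84) * (dot a b * dot a k * dot b l) + (72) * (dot a b * dot a k * dot b k) -
    (12) * (dot a b * dot a b * dot l l) - (24) * (dot a b * dot a b * dot k k) + (6) * (dot
    a b * dot a b * dot k l) - (12) * (dot a a * dot b l * dot b l) - (24) * (dot a a * dot
    b k * dot b l) + (18) * (dot a a * dot b b * dot l l) + (30) * (dot a a * dot b b * dot
    k l) - (6) * (dot a a * dot b b * dot k k) - (96) * (dot a a * dot b k * dot b k)) *
    sch_ablw_w + ((24) * (dot a w * dot b b * dot b l) - (18) * (dot a w * dot b b * dot b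
    k) + (36) * (dot a l * dot b b * dot b w) - (42) * (dot a k * dot b b * dot b w) + (12)
    * (dot a b * dot b k * dot b w) - (72) * (dot a b * dot b l * dot b w) + (6) * (dot a b
    * dot b b * dot l w) - (48) * (dot a b * dot b b * dot k w)) * sch_aklw_a + ((24) * (dot
    a k * dot a w * dot b b) - (48) * (dot a b * dot a w * dot b k) - (12) * (dot a b * dot
    a l * dot b w) - (12) * (dot a b * dot a k * dot b w) + (6) * (dot a b * dot a b * dot l
    w) + (48) * (dot a a * dot b k * dot b w) - (66) * (dot a a * dot b b * dot l w)) *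
    sch_aklw_b + ((12) * (dot a b * dot a b * dot b w) + (42) * (dot a a * dot b b * dot b
    w)) * sch_aklw_k + ((6) * (dot a b * dot a w * dot b b) - (24) * (dot a a * dot b b *
    dot b w)) * sch_aklw_l + ((96) * (dot a b * dot a l * dot b b) + (6) * (dot a b * dot a
    k * dot b b) - (78) * (dot a b * dot a b * dot b l) + (6) * (dot a b * dot a b * dot b
    k) + (102) * (dot a a * dot b b * dot b k)) * sch_aklw_w + ((-84) * (dot a l * dot a w *
    dot b b) + (48) * (dot a b * dot a w * dot b l) - (6) * (dot a b * dot a b * dot l w)) *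
    sch_bklw_a + ((24) * (dot a b * dot a l * dot a w) + (12) * (dot a b * dot a k * dot a
    w) - (42) * (dot a a * dot a w * dot b l) - (12) * (dot a a * dot a l * dot b w) - (12)
    * (dot a a * dot a k * dot b w) - (12) * (dot a a * dot a b * dot k w) - (54) * (dot a a
    * dot a w * dot b k)) * sch_bklw_b + ((42) * (dot a b * dot a b * dot a w) - (30) * (dot
    a a * dot a w * dot b b) - (18) * (dot a a * dot a b * dot b w)) * sch_bklw_k + ((30) *
    (dot a b * dot a b * dot a w) + (36) * (dot a a * dot a b * dot b w)) * sch_bklw_l +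
    ((12) * (dot a b * dot a b * dot a l) - (6) * (dot a a * dot a k * dot b b) + (78) *
    (dot a a * dot a b * dot b l)) * sch_bklw_w

end Identities


/-! ### Derivatives and images of symbols -/

section Symbols

variable {A B : Type} [CommRing A] [CommRing B]

theorem map_dot (φ : A →+* B) (x y : Fin 3 → A) : φ (dot x y) = dot (φ ∘ x) (φ ∘ y) := by
  simp [dot]

theorem map_det (φ : A →+* B) (x y z : Fin 3 → A) :
    φ (det x y z) = det (φ ∘ x) (φ ∘ y) (φ ∘ z) := by
  simp [det]

theorem comp_smul_vector (φ : A →+* B) (r : A) (x : Fin 3 → A) :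
    φ ∘ (r • x) = φ r • (φ ∘ x) := by
  funext i; simp

theorem comp_add_vector (φ : A →+* B) (x y : Fin 3 → A) : φ ∘ (x + y) = φ ∘ x + φ ∘ y := by
  funext i; simp

theorem dot_zero_left (x : Fin 3 → A) : dot 0 x = 0 := by simp [dot]

theorem dot_zero_right (x : Fin 3 → A) : dot x 0 = 0 := by simp [dot]

theorem det_zero_left (x y : Fin 3 → A) : det 0 x y = 0 := by simp [det]

theorem det_zero_middle (x y : Fin 3 → A) : det x 0 y = 0 := by simp [det]

theorem det_zero_right (x y : Fin 3 → A) : det x y 0 = 0 := by simp [det]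

variable [Algebra ℝ A]

theorem deriv_dot (D : Derivation ℝ A A) (x y : Fin 3 → A) :
    D (dot x y) = dot (D ∘ x) y + dot x (D ∘ y) := by
  simp only [dot, map_add, map_neg, Derivation.leibniz, smul_eq_mul, Function.comp]
  ring

theorem deriv_det (D : Derivation ℝ A A) (x y z : Fin 3 → A) :
    D (det x y z) = det (D ∘ x) y z + det x (D ∘ y) z + det x y (D ∘ z) := by
  simp only [det, map_add, map_sub, Derivation.leibniz, smul_eq_mul, Function.comp]
  ring

theorem deriv_ofNat (D : Derivation ℝ A A) (n : ℕ) [n.AtLeastTwo] :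
    D ofNat(n) = 0 := by
  rw [← Nat.cast_ofNat, D.map_natCast]

/-- The symbols are kept with separate arguments in the cubic slots, so that a derivation acting on
the diagonal gives the three polarized terms; in this form the result of `γ` enters the vector
identities. -/
theorem deriv_leftSym (D : Derivation ℝ A A) {u v k w : Fin 3 → A} (hu : D ∘ u = 0)
    (hk : D ∘ k = 0) (hw : D ∘ w = 0) :
    D (leftSym (fun x y z => dot u x * dot u y * dot u z) (dot u u • u) v v v k w) =
      leftSym (fun x y z => dot u x * dot u y * dot u z) (dot u u • u) (D ∘ v) v v k w
      + leftSym (fun x y z => dot u x * dot u y * dot u z) (dot u u • u) v (D ∘ v) v k w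
      + leftSym (fun x y z => dot u x * dot u y * dot u z) (dot u u • u) v v (D ∘ v) k w := by
  simp only [leftSym, dot_smul_left, map_add, map_sub, Derivation.leibniz, smul_eq_mul, deriv_dot,
    deriv_det, deriv_ofNat, hu, hk, hw, dot_zero_left, dot_zero_right, det_zero_middle,
    det_zero_right]
  ring

theorem deriv_rightSym (D : Derivation ℝ A A) {u v k w l : Fin 3 → A} (hu : D ∘ u = 0)
    (hv : D ∘ v = 0) (hk : D ∘ k = 0) (hl : D ∘ l = 0) :
    D (rightSym (fun x y z => dot u x * dot u y * dot u z) (dot u u • u) v k w w w l) =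
      rightSym (fun x y z => dot u x * dot u y * dot u z) (dot u u • u) v k (D ∘ w) w w l
      + rightSym (fun x y z => dot u x * dot u y * dot u z) (dot u u • u) v k w (D ∘ w) w l
      + rightSym (fun x y z => dot u x * dot u y * dot u z) (dot u u • u) v k w w (D ∘ w) l := by
  simp only [rightSym, dot_smul_left, det_smul_left, map_add, map_sub, map_neg,
    Derivation.leibniz, smul_eq_mul, deriv_dot, neg_mul,
    deriv_det, deriv_ofNat, hu, hv, hk, hl, dot_zero_left, dot_zero_right, det_zero_left,
    det_zero_middle, det_zero_right]
  ring

theorem deriv_vertex_left (D : Derivation ℝ A A) {a k b l c : Fin 3 → A}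
    (hk : D ∘ k = 0) (hb : D ∘ b = 0) (hl : D ∘ l = 0) (hc : D ∘ c = 0) :
    D (vertex a a a k b b b l c c c) = vertex (D ∘ a) a a k b b b l c c c
      + vertex a (D ∘ a) a k b b b l c c c + vertex a a (D ∘ a) k b b b l c c c := by
  simp only [vertex, vertexAC, vertexA, vertexAB, map_add, map_sub, map_neg, Derivation.leibniz,
    smul_eq_mul, deriv_dot, deriv_det, deriv_ofNat, hk, hb, hl, hc, dot_zero_left,
    dot_zero_right, det_zero_left, det_zero_middle, det_zero_right]
  ring

theorem deriv_vertex_middle (D : Derivation ℝ A A) {a k b l c : Fin 3 → A}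
    (ha : D ∘ a = 0) (hk : D ∘ k = 0) (hl : D ∘ l = 0) (hc : D ∘ c = 0) :
    D (vertex a a a k b b b l c c c) = vertex a a a k (D ∘ b) b b l c c c
      + vertex a a a k b (D ∘ b) b l c c c + vertex a a a k b b (D ∘ b) l c c c := by
  simp only [vertex, vertexAC, vertexA, vertexAB, map_add, map_sub, map_neg, Derivation.leibniz,
    smul_eq_mul, deriv_dot, deriv_det, deriv_ofNat, ha, hk, hl, hc, dot_zero_left,
    dot_zero_right, det_zero_left, det_zero_middle, det_zero_right]
  ring

theorem deriv_vertex_right (D : Derivation ℝ A A) {a k b l c : Fin 3 → A}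
    (ha : D ∘ a = 0) (hk : D ∘ k = 0) (hb : D ∘ b = 0) (hl : D ∘ l = 0) :
    D (vertex a a a k b b b l c c c) = vertex a a a k b b b l (D ∘ c) c c
      + vertex a a a k b b b l c (D ∘ c) c + vertex a a a k b b b l c c (D ∘ c) := by
  simp only [vertex, vertexAC, vertexA, vertexAB, map_add, map_sub, map_neg, Derivation.leibniz,
    smul_eq_mul, deriv_dot, deriv_det, deriv_ofNat, ha, hk, hb, hl, dot_zero_left,
    dot_zero_right, det_zero_left, det_zero_middle, det_zero_right]
  ring

/-! ### Symbols in integral form -/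

/-- Clearing denominators gives a symbol with integer coefficients, which ring homomorphisms such as
slot permutations and the quotient by `divIdeal` preserve. -/
theorem six_smul_liftPolyLeft (g : Fin 3 → Fin 3 → Fin 3 → TriPoly) :
    (6 : ℝ) • liftPolyLeft g =
      leftSym (contr3 g) (lower (tr3 g)) (tv 1) (tv 1) (tv 1) (mv 2) (tv 2) := by
  rw [liftPolyLeft, leftSym, ← mul_smul_comm, contrTraceless, smul_sub, smul_smul]
  norm_num only
  simp only [ofNat_smul_eq_nsmul, nsmul_eq_mul]
  norm_cast

theorem six_smul_liftPolyRight (g : Fin 3 → Fin 3 → Fin 3 → TriPoly) :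
    (6 : ℝ) • liftPolyRight g =
      rightSym (contr3 g) (lower (tr3 g)) (tv 1) (mv 1) (tv 2) (tv 2) (tv 2) (mv 2) := by
  have e : ∀ x : TriPoly, (6 : ℝ) • (-3 / 2 : ℝ) • x = (-3 : ℝ) • (3 : ℝ) • x := fun x => by
    rw [smul_smul, smul_smul]; norm_num
  rw [liftPolyRight, rightSym, smul_add, smul_add, e, ← mul_smul_comm (3 : ℝ), contrTraceless,
    smul_sub, smul_smul, smul_smul, smul_smul, neg_div, mul_neg, neg_smul, neg_smul]
  norm_num only
  simp only [ofNat_smul_eq_nsmul, nsmul_eq_mul, one_smul]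
  push_cast
  ring

end Symbols


/-! ### Total divergences -/

/-- The total divergences. -/
def divergences (N : ℕ) : Submodule ℝ (Loc N) :=
  ⨆ μ, LinearMap.range (totalDeriv N μ)

theorem totalDeriv_mem_divergences (μ : Fin 3) (z : Loc N) :
    totalDeriv N μ z ∈ divergences N :=
  Submodule.mem_iSup_of_mem μ ⟨z, rfl⟩

theorem exists_totalDiv {z : Loc N} (hz : z ∈ divergences N) : ∃ b, z + totalDiv b = 0 := by
  refine Submodule.iSup_induction _ (motive := fun z => ∃ b, z + totalDiv b = 0) hz ?_ ?_ ?_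
  · rintro μ _ ⟨y, rfl⟩
    refine ⟨Pi.single μ (-y), ?_⟩
    rw [totalDiv, Finset.sum_eq_single μ]
    · simp
    · intro ν _ h
      rw [Pi.single_eq_of_ne h, map_zero]
    · simp
  · exact ⟨0, by simp [totalDiv]⟩
  · rintro x y ⟨b, hb⟩ ⟨c, hc⟩
    refine ⟨b + c, ?_⟩
    have : totalDiv (b + c) = totalDiv b + totalDiv c := by
      simp [totalDiv, Finset.sum_add_distrib]
    rw [this, add_add_add_comm, hb, hc, add_zero]

/-- The ideal generated by the total momentum and the traces `dot (tv s) (tv s)`, `s ∈ S`. -/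
def divIdeal (S : Set (Fin 3)) : Ideal TriPoly :=
  Ideal.span (Set.range totalMom ∪ (fun s => dot (tv s) (tv s)) '' S)

/-- Multiples of the total momentum are mapped to total derivatives and multiples of the traces to
zero. -/
theorem mem_divergences_of_mem_divIdeal {U : TriPoly →ₗ[ℝ] Loc N} {S : Set (Fin 3)}
    (hm : ∀ μ p, U (totalMom μ * p) ∈ divergences N)
    (ht : ∀ s ∈ S, ∀ p, U (dot (tv s) (tv s) * p) = 0) {p : TriPoly} (hp : p ∈ divIdeal S) :
    U p ∈ divergences N := by
  -- `U` is only linear, so the claim is strengthened to all multiples of `p` in order to pass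
  -- through the ideal span.
  suffices h : ∀ q, U (p * q) ∈ divergences N by simpa using h 1
  refine Submodule.span_induction (p := fun p _ => ∀ q, U (p * q) ∈ divergences N) ?_ ?_ ?_ ?_ hp
  · rintro _ (⟨μ, rfl⟩ | ⟨s, hs, rfl⟩) q
    · exact hm μ q
    · rw [ht s hs]; exact Submodule.zero_mem _
  · intro q; simp
  · intro x y _ _ hx hy q
    rw [add_mul, map_add]
    exact Submodule.add_mem _ (hx q) (hy q)
  · intro r x _ hx q
    rw [smul_eq_mul, mul_comm r, mul_assoc]
    exact hx _

/-- Working modulo divergences is momentum conservation: one momentum is eliminated in favour of the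
other two. -/
theorem mv_zero_quotient (S : Set (Fin 3)) :
    Ideal.Quotient.mk (divIdeal S) ∘ mv 0 =
      -(Ideal.Quotient.mk (divIdeal S) ∘ mv 1) - Ideal.Quotient.mk (divIdeal S) ∘ mv 2 := by
  funext μ
  have : Ideal.Quotient.mk (divIdeal S) (totalMom μ) = 0 :=
    Ideal.Quotient.eq_zero_iff_mem.2 (Ideal.subset_span (Or.inl ⟨μ, rfl⟩))
  simp only [totalMom, map_add] at this
  simp only [Function.comp, Pi.sub_apply, Pi.neg_apply]
  linear_combination this

theorem dot_tv_quotient {S : Set (Fin 3)} {s : Fin 3} (hs : s ∈ S) :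
    dot (Ideal.Quotient.mk (divIdeal S) ∘ tv s) (Ideal.Quotient.mk (divIdeal S) ∘ tv s) = 0 := by
  rw [← map_dot]
  exact Ideal.Quotient.eq_zero_iff_mem.2 (Ideal.subset_span (Or.inr ⟨s, hs, rfl⟩))

theorem hU_leib {X : Loc N →ₗ[ℝ] Loc N} {d : ℕ} (hX : IsDer d X) (a : Fin N) (s α) :
    LeibAt X 1 (hU a s α) :=
  slot3_induction (LeibAt.zero _ _) (fun _ _ _ _ => hX.leib_h _ _ _ _ _) s α

theorem hsU_leib {X : Loc N →ₗ[ℝ] Loc N} {d : ℕ} (hX : IsDer d X) (a : Fin N) (s α) :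
    LeibAt X ((-1) ^ d) (hsU a s α) :=
  slot3_induction (LeibAt.zero _ _) (fun _ _ _ _ => hX.leib_hs _ _ _ _ _) s α

theorem CU_leib {X : Loc N →ₗ[ℝ] Loc N} {d : ℕ} (hX : IsDer d X) (a : Fin N) (s α) :
    LeibAt X ((-1) ^ d) (CU a s α) :=
  slot2_induction (LeibAt.zero _ _) (fun _ _ _ => hX.leib_C _ _ _ _) s α

theorem totalMom_mem_divergences {f : Fin N → Fin N → Fin N → ℝ} {X Y Z : Fin N → Slot N}
    (hX : ∀ a, (X a).Shift) (hY : ∀ a, (Y a).Shift) (hZ : ∀ a, (Z a).Shift)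
    (eX : ∀ a μ s α, LeibAt (totalDeriv N μ) 1 (X a s α))
    (eY : ∀ a μ s α, LeibAt (totalDeriv N μ) 1 (Y a s α)) (μ : Fin 3) (p : TriPoly) :
    umbSum f X Y Z (totalMom μ * p) ∈ divergences N := by
  have : umbSum f X Y Z (totalMom μ * p) = totalDeriv N μ (umbSum f X Y Z p) := by
    simp only [umbSum_apply, map_sum, map_smul]
    simp only [totalDeriv_umb (hX _) (hY _) (hZ _) (eX _) (eY _)]
  rw [this]
  exact totalDeriv_mem_divergences _ _

theorem zero_umb_left (Y Z : Slot N) : umb 0 Y Z = 0 :=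
  LinearMap.ext fun p => poly_linear_ext (fun m => by simp [umb_monomial]) p

theorem zero_umb_middle (X Z : Slot N) : umb X 0 Z = 0 :=
  LinearMap.ext fun p => poly_linear_ext (fun m => by simp [umb_monomial]) p

theorem zero_umb_right (X Y : Slot N) : umb X Y 0 = 0 :=
  LinearMap.ext fun p => poly_linear_ext (fun m => by simp [umb_monomial]) p

/-! ### The lift of `a₂` -/

/-- The symbol of an antifield with lowered indices. -/
def lu : Fin 3 → TriPoly := lower (tv 0)

theorem contr3_tv : contr3 (fun x y z => tv 0 x * tv 0 y * tv 0 z) =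
    fun x y z => dot lu x * dot lu y * dot lu z := by
  funext x y z
  simp [contr3, Fin.sum_univ_three, dot, lu, lower, η]
  ring

theorem lower_tr3_tv : lower (tr3 fun x y z => tv 0 x * tv 0 y * tv 0 z) = dot lu lu • lu := by
  funext μ
  simp only [lower, tr3, lu, sum_eta_smul, Pi.smul_apply, smul_eq_mul, mul_smul_comm]
  congr 1
  simp [dot, lower, η]
  ring

theorem dot_lu_lu : dot lu lu = dot (tv 0) (tv 0) := by
  simp [dot, lu, lower, η]

theorem grad_comp_tv_self (s : Fin 3) : grad s ∘ tv s = mv s := by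
  funext i; simp

theorem grad_comp_tv {s t : Fin 3} (h : t ≠ s) : grad s ∘ tv t = 0 := by
  funext i; simp [grad_tv_of_ne h]

theorem grad_comp_mv (s t : Fin 3) : grad s ∘ mv t = 0 := by
  funext i; simp

theorem grad_comp_lu {s : Fin 3} (h : 0 ≠ s) : grad s ∘ lu = 0 := by
  funext i; simp [lu, lower, grad_tv_of_ne h]

/-- Only the field slot is not closed under `γ`; the sign comes from passing the odd antifield in
front of it. -/
theorem gamma_umbSum_left (f : Fin N → Fin N → Fin N → ℝ) (p : TriPoly) :
    γ N (umbSum f hsU hU CU p) = -umbSum f hsU CU CU (grad 1 p) := by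
  simp only [umbSum_apply, map_sum, map_smul,
    gamma_umb (hsU_gamma _) (hU_gamma _) (CU_gamma _) (hsU_leib gamma_isDer _)
      (hU_leib gamma_isDer _), zero_umb_left, zero_umb_right, ← Finset.sum_neg_distrib]
  simp

theorem gamma_umbSum_right (f : Fin N → Fin N → Fin N → ℝ) (p : TriPoly) :
    γ N (umbSum f hsU CU hU p) = umbSum f hsU CU CU (grad 2 p) := by
  simp only [umbSum_apply, map_sum, map_smul,
    gamma_umb (hsU_gamma _) (CU_gamma _) (hU_gamma _) (hsU_leib gamma_isDer _)
      (CU_leib gamma_isDer _), zero_umb_left, zero_umb_middle]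
  simp

theorem gamma_umbSum_vertex (f : Fin N → Fin N → Fin N → ℝ) (p : TriPoly) :
    γ N (umbSum f hU hU hU p) = umbSum f CU hU hU (grad 0 p) + umbSum f hU CU hU (grad 1 p)
      + umbSum f hU hU CU (grad 2 p) := by
  simp only [umbSum_apply, map_sum, map_smul,
    gamma_umb (hU_gamma _) (hU_gamma _) (hU_gamma _) (hU_leib gamma_isDer _)
      (hU_leib gamma_isDer _), ← Finset.sum_add_distrib, ← smul_add]
  simp

/-- The symbol of `6 (γ a₁ + δ a₂)` before integration by parts. -/
def ghostPoly : TriPoly :=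
  ghostSymAux (fun x y z => dot lu x * dot lu y * dot lu z) (dot lu lu • lu) (tv 1) (mv 1)
    (tv 2) (mv 2)
    - 18 * (det (tv 1) (mv 2) (tv 2) * dot lu (mv 0) * dot lu (tv 1) * dot lu (tv 2))
    + 6 * (det (tv 1) (mv 2) (tv 2) * dot lu (mv 0) * dot (tv 1) (tv 2) * dot lu lu)

theorem six_smul_deltaPoly : (6 : ℝ) • deltaPoly =
    -18 * (det (tv 1) (mv 2) (tv 2) * dot lu (mv 0) * dot lu (tv 1) * dot lu (tv 2))
    + 6 * (det (tv 1) (mv 2) (tv 2) * dot lu (mv 0) * dot (tv 1) (tv 2) * dot lu lu) := by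
  rw [deltaPoly, mul_sub, mul_smul_comm, smul_sub, smul_sub, smul_smul, smul_smul, smul_smul,
    dot_lu_lu]
  norm_num only
  simp only [neg_smul, ofNat_smul_eq_nsmul, nsmul_eq_mul, lu]
  push_cast
  ring

theorem gamma_a₁_add_delta_a₂ (f : Fin N → Fin N → Fin N → ℝ) :
    (6 : ℝ) • (γ N (a₁ f) + δ N (a₂ f)) = umbSum f hsU CU CU ghostPoly := by
  rw [a₁_umb, map_add, gamma_umbSum_left, gamma_umbSum_right, delta_a₂_umb, ← map_neg, ← map_add,
    ← map_add, ← map_smul, smul_add, smul_add, smul_neg, ← (grad 1).map_smul, ← (grad 2).map_smul,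
    six_smul_liftPolyLeft, six_smul_liftPolyRight, six_smul_deltaPoly, contr3_tv, lower_tr3_tv,
    deriv_leftSym _ (grad_comp_lu (by decide)) (grad_comp_mv _ _) (grad_comp_tv (by decide)),
    deriv_rightSym _ (grad_comp_lu (by decide)) (grad_comp_tv (by decide)) (grad_comp_mv _ _)
      (grad_comp_mv _ _), grad_comp_tv_self, grad_comp_tv_self, ghostPoly, ghostSymAux]
  congr 1
  ring

theorem map_ghostSymAux {A B : Type} [CommRing A] [CommRing B] (φ : A →+* B)
    (u w k y l : Fin 3 → A) :
    φ (ghostSymAux (fun x y z => dot u x * dot u y * dot u z) (dot u u • u) w k y l) =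
      ghostSymAux (fun x y z => dot (φ ∘ u) x * dot (φ ∘ u) y * dot (φ ∘ u) z)
        (dot (φ ∘ u) (φ ∘ u) • (φ ∘ u)) (φ ∘ w) (φ ∘ k) (φ ∘ y) (φ ∘ l) := by
  simp only [ghostSymAux, leftSym, rightSym, map_add, map_sub, map_neg, map_mul, map_ofNat,
    map_dot, map_det, comp_smul_vector]

theorem map_ghostPoly {B : Type} [CommRing B] (φ : TriPoly →+* B)
    (hφ : φ ∘ mv 0 = -(φ ∘ mv 1) - φ ∘ mv 2) :
    φ ghostPoly = ghostSym (φ ∘ lu) (φ ∘ tv 1) (φ ∘ mv 1) (φ ∘ tv 2) (φ ∘ mv 2) := by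
  simp only [ghostPoly, ghostSym, map_add, map_sub, map_mul, map_ofNat, map_ghostSymAux, map_dot,
    map_det, hφ]

theorem permSlots_comp_tv (σ : Equiv.Perm (Fin 3)) (s : Fin 3) :
    permSlots σ ∘ tv s = tv (σ s) := by
  funext i; simp

theorem permSlots_comp_mv (σ : Equiv.Perm (Fin 3)) (s : Fin 3) :
    permSlots σ ∘ mv s = mv (σ s) := by
  funext i; simp

theorem swap_one_two_zero : Equiv.swap (1 : Fin 3) 2 0 = 0 := by decide

theorem swap_zero_one_two : Equiv.swap (0 : Fin 3) 1 2 = 2 := by decide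

/-- In the quotient by `divIdeal {1, 2}` momentum is conserved and both ghost vectors are null,
which are exactly the hypotheses under which the vector identity `ghostSym_add_swap` is available.
-/
theorem ghostPoly_mem :
    ghostPoly + permSlots (Equiv.swap 1 2) ghostPoly ∈ divIdeal {1, 2} := by
  rw [← Ideal.Quotient.eq_zero_iff_mem, map_add]
  set q := Ideal.Quotient.mk (divIdeal {1, 2}) with hq
  set σ := permSlots (Equiv.swap 1 2) with hσ
  have hm : q ∘ mv 0 = -(q ∘ mv 1) - q ∘ mv 2 := mv_zero_quotient _
  have t0 : σ ∘ lu = lu := by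
    funext i
    simp only [lu, lower, Function.comp, map_smul, hσ, permSlots_tv, swap_one_two_zero]
  have e : ∀ x : Fin 3 → TriPoly, (q.comp (σ : TriPoly →+* TriPoly)) ∘ x = q ∘ (σ ∘ x) :=
    fun x => rfl
  have h1 := map_ghostPoly q hm
  have h2 := map_ghostPoly (q.comp (σ : TriPoly →+* TriPoly)) (by
    simp only [e]
    simp only [hσ, permSlots_comp_mv, Equiv.swap_apply_left, Equiv.swap_apply_right,
      swap_one_two_zero, hm]
    abel)
  simp only [e, t0] at h2
  simp only [hσ, permSlots_comp_mv, permSlots_comp_tv, Equiv.swap_apply_left,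
    Equiv.swap_apply_right] at h2
  rw [h1]
  refine (congrArg _ h2).trans ?_
  exact ghostSym_add_swap (dot_tv_quotient (by simp)) (dot_tv_quotient (by simp)) _ _ _

theorem gamma_a₁_mem_divergences {f : Fin N → Fin N → Fin N → ℝ}
    (hf : ∀ a b c, f a b c = -f a c b) : γ N (a₁ f) + δ N (a₂ f) ∈ divergences N := by
  have h1 := gamma_a₁_add_delta_a₂ f
  -- The structure constants are antisymmetric in these slots and the ghosts anticommute, so the
  -- exchange is free of signs.
  have h2 : umbSum f hsU CU CU ghostPoly =
      umbSum f hsU CU CU (permSlots (Equiv.swap 1 2) ghostPoly) := by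
    have := umbSum_swap_right hf CU_comm hsU ghostPoly
    simpa using this
  have h3 : umbSum f hsU CU CU (ghostPoly + permSlots (Equiv.swap 1 2) ghostPoly) ∈
      divergences N := by
    refine mem_divergences_of_mem_divIdeal (totalMom_mem_divergences hsU_shift CU_shift CU_shift
      (fun a μ => by simpa using hsU_leib (totalDeriv_isDer μ) a)
      (fun a μ => by simpa using CU_leib (totalDeriv_isDer μ) a)) ?_ ghostPoly_mem
    rintro s (rfl | rfl) p
    · simp [umbSum_apply, umb_traceless_middle (CU_traceless _)]
    · simp [umbSum_apply, umb_traceless_right (CU_traceless _)]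
  -- The symmetrized symbol represents the original expression twice; the scalar `6 + 6` is then
  -- removed.
  rw [map_add, ← h2, ← h1, ← add_smul] at h3
  exact (Submodule.smul_mem_iff _ (by norm_num)).1 h3


/-! ### The lift of `a₁` -/

section FieldEquations

variable {A : Type} [CommRing A] [Algebra ℝ A]

theorem two_smul_gPoly (u k : Fin 3 → A) (x y z : Fin 3) :
    (2 : ℝ) • gPoly u k x y z = 2 * fronsdalPoly u k x y z - (metric x y • fronsdalTrPoly u k z
    + metric y z • fronsdalTrPoly u k x + metric x z • fronsdalTrPoly u k y) := by
  rw [gPoly, smul_sub, smul_smul]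
  norm_num only
  rw [one_smul, ofNat_smul_eq_nsmul, nsmul_eq_mul, Nat.cast_ofNat]

theorem two_smul_contr3_gPoly (u k : Fin 3 → A) :
    (2 : ℝ) • contr3 (fun x y z => (η x * η y * η z) • gPoly u k x y z) = eomSym u k := by
  funext x y z
  simp only [Pi.smul_apply, contr3, Finset.smul_sum, ← smul_mul_assoc, smul_comm (2 : ℝ),
    two_smul_gPoly]
  have h1 : ∑ α, ∑ β, ∑ l, (η α * η β * η l) • fronsdalPoly u k α β l * (x α * y β * z l) =
      fronsdalSym u k x y z := by
    unfold fronsdalPoly fronsdalSym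
    rw [dot_comm k x, dot_comm k y, dot_comm k z, dot_comm u x, dot_comm u y, dot_comm u z]
    generalize dot k k = P
    generalize dot u k = Q
    generalize dot u u = U
    simp only [Fin.sum_univ_three, η, dot]
    simp
    ring
  have h2 : ∀ t : Fin 3 → A, ∑ α, ∑ β, ∑ l, (η α * η β * η l) •
      (metric α β • t l + metric β l • t α + metric α l • t β) * (x α * y β * z l) =
      dot x y * dot t z + dot y z * dot t x + dot x z * dot t y := by
    intro t
    simp only [Fin.sum_univ_three, η, dot, metric]
    simp
    ring
  have h3 : ∀ x, dot (fronsdalTrPoly u k) x = fronsdalTrSym u k x := fun x => by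
    simp only [fronsdalTrSym, dot, fronsdalTrPoly]; ring
  simp only [smul_sub, sub_mul, Finset.sum_sub_distrib, h2, h3, eomSym, mul_comm (2 : A),
    ← smul_mul_assoc, ← h1, Finset.sum_mul]
  congr 1
  refine Finset.sum_congr rfl fun α _ => Finset.sum_congr rfl fun β _ =>
    Finset.sum_congr rfl fun l _ => ?_
  ring

/-- In dimension three the trace of `η_{μν} F_ρ + η_{νρ} F_μ + η_{μρ} F_ν` is `5 F_μ`, so the trace
of the field equations is `F_μ - 5/2 F_μ = -3/2 F_μ`; doubling gives the factor `-3`. -/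
theorem two_smul_lower_tr3_gPoly (u k : Fin 3 → A) :
    (2 : ℝ) • lower (tr3 (fun x y z => (η x * η y * η z) • gPoly u k x y z)) = eomTrSym u k := by
  funext μ
  have hη : ∀ i, η i * η i = 1 := fun i => by unfold η; split_ifs <;> norm_num
  have h1 : ∀ ν, η ν • (2 : ℝ) • (η μ * η ν * η ν) • gPoly u k μ ν ν =
      η μ • η ν • (2 * fronsdalPoly u k μ ν ν - (metric μ ν • fronsdalTrPoly u k ν
    + metric ν ν • fronsdalTrPoly u k μ + metric μ ν • fronsdalTrPoly u k ν)) := fun ν => by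
    rw [← two_smul_gPoly, mul_assoc, hη, mul_one]
    simp only [smul_smul]
    congr 1
    ring
  simp only [Pi.smul_apply, lower, tr3, smul_comm (2 : ℝ) (η _), Finset.smul_sum, h1]
  simp only [smul_smul, ← mul_assoc, hη, one_mul]
  simp only [sum_eta_smul]
  fin_cases μ <;>
  · simp [metric, η, fronsdalPoly, fronsdalTrPoly, eomTrSym, dot]
    ring

end FieldEquations

theorem two_smul_leftSym {A : Type} [CommRing A] [Algebra ℝ A]
    (G : (Fin 3 → A) → (Fin 3 → A) → (Fin 3 → A) → A) (t v₁ v₂ v₃ k w : Fin 3 → A) :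
    (2 : ℝ) • leftSym G t v₁ v₂ v₃ k w =
      leftSym ((2 : ℝ) • G) ((2 : ℝ) • t) v₁ v₂ v₃ k w := by
  have h1 : ∀ x : A, (2 : ℝ) • x = 2 * x := fun x => by
    rw [ofNat_smul_eq_nsmul, nsmul_eq_mul, Nat.cast_ofNat]
  have h2 : (2 : ℝ) • t = (2 : A) • t := funext fun i => h1 _
  simp only [leftSym, h2, h1, dot_smul_left, Pi.smul_apply]
  ring

theorem two_smul_rightSym {A : Type} [CommRing A] [Algebra ℝ A]
    (G : (Fin 3 → A) → (Fin 3 → A) → (Fin 3 → A) → A) (t v k w₁ w₂ w₃ l : Fin 3 → A) :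
    (2 : ℝ) • rightSym G t v k w₁ w₂ w₃ l =
      rightSym ((2 : ℝ) • G) ((2 : ℝ) • t) v k w₁ w₂ w₃ l := by
  have h1 : ∀ x : A, (2 : ℝ) • x = 2 * x := fun x => by
    rw [ofNat_smul_eq_nsmul, nsmul_eq_mul, Nat.cast_ofNat]
  have h2 : (2 : ℝ) • t = (2 : A) • t := funext fun i => h1 _
  simp only [rightSym, h2, h1, dot_smul_left, det_smul_left, Pi.smul_apply]
  ring

section Images

variable {A B : Type} [CommRing A] [CommRing B] (φ : A →+* B)

theorem map_eomSym (u k x y z : Fin 3 → A) :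
    φ (eomSym u k x y z) = eomSym (φ ∘ u) (φ ∘ k) (φ ∘ x) (φ ∘ y) (φ ∘ z) := by
  simp only [eomSym, fronsdalSym, fronsdalTrSym, map_add, map_sub, map_mul, map_ofNat, map_pow,
    map_dot]

theorem comp_eomTrSym (u k : Fin 3 → A) : φ ∘ eomTrSym u k = eomTrSym (φ ∘ u) (φ ∘ k) := by
  simp only [eomTrSym, comp_add_vector, comp_smul_vector, map_sub, map_mul, map_neg, map_ofNat,
    map_pow, map_dot]

theorem map_leftSym_eomSym (u p v₁ v₂ v₃ k w : Fin 3 → A) :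
    φ (leftSym (eomSym u p) (eomTrSym u p) v₁ v₂ v₃ k w) =
      leftSym (eomSym (φ ∘ u) (φ ∘ p)) (eomTrSym (φ ∘ u) (φ ∘ p)) (φ ∘ v₁) (φ ∘ v₂) (φ ∘ v₃)
        (φ ∘ k) (φ ∘ w) := by
  simp only [leftSym, map_sub, map_mul, map_ofNat, map_dot, map_det, map_eomSym, comp_eomTrSym]

theorem map_rightSym_eomSym (u p v k w₁ w₂ w₃ l : Fin 3 → A) :
    φ (rightSym (eomSym u p) (eomTrSym u p) v k w₁ w₂ w₃ l) =
      rightSym (eomSym (φ ∘ u) (φ ∘ p)) (eomTrSym (φ ∘ u) (φ ∘ p)) (φ ∘ v) (φ ∘ k) (φ ∘ w₁)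
        (φ ∘ w₂) (φ ∘ w₃) (φ ∘ l) := by
  simp only [rightSym, map_add, map_sub, map_neg, map_mul, map_ofNat, map_dot, map_det,
    map_eomSym, comp_eomTrSym]

theorem map_vertex (a₁ a₂ a₃ k b₁ b₂ b₃ l c₁ c₂ c₃ : Fin 3 → A) :
    φ (vertex a₁ a₂ a₃ k b₁ b₂ b₃ l c₁ c₂ c₃) = vertex (φ ∘ a₁) (φ ∘ a₂) (φ ∘ a₃) (φ ∘ k)
      (φ ∘ b₁) (φ ∘ b₂) (φ ∘ b₃) (φ ∘ l) (φ ∘ c₁) (φ ∘ c₂) (φ ∘ c₃) := by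
  simp only [vertex, vertexAC, vertexA, vertexAB, map_add, map_sub, map_neg, map_mul, map_ofNat,
    map_dot, map_det]

theorem map_vertexSym (a k b l w m : Fin 3 → A) :
    φ (vertexSym a k b l w m) =
      vertexSym (φ ∘ a) (φ ∘ k) (φ ∘ b) (φ ∘ l) (φ ∘ w) (φ ∘ m) := by
  simp only [vertexSym, map_add, map_sub, map_mul, map_ofNat, map_leftSym_eomSym,
    map_rightSym_eomSym, map_vertex]

end Images

theorem umbSum_hU_CU_hU {f : Fin N → Fin N → Fin N → ℝ} (hf : TotallyAntisymmetric f)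
    (p : TriPoly) :
    umbSum f hU CU hU p = -umbSum f hU hU CU (permSlots (Equiv.swap 1 2) p) := by
  rw [umbSum_swap_right (fun a b c => (hf a b c).2) CU_comm_hU, neg_one_smul]

/-- `γ a₀` has its ghost in any of the three slots. Moving it to the last one exchanges the first
two indices of `f`, which is where total antisymmetry goes beyond the assumption on `b, c`. -/
theorem umbSum_CU_hU_hU {f : Fin N → Fin N → Fin N → ℝ} (hf : TotallyAntisymmetric f)
    (p : TriPoly) :
    umbSum f CU hU hU p =
      umbSum f hU hU CU (permSlots (Equiv.swap 1 2) (permSlots (Equiv.swap 0 1) p)) := by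
  rw [umbSum_swap_left (fun a b c => (hf a b c).1) CU_comm_hU, neg_one_smul,
    umbSum_hU_CU_hU hf, neg_neg]

/-- The diagonal symbol of `8 a₀`. -/
def vertexPoly : TriPoly :=
  vertex (tv 0) (tv 0) (tv 0) (mv 0) (tv 1) (tv 1) (tv 1) (mv 1) (tv 2) (tv 2) (tv 2)

theorem gamma_a₀_umb {f : Fin N → Fin N → Fin N → ℝ} (hf : TotallyAntisymmetric f) :
    (24 : ℝ) • γ N (a₀ f) = umbSum f hU hU CU ((3 : ℝ) •
      (permSlots (Equiv.swap 1 2) (permSlots (Equiv.swap 0 1) (grad 0 vertexPoly))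
        - permSlots (Equiv.swap 1 2) (grad 1 vertexPoly) + grad 2 vertexPoly)) := by
  rw [a₀_umb, map_smul, map_smul, smul_smul, gamma_umbSum_vertex, umbSum_CU_hU_hU hf,
    umbSum_hU_CU_hU hf, ← sub_eq_add_neg, ← map_sub, ← map_add, map_smul]
  norm_num only
  rfl

theorem delta_a₁_umb_smul {f : Fin N → Fin N → Fin N → ℝ} (hf : TotallyAntisymmetric f) :
    (24 : ℝ) • δ N (a₁ f) = umbSum f hU hU CU ((2 : ℝ) •
      (leftSym (eomSym (tv 0) (mv 0)) (eomTrSym (tv 0) (mv 0)) (tv 1) (tv 1) (tv 1) (mv 2) (tv 2)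
      - permSlots (Equiv.swap 1 2) (rightSym (eomSym (tv 0) (mv 0)) (eomTrSym (tv 0) (mv 0))
          (tv 1) (mv 1) (tv 2) (tv 2) (tv 2) (mv 2)))) := by
  -- The factor `6` clears the denominators of `a₁`, one factor `2` those of the field equations,
  -- and the last `2` matches the `24 = 3 · 8` used for `a₀`.
  rw [delta_a₁_umb, umbSum_hU_CU_hU hf, ← sub_eq_add_neg, ← map_sub, ← map_smul,
    show (24 : ℝ) = 2 * 2 * 6 by norm_num, mul_smul, mul_smul, smul_sub (6 : ℝ),
    smul_sub (2 : ℝ) (_ • _), ← map_smul (permSlots _), ← map_smul (permSlots _),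
    six_smul_liftPolyLeft, six_smul_liftPolyRight, two_smul_leftSym, two_smul_rightSym,
    two_smul_contr3_gPoly, two_smul_lower_tr3_gPoly]

theorem gamma_a₀_add_delta_a₁ {f : Fin N → Fin N → Fin N → ℝ} (hf : TotallyAntisymmetric f) :
    (24 : ℝ) • (γ N (a₀ f) + δ N (a₁ f)) =
      umbSum f hU hU CU (vertexSym (tv 0) (mv 0) (tv 1) (mv 1) (tv 2) (mv 2)) := by
  have hs : ∀ (n : ℕ) (x : TriPoly), (n : ℝ) • x = (n : TriPoly) * x := fun n x => by
    rw [Nat.cast_smul_eq_nsmul, nsmul_eq_mul]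
  have h2 := hs 2
  have h3 := hs 3
  push_cast at h2 h3
  have e : ∀ (σ : Equiv.Perm (Fin 3)) (x : Fin 3 → TriPoly),
    (permSlots σ : TriPoly →+* TriPoly) ∘ x = permSlots σ ∘ x := fun _ _ => rfl
  have mV : ∀ (σ : Equiv.Perm (Fin 3)), _ := fun σ =>
    map_vertex (permSlots σ : TriPoly →+* TriPoly)
  have mR : ∀ (σ : Equiv.Perm (Fin 3)), _ := fun σ =>
    map_rightSym_eomSym (permSlots σ : TriPoly →+* TriPoly)
  simp only [e, RingHom.coe_coe] at mV mR
  rw [smul_add, gamma_a₀_umb hf, delta_a₁_umb_smul hf, ← map_add, h2, h3, vertexPoly,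
    deriv_vertex_left _ (grad_comp_mv _ _) (grad_comp_tv (by decide)) (grad_comp_mv _ _)
      (grad_comp_tv (by decide)),
    deriv_vertex_middle _ (grad_comp_tv (by decide)) (grad_comp_mv _ _) (grad_comp_mv _ _)
      (grad_comp_tv (by decide)),
    deriv_vertex_right _ (grad_comp_tv (by decide)) (grad_comp_mv _ _)
      (grad_comp_tv (by decide)) (grad_comp_mv _ _)]
  simp only [map_add, mV, mR, grad_comp_tv_self, permSlots_comp_tv, permSlots_comp_mv,
    Equiv.swap_apply_left, Equiv.swap_apply_right, swap_one_two_zero, swap_zero_one_two]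
  rw [← map_add]
  refine congrArg _ ?_
  rw [vertexSym]
  ring

/-- Only the ghost, in slot `2`, is traceless, so only its trace belongs to the ideal; eliminating
the momentum of the ghost leaves an identity symmetric in the roles of the two fields. -/
theorem vertexSym_mem : vertexSym (tv 0) (mv 0) (tv 1) (mv 1) (tv 2) (mv 2)
    - permSlots (Equiv.swap 0 1) (vertexSym (tv 0) (mv 0) (tv 1) (mv 1) (tv 2) (mv 2)) ∈
      divIdeal {2} := by
  rw [← Ideal.Quotient.eq_zero_iff_mem, map_sub]
  set q := Ideal.Quotient.mk (divIdeal {2}) with hq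
  have hm : q ∘ mv 2 = -(q ∘ mv 0) - q ∘ mv 1 := by
    have : q ∘ mv 0 = -(q ∘ mv 1) - q ∘ mv 2 := mv_zero_quotient _
    rw [this]; abel
  have h2 : permSlots (Equiv.swap 0 1) (vertexSym (tv 0) (mv 0) (tv 1) (mv 1) (tv 2) (mv 2)) =
      vertexSym (tv 1) (mv 1) (tv 0) (mv 0) (tv 2) (mv 2) := by
    refine (map_vertexSym (permSlots (Equiv.swap 0 1) : TriPoly →+* TriPoly) _ _ _ _ _ _).trans ?_
    simp only [RingHom.coe_coe, permSlots_comp_tv, permSlots_comp_mv, Equiv.swap_apply_left,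
      Equiv.swap_apply_right, swap_zero_one_two]
  have hw : dot (q ∘ tv 2) (q ∘ tv 2) = 0 := dot_tv_quotient (Set.mem_singleton _)
  rw [h2, map_vertexSym q, map_vertexSym q, hm]
  exact vertexSym_sub_swap hw (q ∘ tv 0) (q ∘ mv 0) (q ∘ tv 1) (q ∘ mv 1)

theorem gamma_a₀_mem_divergences {f : Fin N → Fin N → Fin N → ℝ}
    (hf : TotallyAntisymmetric f) : γ N (a₀ f) + δ N (a₁ f) ∈ divergences N := by
  have h1 := gamma_a₀_add_delta_a₁ hf
  set V := vertexSym (tv 0) (mv 0) (tv 1) (mv 1) (tv 2) (mv 2) with hV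
  -- Fields commute and `f` is antisymmetric, so symbols symmetric under exchange of the two field
  -- slots contribute nothing.
  have h2 : umbSum f hU hU CU V = -umbSum f hU hU CU (permSlots (Equiv.swap 0 1) V) := by
    have := umbSum_swap_left (fun a b c => (hf a b c).1) hU_comm CU V
    rwa [neg_one_smul] at this
  have h3 : umbSum f hU hU CU (V - permSlots (Equiv.swap 0 1) V) ∈ divergences N := by
    refine mem_divergences_of_mem_divIdeal (totalMom_mem_divergences hU_shift hU_shift CU_shift
      (fun a μ => hU_leib (totalDeriv_isDer μ) a)
      (fun a μ => hU_leib (totalDeriv_isDer μ) a)) ?_ vertexSym_mem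
    rintro s rfl p
    simp [umbSum_apply, umb_traceless_right (CU_traceless _)]
  rw [map_sub, sub_eq_add_neg, ← h2, ← h1, ← add_smul] at h3
  exact (Submodule.smul_mem_iff _ (by norm_num)).1 h3

/-! ### Ghost and antighost numbers -/

theorem Homog_mul {g g' : ℤ} {k k' : ℕ} {x y : Loc N} (hx : x ∈ Homog N g k)
    (hy : y ∈ Homog N g' k') : x * y ∈ Homog N (g + g') (k + k') := by
  refine Submodule.span_induction₂ (p := fun x y _ _ => x * y ∈ Homog N (g + g') (k + k'))
    ?_ ?_ ?_ ?_ ?_ ?_ ?_ hx hy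
  · rintro _ _ ⟨F, l, hl, hl', rfl⟩ ⟨F', m, hm, hm', rfl⟩
    refine Submodule.subset_span ⟨F * F', l ++ m, ?_, ?_, ?_⟩
    · rw [List.map_append, List.sum_append, hl, hm]
    · rw [List.map_append, List.sum_append, hl', hm']
    · rw [List.map_append, List.prod_append, map_mul, mul_assoc, mul_assoc, ← mul_assoc _ (ofField N F'),
        ← (ofField_commute F' _).eq, mul_assoc]
  · intro y _; simp
  · intro x _; simp
  · intro x y z _ _ _ h h'; rw [add_mul]; exact Submodule.add_mem _ h h'
  · intro x y z _ _ _ h h'; rw [mul_add]; exact Submodule.add_mem _ h h'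
  · intro r x y _ _ h; rw [smul_mul_assoc]; exact Submodule.smul_mem _ _ h
  · intro r x y _ _ h; rw [mul_smul_comm]; exact Submodule.smul_mem _ _ h

theorem gen_mem_Homog (y : Gen N) : gen y ∈ Homog N y.gh y.antigh :=
  Submodule.subset_span ⟨1, [y], by simp, by simp, by simp⟩

theorem hU_mem_Homog (a : Fin N) (s α) : hU a s α ∈ Homog N 0 0 :=
  slot3_induction (p := fun z => z ∈ Homog N 0 0) (Submodule.zero_mem _)
    (fun _ _ _ _ => Submodule.subset_span ⟨_, [], rfl, rfl, (mul_one _).symm⟩) s α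

theorem hsU_mem_Homog (a : Fin N) (s α) : hsU a s α ∈ Homog N (-1) 1 :=
  slot3_induction (p := fun z => z ∈ Homog N (-1) 1) (Submodule.zero_mem _)
    (fun x y z α => gen_mem_Homog (.hs a (sort3 x y z) α)) s α

theorem CU_mem_Homog (a : Fin N) (s α) : CU a s α ∈ Homog N 1 0 :=
  slot2_induction (p := fun z => z ∈ Homog N 1 0) (Submodule.zero_mem _)
    (fun x y α => gen_mem_Homog (.C a (sort2 x y) α)) s α

theorem umbSum_mem_Homog (f : Fin N → Fin N → Fin N → ℝ) {X Y Z : Fin N → Slot N} {g g' g'' : ℤ}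
    {k k' k'' : ℕ} (hX : ∀ a s α, X a s α ∈ Homog N g k) (hY : ∀ a s α, Y a s α ∈ Homog N g' k')
    (hZ : ∀ a s α, Z a s α ∈ Homog N g'' k'') (p : TriPoly) :
    umbSum f X Y Z p ∈ Homog N (g + g' + g'') (k + k' + k'') := by
  rw [umbSum_apply]
  refine Submodule.sum_mem _ fun a _ => Submodule.sum_mem _ fun b _ => Submodule.sum_mem _ fun c _ =>
    Submodule.smul_mem _ _ ?_
  induction p using MvPolynomial.induction_on' with
  | monomial m r =>
    rw [show MvPolynomial.monomial m r = r • MvPolynomial.monomial m (1 : ℝ) by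
      rw [MvPolynomial.smul_monomial, smul_eq_mul, mul_one], map_smul, umb_monomial]
    exact Submodule.smul_mem _ _ (Homog_mul (Homog_mul (hX _ _ _) (hY _ _ _)) (hZ _ _ _))
  | add p q hp hq =>
    rw [map_add]
    exact Submodule.add_mem _ hp hq

/-! ### The lifts and the invariant norm -/

theorem gamma_a₂ (f : Fin N → Fin N → Fin N → ℝ) : γ N (a₂ f) = 0 := by
  have dC : ∀ a x y α, γ N (C a x y α) = 0 := fun a x y α => gamma_gen _
  have l1 : ∀ a x y α w, γ N (Cs a x y α * w) = Cs a x y α * γ N w :=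
    fun a x y α w => by
      rw [gamma_isDer.leib_Cs a x y α w, show γ N (Cs a x y α) = 0 from gamma_gen _]; simp
  have l3 : ∀ a x y α w, γ N (C a x y α * w) = - (C a x y α * γ N w) :=
    fun a x y α w => by
      rw [gamma_isDer.leib_C a x y α w, dC]; simp
  simp only [a₂, T, map_sum, map_smul, mul_assoc, l1, l3, dC, map_sub, sub_zero, smul_zero,
    mul_zero, neg_zero, Finset.sum_const_zero]

theorem isLift_a₁ {f : Fin N → Fin N → Fin N → ℝ} (hf : ∀ a b c, f a b c = -f a c b) :
    IsLift₁ (a₁ f) (a₂ f) := by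
  refine ⟨?_, exists_totalDiv (gamma_a₁_mem_divergences hf)⟩
  rw [a₁_umb]
  exact Submodule.add_mem _
    (umbSum_mem_Homog f hsU_mem_Homog hU_mem_Homog CU_mem_Homog _)
    (umbSum_mem_Homog f hsU_mem_Homog CU_mem_Homog hU_mem_Homog _)

theorem isLift_a₀ {f : Fin N → Fin N → Fin N → ℝ} (hf : TotallyAntisymmetric f) :
    IsLift₀ (a₀ f) (a₁ f) := by
  refine ⟨?_, exists_totalDiv (gamma_a₀_mem_divergences hf)⟩
  rw [a₀_umb]
  exact umbSum_mem_Homog f hU_mem_Homog hU_mem_Homog hU_mem_Homog _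

theorem totallyAntisymmetric_iff_invariantNorm {f : Fin N → Fin N → Fin N → ℝ}
    (hf : ∀ a b c, f a b c = -f a c b) : TotallyAntisymmetric f ↔ InvariantNorm f := by
  have h1 : ∀ x y z : Fin N → ℝ, algMul f x y ⬝ᵥ z = ∑ a, ∑ b, ∑ c, f c a b * x a * y b * z c := by
    intro x y z
    simp only [dotProduct, algMul, Finset.sum_mul]
    rw [Finset.sum_comm]
    exact Finset.sum_congr rfl fun a _ => Finset.sum_comm
  have h2 : ∀ x y z : Fin N → ℝ, x ⬝ᵥ algMul f y z = ∑ a, ∑ b, ∑ c, f a b c * x a * y b * z c := by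
    intro x y z
    simp only [dotProduct, algMul, Finset.mul_sum]
    refine Finset.sum_congr rfl fun a _ => Finset.sum_congr rfl fun b _ =>
      Finset.sum_congr rfl fun c _ => ?_
    ring
  constructor
  · intro h x y z
    rw [h1, h2]
    refine Finset.sum_congr rfl fun a _ => Finset.sum_congr rfl fun b _ =>
      Finset.sum_congr rfl fun c _ => ?_
    rw [(h c a b).1, (h a c b).2, neg_neg]
  · intro h
    -- Basis vectors turn invariance into cyclicity of the indices, which together with one
    -- transposition generates all permutations with their signs.
    have key : ∀ a b c, f c a b = f a b c := by
      intro a b c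
      have := h (Pi.single a 1) (Pi.single b 1) (Pi.single c 1)
      rw [h1, h2] at this
      simpa [Pi.single_apply] using this
    intro a b c
    refine ⟨?_, hf a b c⟩
    rw [← key a b c, hf c a b, key b a c]

end Spin3

end

theorem mainTheorem3 (N : ℕ) (f : Fin N → Fin N → Fin N → ℝ)
    (hf : ∀ a b c, f a b c = -f a c b) :
    Spin3.γ N (Spin3.a₂ f) = 0 ∧
    Spin3.IsLift₁ (Spin3.a₁ f) (Spin3.a₂ f) ∧
    ((∃ a0, Spin3.IsLift₀ a0 (Spin3.a₁ f)) ↔ Spin3.TotallyAntisymmetric f) ∧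
    ((∃ a1 a0, Spin3.IsLift₁ a1 (Spin3.a₂ f) ∧ Spin3.IsLift₀ a0 a1) ↔
      Spin3.TotallyAntisymmetric f) ∧
    (Spin3.TotallyAntisymmetric f ↔ Spin3.InvariantNorm f) ∧
    (Spin3.TotallyAntisymmetric f → Spin3.IsLift₀ (Spin3.a₀ f) (Spin3.a₁ f)) := by
  have h1 := Spin3.isLift_a₁ hf
  refine ⟨Spin3.gamma_a₂ f, h1, ⟨?_, fun h => ⟨_, Spin3.isLift_a₀ h⟩⟩,
    ⟨?_, fun h => ⟨_, _, h1, Spin3.isLift_a₀ h⟩⟩,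
    Spin3.totallyAntisymmetric_iff_invariantNorm hf, Spin3.isLift_a₀⟩
  · rintro ⟨a0, h⟩; exact Spin3.totallyAntisymmetric_of_lift hf h1 h
  · rintro ⟨a1, a0, h, h'⟩; exact Spin3.totallyAntisymmetric_of_lift hf h h'
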